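/- **Setting.** Let $p,d,n\ge 1$ be integers and $r=pd$. Let $G(r,1,n)$ be the group of unitary transformations of $V=\mathbb{C}^n$ given by monomial matrices whose nonzero entries are $r$-th roots of unity, and let $G(r,p,n)$ be the normal subgroup of index $p$ of those for which the product of the nonzero entries is a $d$-th root of unity. For a finite group $W$ of unitary transformations of $V$ and a function $c$ on the reflections of $W$ invariant under conjugation by $W$, the rational Cherednik algebra $H_c(W)$ is generated by $x\in V^*$, $y\in V$, $w\in W$ with $[x,x']=[y,y']=0$, $wxw^{-1}=w(x)$, $wyw^{-1}=w(y)$ and $$[y,x]=\langle y,x\rangle+\sum_{H}\frac{\langle\alpha_H,y\rangle\langle x,v_H\rangle}{\langle\alpha_H,v_H\rangle}\sum_{g\in W_H\setminus\{1\}}c_g\,g ,$$ where $H$ runs over the reflection hyperplanes, $W_H$ is the pointwise stabilizer of $H$, $v_H$ is a normal vector of $H$ and $\alpha_H=\langle v_H,\cdot\rangle$. For a representation $\sigma$ of $W$ the module $\mathbb{C}[V]\otimes\sigma$ is $\Delta(\sigma)=H_c(W)\otimes_{\mathbb{C}[V^*]\rtimes W}\sigma$, with $V$ acting by $0$ on $\sigma$;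 it is called a standard module if $\sigma$ is irreducible. For a family $\lambda=(\lambda^i_j)_{i\in\mathbb{Z}/p,\,0\le j<d}$ of Young diagrams with $n$ cells in total, let $V(\lambda)$ be the representation of $G(r,1,n)$ with basis $v(T)$, $T$ a standard tableau of shape $\lambda$, on which a diagonal matrix $\mathrm{diag}(\theta_1,\dots,\theta_n)$ acts by $v(T)\mapsto\prod_k\theta_k^{d i_k+j_k}\,v(T)$, where $(i_k,j_k)$, $0\le i_k<p$, is the index of the diagram containing $k$, and the permutation matrix of $(a,a+1)$ acts by Young's seminormal form $v(T)\mapsto\alpha v(T)+(1+\alpha)v(T')$. Here $\alpha=1/(\mathrm{ct}(a+1)-\mathrm{ct}(a))$, with $\mathrm{ct}$ the content, if $a,a+1$ lie in the same diagram, and $\alpha=0$ otherwise; $T'$ is $T$ with $a,a+1$ interchanged, and $v(T')=0$ if $T'$ is not standard. Let $\mathrm{shift}(\lambda)=(\lambda^{i+1}_j)$ and shift tableaux likewise, let $\bar\lambda$ be the orbit of $\lambda$ under $\mathrm{shift}$, and let $e_\lambda=p/|\bar\lambda|$. For $\mu\in\bar\lambda$ and $l\in\mathbb{Z}$ let $V(\bar\lambda,l)$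 be the eigenspace in $V(\mu)$ of the operator $v(T)\mapsto v(\mathrm{shift}^{p/e_\lambda}T)$ for the eigenvalue $e^{2\pi i l/e_\lambda}$, which is a $G(r,p,n)$-subrepresentation of $V(\mu)$. **Statement.** Let $c$ be a $G(r,1,n)$-invariant function on the reflections of $G(r,1,n)$ with $c_g=0$ for all reflections $g\in G(r,1,n)\setminus G(r,p,n)$, and let $\mathrm{Res}'_{r,p,n}$ be restriction along the algebra homomorphism $H_c(G(r,p,n))\to H_c(G(r,1,n))$ that is the identity on $V^*$, $V$ and $G(r,p,n)$. Then for every $\lambda$, and for every choice of representative $\mu$ of $\bar\lambda$, the representations $V(\bar\lambda,l)$, $1\le l\le e_\lambda$, of $G(r,p,n)$ are irreducible and $$\mathrm{Res}'_{r,p,n}\bigl(\mathbb{C}[V]\otimes V(\lambda)\bigr)\cong\bigoplus_{l=1}^{e_\lambda}\mathbb{C}[V]\otimes V(\bar\lambda,l)$$ as $H_c(G(r,p,n))$-modules. In particular, for $r=p=2$, that is for $W(B_n)=G(2,1,n)\supset W(D_n)=G(2,2,n)$ and $\lambda=(\lambda_1,\lambda_2)$ a bipartition of $n$: one has $e_\lambda=2$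 if and only if $\lambda_1=\lambda_2$. If $\lambda_1\ne\lambda_2$, then the restriction $V(\bar\lambda)$ of $V(\mu)$ to $W(D_n)$ is irreducible and the restriction of $\mathbb{C}[\mathbb{C}^n]\otimes V(\lambda)$ to $H_c(W(D_n))$ is $\mathbb{C}[\mathbb{C}^n]\otimes V(\bar\lambda)$. If $\lambda_1=\lambda_2$, then $V(\bar\lambda,0)$ and $V(\bar\lambda,1)$ are irreducible and the restriction is $\mathbb{C}[\mathbb{C}^n]\otimes V(\bar\lambda,0)\oplus\mathbb{C}[\mathbb{C}^n]\otimes V(\bar\lambda,1)$. -/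

import Mathlib

open scoped TensorProduct DirectSum

set_option linter.unusedSectionVars false

namespace ImprimitiveCherednik

theorem swap_val {n : ℕ} (a b x : Fin n) :
    ((Equiv.swap a b x : Fin n) : ℕ) =
      if (x : ℕ) = a then (b : ℕ) else if (x : ℕ) = b then (a : ℕ) else x := by
  rw [Equiv.swap_apply_def]
  simp only [Fin.ext_iff]
  split_ifs <;> rfl

/-- A family `s 0, …, s (n-2)` of elements of a monoid satisfying the Coxeter relations of the
symmetric group extends to a homomorphism from the symmetric group. -/
theorem exists_perm_lift {M : Type*} [Monoid M] : ∀ (n : ℕ) (s : ℕ → M),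
    (∀ i, i + 1 < n → s i * s i = 1) →
    (∀ i, i + 2 < n → s i * s (i + 1) * s i = s (i + 1) * s i * s (i + 1)) →
    (∀ i j, i + 1 < j → j + 1 < n → s i * s j = s j * s i) →
    ∃ f : Equiv.Perm (Fin n) →* M, ∀ (i : ℕ) (h : i + 1 < n),
      f (Equiv.swap ⟨i, Nat.lt_of_succ_lt h⟩ ⟨i + 1, h⟩) = s i := by
  intro n
  induction n with
  | zero => exact fun s _ _ _ => ⟨1, fun i h => absurd h (by omega)⟩
  | succ n ih =>
    intro s hsq hbr hcm
    obtain ⟨φ, hφ⟩ := ih (fun i => s (i + 1)) (fun i hi => hsq _ (by omega))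
      (fun i hi => hbr _ (by omega)) (fun i j hij hj => hcm _ _ (by omega) (by omega))
    let c : ℕ → M := fun k => Nat.rec 1 (fun i x => s i * x) k
    have hc : ∀ k, c (k + 1) = s k * c k := fun k => rfl
    have c_far : ∀ k i, k < i → i < n → s i * c k = c k * s i := by
      intro k
      induction k with
      | zero => intro i _ _; show s i * 1 = 1 * s i; simp
      | succ k ihk =>
        intro i hki hi
        rw [hc, ← mul_assoc, ← hcm k i (by omega) (by omega), mul_assoc, ihk i (by omega) hi,
          mul_assoc]
    have c_near : ∀ k i, i + 1 < k → k ≤ n → s i * c k = c k * s (i + 1) := by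
      intro k
      induction k with
      | zero => intro i h; omega
      | succ k ihk =>
        intro i hik hk
        rcases Nat.lt_or_ge (i + 1) k with h | h
        · rw [hc, ← mul_assoc, hcm i k h (by omega), mul_assoc, ihk i h (by omega), mul_assoc]
        · obtain rfl : k = i + 1 := by omega
          rw [hc, hc, ← mul_assoc, ← mul_assoc, hbr i (by omega), mul_assoc, mul_assoc,
            c_far i (i + 1) (by omega) (by omega)]
          simp only [mul_assoc]
    have hdec : ∀ σ : Equiv.Perm (Fin (n + 1)), ∃ e : Equiv.Perm (Fin n),
        ∀ i : Fin n, σ i.succ = (σ 0).succAbove (e i) := by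
      intro σ
      have h1 : ∀ i : Fin n, ∃ j, (σ 0).succAbove j = σ i.succ := fun i =>
        Fin.exists_succAbove_eq (fun h => absurd (σ.injective h) (Fin.succ_ne_zero i))
      choose g hg using h1
      have hinj : Function.Injective g := by
        intro a b hab
        have := hg a
        rw [hab, hg b] at this
        exact (Fin.succ_injective _ (σ.injective this)).symm
      exact ⟨Equiv.ofBijective g (Finite.injective_iff_bijective.mp hinj), fun i => (hg i).symm⟩
    choose e he using hdec
    have he_unique : ∀ σ (g : Equiv.Perm (Fin n)),
        (∀ i : Fin n, σ i.succ = (σ 0).succAbove (g i)) → e σ = g := by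
      intro σ g hg
      ext1 i
      exact Fin.succAbove_right_injective ((he σ i).symm.trans (hg i))
    let F : Equiv.Perm (Fin (n + 1)) → M := fun σ => c (σ 0) * φ (e σ)
    have hF1 : F 1 = 1 := by
      have h : e 1 = 1 := he_unique 1 1 (fun i => by simp)
      show c ((1 : Equiv.Perm (Fin (n + 1))) 0) * φ (e 1) = 1
      rw [h]
      simp [c]
    have hsv : ∀ (k : Fin (n + 1)) (j : Fin n),
        ((k.succAbove j : Fin (n + 1)) : ℕ) = if (j : ℕ) < k then (j : ℕ) else j + 1 := by
      intro k j
      rw [Fin.succAbove]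
      simp only [Fin.lt_def, Fin.val_castSucc]
      split_ifs <;> rfl
    have hF : ∀ (i : ℕ) (h : i + 1 < n + 1) (σ : Equiv.Perm (Fin (n + 1))),
        F (Equiv.swap ⟨i, Nat.lt_of_succ_lt h⟩ ⟨i + 1, h⟩ * σ) = s i * F σ := by
      intro i h σ
      set t : Equiv.Perm (Fin (n + 1)) := Equiv.swap ⟨i, Nat.lt_of_succ_lt h⟩ ⟨i + 1, h⟩ with ht
      have htv : ∀ x : Fin (n + 1), ((t x : Fin (n + 1)) : ℕ) =
          if (x : ℕ) = i then i + 1 else if (x : ℕ) = i + 1 then i else x := by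
        intro x
        exact swap_val _ _ x
      show c ((t * σ) 0) * φ (e (t * σ)) = s i * (c (σ 0) * φ (e σ))
      rcases lt_trichotomy ((σ 0 : Fin (n + 1)) : ℕ) i with hk | hk | hk
      · obtain ⟨i, rfl⟩ : ∃ i', i = i' + 1 := ⟨i - 1, by omega⟩
        have h0 : (t * σ) 0 = σ 0 := by
          apply Fin.ext; rw [Equiv.Perm.mul_apply, htv]; split_ifs <;> omega
        have h1 : e (t * σ) = Equiv.swap ⟨i, by omega⟩ ⟨i + 1, by omega⟩ * e σ := by
          apply he_unique
          intro j
          rw [h0, Equiv.Perm.mul_apply, Equiv.Perm.mul_apply, he]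
          apply Fin.ext
          rw [htv, hsv, hsv, swap_val]
          dsimp only
          split_ifs <;> omega
        rw [h0, h1, map_mul, hφ i (by omega), ← mul_assoc, ← mul_assoc, c_far _ _ hk (by omega)]
      · have h0 : (((t * σ) 0 : Fin (n + 1)) : ℕ) = i + 1 := by
          rw [Equiv.Perm.mul_apply, htv, if_pos hk]
        have h1 : e (t * σ) = e σ := by
          apply he_unique
          intro j
          rw [Equiv.Perm.mul_apply, he]
          apply Fin.ext
          rw [htv, hsv, hsv, h0, hk]
          split_ifs <;> omega
        rw [h0, h1, hc, hk, mul_assoc]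
      · rcases Nat.lt_or_ge (i + 1) (σ 0 : Fin (n + 1)) with hk' | hk'
        · have h0 : (t * σ) 0 = σ 0 := by
            apply Fin.ext; rw [Equiv.Perm.mul_apply, htv]; split_ifs <;> omega
          have hlt := (σ 0).isLt
          have h1 : e (t * σ) = Equiv.swap ⟨i, by omega⟩ ⟨i + 1, by omega⟩ * e σ := by
            apply he_unique
            intro j
            rw [h0, Equiv.Perm.mul_apply, Equiv.Perm.mul_apply, he]
            apply Fin.ext
            rw [htv, hsv, hsv, swap_val]
            dsimp only
            split_ifs <;> omega
          rw [h0, h1, map_mul, hφ i (by omega), ← mul_assoc, ← mul_assoc,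
            c_near _ _ hk' (by omega)]
        · have hk2 : ((σ 0 : Fin (n + 1)) : ℕ) = i + 1 := by omega
          have h0 : (((t * σ) 0 : Fin (n + 1)) : ℕ) = i := by
            rw [Equiv.Perm.mul_apply, htv]; split_ifs <;> omega
          have h1 : e (t * σ) = e σ := by
            apply he_unique
            intro j
            rw [Equiv.Perm.mul_apply, he]
            apply Fin.ext
            rw [htv, hsv, hsv, h0, hk2]
            split_ifs <;> omega
          rw [h0, h1, hk2, hc, ← mul_assoc, ← mul_assoc, hsq i h, one_mul]
    have hmul : ∀ σ τ, F (σ * τ) = F σ * F τ := by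
      intro σ
      have hσ : σ ∈ Submonoid.closure
          (Set.range fun i : Fin n => Equiv.swap i.castSucc i.succ) := by
        rw [Equiv.Perm.mclosure_swap_castSucc_succ]; trivial
      induction hσ using Submonoid.closure_induction with
      | one => intro τ; rw [one_mul, hF1, one_mul]
      | mem x hx =>
        obtain ⟨i, rfl⟩ := hx
        intro τ
        have h := hF i (by omega)
        have h1 := h 1
        rw [mul_one, hF1, mul_one] at h1
        exact (h τ).trans (congrArg (· * F τ) h1.symm)
      | mul x y _ _ hx hy => intro τ; rw [mul_assoc, hx, hy, hx]; exact (mul_assoc (F x) (F y) (F τ)).symm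
    refine ⟨⟨⟨F, hF1⟩, hmul⟩, fun i h => ?_⟩
    have := hF i h 1
    rwa [mul_one, hF1, mul_one] at this

/-! ### Multipartitions, standard tableaux and the modules `V(λ)` -/

/-- A `p * d`-tuple `(λ^i_j)`, `i ∈ ℤ/p`, `0 ≤ j < d`, of Young diagrams with `n` cells in total. -/
@[ext]
structure MultiPartition (p d n : ℕ) [NeZero p] where
  shape : ZMod p → Fin d → YoungDiagram
  card_eq : ∑ i, ∑ j, (shape i j).card = n

/-- A cell of a multipartition: the index `(i, j)` of the diagram, then (row, column). -/
abbrev Box (p d : ℕ) := (ZMod p × Fin d) × (ℕ × ℕ)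

section Tableaux

variable {p d n : ℕ} [NeZero p]

/-- The shift operator `(λ^i_j) ↦ (λ^{i+1}_j)`. -/
def MultiPartition.shift (lam : MultiPartition p d n) : MultiPartition p d n where
  shape i j := lam.shape (i + 1) j
  card_eq := (Equiv.sum_comp (Equiv.addRight (1 : ZMod p))
    fun i => ∑ j, (lam.shape i j).card).trans lam.card_eq

/-- Two multipartitions are cyclically equivalent if some power of the shift maps one to the
other. -/
def CyclicEquiv (lam mu : MultiPartition p d n) : Prop :=
  ∃ k : ℕ, MultiPartition.shift^[k] lam = mu

/-- The number `e_λ = p / |λ̄|`, where `λ̄` is the cyclic equivalence class of `λ`. -/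
noncomputable def eNumber (lam : MultiPartition p d n) : ℕ :=
  p / {mu | CyclicEquiv lam mu}.ncard

/-- A filling `f` (the number `k` sits in the cell `f k`) is a standard tableau of shape `λ` if it
is a bijection onto the cells of `λ` and the numbers increase along rows and columns. -/
structure IsStd (lam : MultiPartition p d n) (f : Fin n → Box p d) : Prop where
  inj : Function.Injective f
  range_iff : ∀ b : Box p d, (∃ k, f k = b) ↔ b.2 ∈ lam.shape b.1.1 b.1.2
  mono : ∀ k l, (f k).1 = (f l).1 → (f k).2 ≤ (f l).2 → k ≤ l

/-- Standard tableaux of shape `λ`. -/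
abbrev StdTableau (lam : MultiPartition p d n) := {f : Fin n → Box p d // IsStd lam f}

/-- The vector space `V(λ)` with basis the symbols `v(T)`, `T` a standard tableau of shape `λ`. -/
abbrev VMod (lam : MultiPartition p d n) := StdTableau lam →₀ ℂ

open scoped Classical in
/-- The basis vector `v(f)` if `f` is a standard tableau of shape `λ`, and `0` otherwise. -/
noncomputable def vec (lam : MultiPartition p d n) (f : Fin n → Box p d) : VMod lam :=
  if h : IsStd lam f then Finsupp.single ⟨f, h⟩ 1 else 0

/-- The content (column minus row) of the number `k` in the filling `f`. -/
def content (f : Fin n → Box p d) (k : Fin n) : ℤ := ((f k).2.2 : ℤ) - (f k).2.1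

open scoped Classical in
/-- `1 / (c(b) - c(a))` if `a`, `b` lie in the same diagram, and `0` otherwise. -/
noncomputable def axial (f : Fin n → Box p d) (a b : Fin n) : ℂ :=
  if (f a).1 = (f b).1 then ((content f b - content f a : ℤ) : ℂ)⁻¹ else 0

/-- Young's seminormal form, for the transposition of `a` and `b = a + 1`:
`v(T) ↦ α v(T) + (1 + α) v(T')`, where `α = 1 / (c(b) - c(a))` if `a` and `b` lie in the same
diagram and `α = 0` otherwise, and `T'` is `T` with `a` and `b` interchanged
(`v(T') = 0` if `T'` is not standard). -/
noncomputable def swapOp (lam : MultiPartition p d n) (a b : Fin n) : Module.End ℂ (VMod lam) :=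
  Finsupp.linearCombination ℂ fun T : StdTableau lam =>
    axial T.1 a b • vec lam T.1 + (1 + axial T.1 a b) • vec lam (T.1 ∘ Equiv.swap a b)

/-- The diagonal matrix with entries `θ k` acts on `v(T)` by the product over `k` of
`(θ k) ^ (d * i + j)`, where `(i, j)` is the index of the diagram containing `k`. -/
noncomputable def torusOp (lam : MultiPartition p d n) (θ : Fin n → ℂ) :
    Module.End ℂ (VMod lam) :=
  Finsupp.linearCombination ℂ fun T : StdTableau lam =>
    (∏ k, θ k ^ (d * (T.1 k).1.1.val + ((T.1 k).1.2 : ℕ))) • vec lam T.1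

theorem vec_std {lam : MultiPartition p d n} (T : StdTableau lam) :
    vec lam T.1 = Finsupp.single T 1 := by
  rw [vec, dif_pos T.2]

theorem vec_not {lam : MultiPartition p d n} {f : Fin n → Box p d} (h : ¬ IsStd lam f) :
    vec lam f = 0 := by
  rw [vec, dif_neg h]

theorem end_ext {lam : MultiPartition p d n} {N : Type*} [AddCommMonoid N] [Module ℂ N]
    {A B : VMod lam →ₗ[ℂ] N} (h : ∀ f, IsStd lam f → A (vec lam f) = B (vec lam f)) : A = B := by
  refine Finsupp.lhom_ext' fun T => LinearMap.ext_ring ?_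
  have := h T.1 T.2
  rw [vec_std] at this
  exact this

theorem axial_swap (f : Fin n → Box p d) (a b : Fin n) : axial f b a = - axial f a b := by
  unfold axial
  by_cases h : (f a).1 = (f b).1
  · rw [if_pos h, if_pos h.symm, ← inv_neg]; push_cast; ring_nf
  · rw [if_neg h, if_neg (fun h' => h h'.symm), neg_zero]

theorem axial_comp (f : Fin n → Box p d) (s : Fin n → Fin n) (a b : Fin n) :
    axial (f ∘ s) a b = axial f (s a) (s b) := rfl

theorem IsStd.range_comp {lam : MultiPartition p d n} {f : Fin n → Box p d} (hf : IsStd lam f)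
    (s : Equiv.Perm (Fin n)) :
    Function.Injective (f ∘ s) ∧
      ∀ b : Box p d, (∃ k, (f ∘ s) k = b) ↔ b.2 ∈ lam.shape b.1.1 b.1.2 :=
  ⟨hf.inj.comp s.injective, fun b => by
    rw [← hf.range_iff]
    exact ⟨fun ⟨k, hk⟩ => ⟨s k, hk⟩, fun ⟨k, hk⟩ => ⟨s.symm k, by simpa using hk⟩⟩⟩

/-- In a standard tableau every cell weakly north-west of an occupied cell is occupied by a number
that is at most as large. -/
theorem IsStd.exists_le {lam : MultiPartition p d n} {f : Fin n → Box p d} (hf : IsStd lam f)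
    (k : Fin n) (x : ℕ × ℕ) (hx : x ≤ (f k).2) : ∃ m, f m = ((f k).1, x) ∧ m ≤ k := by
  have h1 : x ∈ lam.shape (f k).1.1 (f k).1.2 :=
    (lam.shape _ _).isLowerSet hx ((hf.range_iff (f k)).1 ⟨k, rfl⟩)
  obtain ⟨m, hm⟩ := (hf.range_iff ((f k).1, x)).2 h1
  exact ⟨m, hm, hf.mono m k (by rw [hm]) (by rw [hm]; exact hx)⟩

theorem IsStd.content_lt {lam : MultiPartition p d n} {f : Fin n → Box p d} (hf : IsStd lam f)
    {a b : Fin n} (hab : a < b) (hc : (f a).1 = (f b).1) (h : content f a = content f b) :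
    (a : ℕ) + 3 ≤ b := by
  unfold content at h
  have hne : (f a).2 ≠ (f b).2 := fun h' => hab.ne (hf.inj (Prod.ext hc h'))
  have hlt : (f a).2.1 < (f b).2.1 := by
    by_contra hcon
    have : b ≤ a := hf.mono b a hc.symm (Prod.le_def.2 ⟨by omega, by omega⟩)
    exact absurd hab (not_lt.2 this)
  obtain ⟨m, hm, hmb⟩ := hf.exists_le b ((f a).2.1 + 1, (f a).2.2)
    (Prod.le_def.2 ⟨by simp; omega, by simp; omega⟩)
  obtain ⟨l, hl, hlb⟩ := hf.exists_le b ((f a).2.1, (f a).2.2 + 1)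
    (Prod.le_def.2 ⟨by simp; omega, by simp; omega⟩)
  have ham : a ≤ m := hf.mono a m (by rw [hm, hc]) (by rw [hm]; exact Prod.le_def.2 ⟨by simp, le_rfl⟩)
  have hal : a ≤ l := hf.mono a l (by rw [hl, hc]) (by rw [hl]; exact Prod.le_def.2 ⟨le_rfl, by simp⟩)
  have h1 : m ≠ a := by
    intro h'; rw [h'] at hm; have := congrArg (fun x : Box p d => x.2.1) hm; simp at this
  have h2 : l ≠ a := by
    intro h'; rw [h'] at hl; have := congrArg (fun x : Box p d => x.2.2) hl; simp at this
  have h3 : m ≠ b := by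
    intro h'; rw [h'] at hm; have := congrArg (fun x : Box p d => x.2.2) hm; simp at this; omega
  have h4 : l ≠ b := by
    intro h'; rw [h'] at hl; have := congrArg (fun x : Box p d => x.2.1) hl; simp at this; omega
  have h5 : m ≠ l := by
    intro h'; rw [h', hl] at hm; have := congrArg (fun x : Box p d => x.2.1) hm; simp at this
  simp only [Fin.le_def, Fin.ext_iff, ne_eq] at *
  omega

theorem IsStd.axial_sq {lam : MultiPartition p d n} {f : Fin n → Box p d} (hf : IsStd lam f)
    {a b : Fin n} (hab : (a : ℕ) + 1 = b) (hs : ¬ IsStd lam (f ∘ Equiv.swap a b)) :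
    axial f a b ^ 2 = 1 := by
  have hcomp := hf.range_comp (Equiv.swap a b)
  have : ∃ k l, (f k).1 = (f l).1 ∧ (f k).2 ≤ (f l).2 ∧
      ¬ (Equiv.swap a b k ≤ Equiv.swap a b l) := by
    by_contra hcon
    push Not at hcon
    refine hs ⟨hcomp.1, hcomp.2, fun k l h1 h2 => ?_⟩
    simpa using hcon _ _ h1 h2
  obtain ⟨k, l, h1, h2, h3⟩ := this
  have hkl := hf.mono k l h1 h2
  have hk : k = a ∧ l = b := by
    simp only [Fin.le_def, swap_val, Fin.ext_iff] at *
    split_ifs at h3 <;> omega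
  obtain ⟨rfl, rfl⟩ := hk
  have hne : k ≠ l := fun h => by rw [h] at hab; omega
  have key : content f l - content f k = 1 ∨ content f l - content f k = -1 := by
    unfold content
    have h21 := (Prod.le_def.1 h2).1
    have h22 := (Prod.le_def.1 h2).2
    rcases Nat.lt_or_ge (f k).2.1 (f l).2.1 with h | h
    · obtain ⟨m, hm, hml⟩ := hf.exists_le l ((f k).2.1 + 1, (f k).2.2)
        (Prod.le_def.2 ⟨by simp; omega, by simp; omega⟩)
      have hkm : k ≤ m := hf.mono k m (by rw [hm, h1])
        (by rw [hm]; exact Prod.le_def.2 ⟨by simp, le_rfl⟩)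
      have hmk : m ≠ k := by
        intro h'; rw [h'] at hm; have := congrArg (fun x : Box p d => x.2.1) hm; simp at this
      have : m = l := by
        simp only [Fin.le_def, Fin.ext_iff, ne_eq] at *; omega
      rw [this] at hm
      have e1 := congrArg (fun x : Box p d => x.2.1) hm
      have e2 := congrArg (fun x : Box p d => x.2.2) hm
      simp only at e1 e2
      right; omega
    · rcases Nat.lt_or_ge (f k).2.2 (f l).2.2 with h' | h'
      · obtain ⟨m, hm, hml⟩ := hf.exists_le l ((f k).2.1, (f k).2.2 + 1)
          (Prod.le_def.2 ⟨by simp; omega, by simp; omega⟩)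
        have hkm : k ≤ m := hf.mono k m (by rw [hm, h1])
          (by rw [hm]; exact Prod.le_def.2 ⟨le_rfl, by simp⟩)
        have hmk : m ≠ k := by
          intro h'; rw [h'] at hm; have := congrArg (fun x : Box p d => x.2.2) hm; simp at this
        have : m = l := by
          simp only [Fin.le_def, Fin.ext_iff, ne_eq] at *; omega
        rw [this] at hm
        have e1 := congrArg (fun x : Box p d => x.2.1) hm
        have e2 := congrArg (fun x : Box p d => x.2.2) hm
        simp only at e1 e2
        left; omega
      · exact absurd (hf.inj (Prod.ext h1 (Prod.ext (by omega) (by omega)))) hne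
  unfold axial
  rw [if_pos h1]
  rcases key with h | h <;> rw [h] <;> norm_num

open scoped Classical in
/-- The coefficient `1 + α`, replaced by `0` when `α = ±1`. -/
noncomputable def coeffAux (α : ℂ) : ℂ := if α ^ 2 = 1 then 0 else 1 + α

theorem coeffAux_mul (α : ℂ) : coeffAux α * coeffAux (-α) = 1 - α ^ 2 := by
  unfold coeffAux
  by_cases h : α ^ 2 = 1
  · rw [if_pos h, h]; ring
  · rw [if_neg h, if_neg (by rwa [neg_sq])]; ring

theorem swapOp_vec (lam : MultiPartition p d n) {a b : Fin n} (hab : (a : ℕ) + 1 = b)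
    (f : Fin n → Box p d) :
    swapOp lam a b (vec lam f) =
      axial f a b • vec lam f + coeffAux (axial f a b) • vec lam (f ∘ Equiv.swap a b) := by
  by_cases hf : IsStd lam f
  · have h1 : swapOp lam a b (vec lam f) =
        axial f a b • vec lam f + (1 + axial f a b) • vec lam (f ∘ Equiv.swap a b) := by
      have := vec_std (⟨f, hf⟩ : StdTableau lam)
      simp only at this
      rw [swapOp, this, Finsupp.linearCombination_single, one_smul, this]
    rw [h1]
    congr 1
    unfold coeffAux
    split_ifs with h
    · have : ¬ IsStd lam (f ∘ Equiv.swap a b) := by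
        intro hs
        by_cases hc : (f a).1 = (f b).1
        · rw [axial, if_pos hc] at h
          have hd : content f b - content f a = 1 ∨ content f b - content f a = -1 := by
            rw [inv_pow, inv_eq_one] at h
            exact sq_eq_one_iff.1 (by exact_mod_cast h)
          have n1 : ¬ (f a).2 ≤ (f b).2 := fun hle => by
            have := hs.mono b a (by simpa using hc) (by simpa using hle)
            rw [Fin.le_def] at this; omega
          have n2 : ¬ (f b).2 ≤ (f a).2 := fun hle => by
            have := hf.mono b a hc.symm hle
            rw [Fin.le_def] at this; omega
          rw [Prod.le_def] at n1 n2
          unfold content at hd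
          omega
        · rw [axial, if_neg hc] at h; norm_num at h
      rw [vec_not this, smul_zero, smul_zero]
    · rfl
  · rw [vec_not hf, map_zero, smul_zero, zero_add]
    by_cases hs : IsStd lam (f ∘ Equiv.swap a b)
    · have h2 := hs.axial_sq hab (by
        rwa [Function.comp_assoc, ← Equiv.Perm.coe_mul, Equiv.swap_mul_self, Equiv.Perm.coe_one,
          Function.comp_id])
      rw [axial_comp, Equiv.swap_apply_left, Equiv.swap_apply_right, axial_swap, neg_sq] at h2
      rw [coeffAux, if_pos h2, zero_smul]
    · rw [vec_not hs, smul_zero]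

theorem swapOp_sq (lam : MultiPartition p d n) {a b : Fin n} (hab : (a : ℕ) + 1 = b) :
    swapOp lam a b * swapOp lam a b = 1 := by
  refine end_ext fun f _ => ?_
  have e1 : (f ∘ Equiv.swap a b) ∘ Equiv.swap a b = f := by
    funext x; simp
  have h := coeffAux_mul (axial f a b)
  rw [Module.End.mul_apply, swapOp_vec lam hab, map_add, map_smul, map_smul, swapOp_vec lam hab,
    swapOp_vec lam hab, e1, axial_comp, Equiv.swap_apply_left, Equiv.swap_apply_right,
    axial_swap f a b, Module.End.one_apply]
  match_scalars
  · linear_combination h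
  · ring

theorem swapOp_comm (lam : MultiPartition p d n) {a b c e : Fin n} (hab : (a : ℕ) + 1 = b)
    (hbc : (b : ℕ) < c) (hce : (c : ℕ) + 1 = e) :
    swapOp lam a b * swapOp lam c e = swapOp lam c e * swapOp lam a b := by
  refine end_ext fun f _ => ?_
  have hac : a ≠ c := by rw [Ne, Fin.ext_iff]; omega
  have hae : a ≠ e := by rw [Ne, Fin.ext_iff]; omega
  have hbc' : b ≠ c := by rw [Ne, Fin.ext_iff]; omega
  have hbe : b ≠ e := by rw [Ne, Fin.ext_iff]; omega
  have e1 : (f ∘ Equiv.swap a b) ∘ Equiv.swap c e = (f ∘ Equiv.swap c e) ∘ Equiv.swap a b := by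
    funext x
    simp only [Function.comp_apply, Equiv.swap_apply_def]
    congr 1
    split_ifs <;> simp_all
  simp only [Module.End.mul_apply, swapOp_vec lam hab, swapOp_vec lam hce, map_add, map_smul,
    axial_comp, e1, Equiv.swap_apply_of_ne_of_ne hac hae, Equiv.swap_apply_of_ne_of_ne hbc' hbe,
    Equiv.swap_apply_of_ne_of_ne hac.symm hbc'.symm, Equiv.swap_apply_of_ne_of_ne hae.symm hbe.symm]
  match_scalars <;> ring

theorem axial_identity {lam : MultiPartition p d n} {f : Fin n → Box p d} (hf : IsStd lam f)
    {a b c : Fin n} (hab : (a : ℕ) + 1 = b) (hbc : (b : ℕ) + 1 = c) :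
    axial f a b * axial f b c = axial f a c * (axial f a b + axial f b c) := by
  unfold axial
  by_cases h1 : (f a).1 = (f b).1
  · by_cases h2 : (f b).1 = (f c).1
    · rw [if_pos h1, if_pos h2, if_pos (h1.trans h2)]
      have n1 : ((content f b - content f a : ℤ) : ℂ) ≠ 0 := by
        rw [Int.cast_ne_zero, sub_ne_zero]
        intro h
        have := hf.content_lt (Fin.lt_def.2 (by omega)) h1 h.symm
        omega
      have n2 : ((content f c - content f b : ℤ) : ℂ) ≠ 0 := by
        rw [Int.cast_ne_zero, sub_ne_zero]
        intro h
        have := hf.content_lt (Fin.lt_def.2 (by omega)) h2 h.symm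
        omega
      have n3 : ((content f c - content f a : ℤ) : ℂ) ≠ 0 := by
        rw [Int.cast_ne_zero, sub_ne_zero]
        intro h
        have := hf.content_lt (Fin.lt_def.2 (by omega)) (h1.trans h2) h.symm
        omega
      field_simp
      push_cast
      ring
    · rw [if_neg h2, if_neg (fun h => h2 (h1.symm.trans h))]; ring
  · by_cases h2 : (f b).1 = (f c).1
    · rw [if_neg h1, if_pos h2, if_neg (fun h => h1 (h.trans h2.symm))]; ring
    · rw [if_neg h1, if_neg h2]; ring

theorem swapOp_braid (lam : MultiPartition p d n) {a b c : Fin n} (hab : (a : ℕ) + 1 = b)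
    (hbc : (b : ℕ) + 1 = c) :
    swapOp lam a b * swapOp lam b c * swapOp lam a b =
      swapOp lam b c * swapOp lam a b * swapOp lam b c := by
  refine end_ext fun f hf => ?_
  have nab : a ≠ b := by rw [Ne, Fin.ext_iff]; omega
  have nac : a ≠ c := by rw [Ne, Fin.ext_iff]; omega
  have nbc : b ≠ c := by rw [Ne, Fin.ext_iff]; omega
  have e1 : (f ∘ Equiv.swap a b) ∘ Equiv.swap a b = f := by
    funext x; simp
  have e2 : (f ∘ Equiv.swap b c) ∘ Equiv.swap b c = f := by
    funext x; simp
  have e3 : ((f ∘ Equiv.swap a b) ∘ Equiv.swap b c) ∘ Equiv.swap a b =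
      ((f ∘ Equiv.swap b c) ∘ Equiv.swap a b) ∘ Equiv.swap b c := by
    funext x
    simp only [Function.comp_apply, Equiv.swap_apply_def]
    congr 1
    split_ifs <;> simp_all
  have v1 : Equiv.swap a b c = c := Equiv.swap_apply_of_ne_of_ne nac.symm nbc.symm
  have v2 : Equiv.swap b c a = a := Equiv.swap_apply_of_ne_of_ne nab nac
  have h1 := coeffAux_mul (axial f a b)
  have h2 := coeffAux_mul (axial f b c)
  have h3 := axial_identity hf hab hbc
  simp only [Module.End.mul_apply, swapOp_vec lam hab, swapOp_vec lam hbc, map_add, map_smul,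
    axial_comp, Equiv.swap_apply_left, Equiv.swap_apply_right, v1, v2, e1, e2,
    e3, axial_swap f a b, axial_swap f b c]
  generalize axial f a b = x at *
  generalize axial f b c = y at *
  generalize axial f a c = z at *
  match_scalars
  · linear_combination z * h1 - z * h2 + (x - y) * h3
  · linear_combination coeffAux x * h3
  · linear_combination (-coeffAux y) * h3
  · ring
  · ring
  · ring

theorem torusOp_vec (lam : MultiPartition p d n) (θ : Fin n → ℂ) (f : Fin n → Box p d) :
    torusOp lam θ (vec lam f) =
      (∏ k, θ k ^ (d * (f k).1.1.val + ((f k).1.2 : ℕ))) • vec lam f := by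
  by_cases hf : IsStd lam f
  · have := vec_std (⟨f, hf⟩ : StdTableau lam)
    simp only at this
    rw [torusOp, this, Finsupp.linearCombination_single, one_smul, this]
  · rw [vec_not hf, map_zero, smul_zero]

theorem torusOp_one (lam : MultiPartition p d n) : torusOp lam (fun _ => 1) = 1 := by
  refine end_ext fun f _ => ?_
  rw [torusOp_vec]
  simp

theorem torusOp_mul (lam : MultiPartition p d n) (θ θ' : Fin n → ℂ) :
    torusOp lam (fun i => θ i * θ' i) = torusOp lam θ * torusOp lam θ' := by
  refine end_ext fun f _ => ?_
  rw [Module.End.mul_apply, torusOp_vec, torusOp_vec, map_smul, torusOp_vec, smul_smul,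
    ← Finset.prod_mul_distrib]
  congr 1
  exact Finset.prod_congr rfl fun k _ => by rw [mul_pow, mul_comm]

theorem swapOp_torusOp (lam : MultiPartition p d n) {a b : Fin n} (hab : (a : ℕ) + 1 = b)
    (θ : Fin n → ℂ) :
    swapOp lam a b * torusOp lam θ =
      torusOp lam (fun i => θ (Equiv.swap a b i)) * swapOp lam a b := by
  refine end_ext fun f _ => ?_
  have h1 : (∏ k, θ (Equiv.swap a b k) ^ (d * ((f ∘ Equiv.swap a b) k).1.1.val +
      (((f ∘ Equiv.swap a b) k).1.2 : ℕ))) =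
      ∏ k, θ k ^ (d * (f k).1.1.val + ((f k).1.2 : ℕ)) :=
    Equiv.prod_comp (Equiv.swap a b) fun k => θ k ^ (d * (f k).1.1.val + ((f k).1.2 : ℕ))
  have h2 : axial f a b * (∏ k, θ (Equiv.swap a b k) ^ (d * (f k).1.1.val + ((f k).1.2 : ℕ))) =
      axial f a b * ∏ k, θ k ^ (d * (f k).1.1.val + ((f k).1.2 : ℕ)) := by
    by_cases hc : (f a).1 = (f b).1
    · rw [← h1]
      congr 1
      refine Finset.prod_congr rfl fun k _ => ?_
      have : ((f ∘ Equiv.swap a b) k).1 = (f k).1 := by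
        simp only [Function.comp_apply, Equiv.swap_apply_def]
        split_ifs with h h'
        · rw [h, hc]
        · rw [h', hc]
        · rfl
      rw [this]
    · rw [axial, if_neg hc, zero_mul, zero_mul]
  rw [Module.End.mul_apply, Module.End.mul_apply, torusOp_vec, map_smul, swapOp_vec lam hab,
    map_add, map_smul, map_smul, torusOp_vec, torusOp_vec, h1, smul_smul, h2, smul_add, smul_smul,
    smul_comm, mul_comm]

theorem exists_permRep (lam : MultiPartition p d n) :
    ∃ f : Equiv.Perm (Fin n) →* Module.End ℂ (VMod lam), ∀ (i : ℕ) (h : i + 1 < n),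
      f (Equiv.swap ⟨i, Nat.lt_of_succ_lt h⟩ ⟨i + 1, h⟩) =
        swapOp lam ⟨i, Nat.lt_of_succ_lt h⟩ ⟨i + 1, h⟩ := by
  obtain ⟨f, hf⟩ := exists_perm_lift n
    (fun i => if h : i + 1 < n then swapOp lam ⟨i, Nat.lt_of_succ_lt h⟩ ⟨i + 1, h⟩ else 1)
    (fun i h => by
      simp only [dif_pos h]
      exact swapOp_sq lam rfl)
    (fun i h => by
      simp only [dif_pos h, dif_pos (show i + 1 < n by omega)]
      exact swapOp_braid lam rfl rfl)
    (fun i j hij hj => by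
      simp only [dif_pos hj, dif_pos (show i + 1 < n by omega)]
      exact swapOp_comm lam rfl hij rfl)
  exact ⟨f, fun i h => by rw [hf i h, dif_pos h]⟩

/-- The action of the permutation matrices on `V(λ)`: the representation of the symmetric group in
which each adjacent transposition acts by `swapOp`. -/
noncomputable def permRep (lam : MultiPartition p d n) :
    Equiv.Perm (Fin n) →* Module.End ℂ (VMod lam) :=
  (exists_permRep lam).choose

theorem permRep_swap (lam : MultiPartition p d n) (i : ℕ) (h : i + 1 < n) :
    permRep lam (Equiv.swap ⟨i, Nat.lt_of_succ_lt h⟩ ⟨i + 1, h⟩) =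
      swapOp lam ⟨i, Nat.lt_of_succ_lt h⟩ ⟨i + 1, h⟩ :=
  (exists_permRep lam).choose_spec i h

/-- Induction on permutations, by left multiplication with adjacent transpositions. -/
theorem perm_induction {n : ℕ} {P : Equiv.Perm (Fin n) → Prop} (h1 : P 1)
    (hs : ∀ (i : ℕ) (h : i + 1 < n), P (Equiv.swap ⟨i, Nat.lt_of_succ_lt h⟩ ⟨i + 1, h⟩))
    (hm : ∀ σ τ, P σ → P τ → P (σ * τ)) (σ : Equiv.Perm (Fin n)) : P σ := by
  cases n with
  | zero => rwa [Subsingleton.elim σ 1]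
  | succ n =>
    have hσ : σ ∈ Submonoid.closure
        (Set.range fun i : Fin n => Equiv.swap i.castSucc i.succ) := by
      rw [Equiv.Perm.mclosure_swap_castSucc_succ]; trivial
    induction hσ using Submonoid.closure_induction with
    | one => exact h1
    | mem x hx => obtain ⟨i, rfl⟩ := hx; exact hs i (by omega)
    | mul x y _ _ hx hy => exact hm _ _ hx hy

theorem permRep_torusOp (lam : MultiPartition p d n) (σ : Equiv.Perm (Fin n)) :
    ∀ θ : Fin n → ℂ, permRep lam σ * torusOp lam θ =
      torusOp lam (fun i => θ (σ.symm i)) * permRep lam σ := by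
  refine perm_induction (P := fun σ => ∀ θ : Fin n → ℂ, permRep lam σ * torusOp lam θ =
      torusOp lam (fun i => θ (σ.symm i)) * permRep lam σ) ?_ ?_ ?_ σ
  · intro θ; rw [map_one, one_mul, mul_one]; rfl
  · intro i h θ
    rw [permRep_swap, swapOp_torusOp lam rfl, Equiv.symm_swap]
  · intro σ τ hσ hτ θ
    rw [map_mul, mul_assoc, hτ, ← mul_assoc, hσ, mul_assoc]; rfl

/-- The shift of fillings `(T^i_j) ↦ (T^{i+1}_j)`, iterated `m` times: a number in the diagram with
index `(i, j)` moves to the same cell of the diagram with index `(i - m, j)`. -/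
def shiftFilling (m : ℕ) (f : Fin n → Box p d) : Fin n → Box p d :=
  fun k => (((f k).1.1 - (m : ZMod p), (f k).1.2), (f k).2)

/-- The linear map `v(T) ↦ v(shift^m T)` on `V(λ)`; used for `m` with `shift^m λ = λ`. -/
noncomputable def shiftOp (lam : MultiPartition p d n) (m : ℕ) : Module.End ℂ (VMod lam) :=
  Finsupp.linearCombination ℂ fun T : StdTableau lam => vec lam (shiftFilling m T.1)

theorem shiftOp_vec {lam : MultiPartition p d n} (m : ℕ) {f : Fin n → Box p d}
    (hf : IsStd lam f) : shiftOp lam m (vec lam f) = vec lam (shiftFilling m f) := by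
  have := vec_std (⟨f, hf⟩ : StdTableau lam)
  simp only at this
  rw [shiftOp, this, Finsupp.linearCombination_single, one_smul]

theorem shiftFilling_fst_eq (m : ℕ) (f : Fin n → Box p d) (a b : Fin n) :
    (shiftFilling m f a).1 = (shiftFilling m f b).1 ↔ (f a).1 = (f b).1 := by
  simp [shiftFilling, Prod.ext_iff]

theorem axial_shiftFilling (m : ℕ) (f : Fin n → Box p d) (a b : Fin n) :
    axial (shiftFilling m f) a b = axial f a b := by
  unfold axial
  simp only [shiftFilling_fst_eq]
  rfl

theorem shiftOp_swapOp (lam : MultiPartition p d n) (m : ℕ) {a b : Fin n}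
    (hab : (a : ℕ) + 1 = b) :
    shiftOp lam m * swapOp lam a b = swapOp lam a b * shiftOp lam m := by
  refine end_ext fun f hf => ?_
  have e1 : shiftFilling m (f ∘ Equiv.swap a b) = shiftFilling m f ∘ Equiv.swap a b := rfl
  rw [Module.End.mul_apply, Module.End.mul_apply, swapOp_vec lam hab, shiftOp_vec m hf,
    swapOp_vec lam hab, map_add, map_smul, map_smul, shiftOp_vec m hf, axial_shiftFilling]
  congr 2
  by_cases hs : IsStd lam (f ∘ Equiv.swap a b)
  · rw [shiftOp_vec m hs, e1]
  · rw [vec_not hs, map_zero, vec_not]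
    intro hs'
    refine hs ⟨hf.inj.comp (Equiv.injective _), (hf.range_comp _).2, fun k l h1 h2 => ?_⟩
    exact hs'.mono k l ((shiftFilling_fst_eq m (f ∘ Equiv.swap a b) k l).2 h1) h2

theorem shiftOp_permRep (lam : MultiPartition p d n) (m : ℕ) (σ : Equiv.Perm (Fin n)) :
    shiftOp lam m * permRep lam σ = permRep lam σ * shiftOp lam m := by
  refine perm_induction (P := fun σ => shiftOp lam m * permRep lam σ =
    permRep lam σ * shiftOp lam m) ?_ ?_ ?_ σ
  · rw [map_one, one_mul, mul_one]
  · intro i h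
    rw [permRep_swap, shiftOp_swapOp lam m rfl]
  · intro σ τ hσ hτ
    rw [map_mul, ← mul_assoc, hσ, mul_assoc, hτ, mul_assoc]

theorem pow_val_sub (d m : ℕ) (i : ZMod p) {z : ℂ} (hz : z ^ (p * d) = 1) :
    z ^ (d * i.val) = z ^ (d * (i - (m : ZMod p)).val) * (z ^ d) ^ m := by
  have h1 : (z ^ d) ^ p = 1 := by rw [← pow_mul, mul_comm, hz]
  have h2 : i.val % p = ((i - (m : ZMod p)).val + m) % p := by
    have : ((i.val : ℕ) : ZMod p) = (((i - (m : ZMod p)).val + m : ℕ) : ZMod p) := by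
      push_cast
      rw [ZMod.natCast_zmod_val, ZMod.natCast_zmod_val, sub_add_cancel]
    exact (ZMod.natCast_eq_natCast_iff' _ _ _).1 this
  rw [pow_mul, pow_mul, ← pow_add, pow_eq_pow_mod _ h1, h2, ← pow_eq_pow_mod _ h1]

theorem shiftOp_torusOp (lam : MultiPartition p d n) (m : ℕ) {θ : Fin n → ℂ}
    (h1 : ∀ i, θ i ^ (p * d) = 1) (h2 : (∏ i, θ i) ^ d = 1) :
    shiftOp lam m * torusOp lam θ = torusOp lam θ * shiftOp lam m := by
  refine end_ext fun f hf => ?_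
  rw [Module.End.mul_apply, Module.End.mul_apply, torusOp_vec, map_smul, shiftOp_vec m hf,
    torusOp_vec]
  congr 1
  have h3 : ∏ k, (θ k ^ d) ^ m = 1 := by
    rw [Finset.prod_pow, Finset.prod_pow, h2, one_pow]
  rw [← mul_one (∏ k, θ k ^ (d * (shiftFilling m f k).1.1.val + _)), ← h3,
    ← Finset.prod_mul_distrib]
  refine Finset.prod_congr rfl fun k _ => ?_
  rw [pow_add, pow_add, pow_val_sub d m _ (h1 k)]
  simp only [shiftFilling]
  ring

end Tableaux

/-! ### The groups `G(r, p, n)` -/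

/-- `w` acts by the monomial matrix with `w e_j = θ (σ j) e_{σ j}`. -/
def IsMonomial {n : ℕ} (w : EuclideanSpace ℂ (Fin n) ≃ₗᵢ[ℂ] EuclideanSpace ℂ (Fin n))
    (θ : Fin n → ℂ) (σ : Equiv.Perm (Fin n)) : Prop :=
  ∀ v i, w v i = θ i * v (σ.symm i)

theorem IsMonomial.ne_zero {n : ℕ} {w : EuclideanSpace ℂ (Fin n) ≃ₗᵢ[ℂ] EuclideanSpace ℂ (Fin n)}
    {θ : Fin n → ℂ} {σ : Equiv.Perm (Fin n)} (h : IsMonomial w θ σ) (i : Fin n) : θ i ≠ 0 := by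
  intro h0
  have := h (w.symm (EuclideanSpace.single i 1)) i
  rw [h0, zero_mul, LinearIsometryEquiv.apply_symm_apply] at this
  simp at this

theorem IsMonomial.unique {n : ℕ} {w : EuclideanSpace ℂ (Fin n) ≃ₗᵢ[ℂ] EuclideanSpace ℂ (Fin n)}
    {θ θ' : Fin n → ℂ} {σ σ' : Equiv.Perm (Fin n)} (h : IsMonomial w θ σ)
    (h' : IsMonomial w θ' σ') : θ = θ' ∧ σ = σ' := by
  have key : ∀ i, σ'.symm i = σ.symm i := by
    intro i
    by_contra hne
    have e := (h (EuclideanSpace.single (σ.symm i) 1) i).symm.trans (h' _ i)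
    simp [hne] at e
    exact h.ne_zero i e
  have hσ : σ = σ' := by
    rw [← Equiv.symm_symm σ, ← Equiv.symm_symm σ']
    exact congrArg Equiv.symm (Equiv.ext fun i => (key i).symm)
  subst hσ
  refine ⟨funext fun i => ?_, rfl⟩
  have e := (h (EuclideanSpace.single (σ.symm i) 1) i).symm.trans (h' _ i)
  simpa using e

theorem IsMonomial.mul {n : ℕ} {w w' : EuclideanSpace ℂ (Fin n) ≃ₗᵢ[ℂ] EuclideanSpace ℂ (Fin n)}
    {θ θ' : Fin n → ℂ} {σ σ' : Equiv.Perm (Fin n)} (h : IsMonomial w θ σ)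
    (h' : IsMonomial w' θ' σ') : IsMonomial (w * w') (fun i => θ i * θ' (σ.symm i)) (σ * σ') := by
  intro v i
  rw [LinearIsometryEquiv.coe_mul, Function.comp_apply, h, h', mul_assoc]; rfl

/-- The group `G(r, p, n)` of unitary transformations of `ℂⁿ` given by monomial matrices whose
nonzero entries are `r`-th roots of unity with product an `(r / p)`-th root of unity. -/
def imprimitiveGroup (r p n : ℕ) :
    Subgroup (EuclideanSpace ℂ (Fin n) ≃ₗᵢ[ℂ] EuclideanSpace ℂ (Fin n)) where
  carrier := {w | ∃ (θ : Fin n → ℂ) (σ : Equiv.Perm (Fin n)),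
    (∀ i, θ i ^ r = 1) ∧ (∏ i, θ i) ^ (r / p) = 1 ∧ IsMonomial w θ σ}
  one_mem' := ⟨fun _ => 1, 1, by simp, by simp, fun v i => (one_mul _).symm⟩
  mul_mem' := by
    rintro w w' ⟨θ, σ, h1, h2, h3⟩ ⟨θ', σ', h1', h2', h3'⟩
    refine ⟨fun i => θ i * θ' (σ.symm i), σ * σ', fun i => ?_, ?_, h3.mul h3'⟩
    · rw [mul_pow, h1, h1', one_mul]
    · rw [Finset.prod_mul_distrib, Equiv.prod_comp σ.symm θ', mul_pow, h2, h2', one_mul]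
  inv_mem' := by
    rintro w ⟨θ, σ, h1, h2, h3⟩
    refine ⟨fun i => (θ (σ i))⁻¹, σ⁻¹, fun i => ?_, ?_, fun v i => ?_⟩
    · rw [inv_pow, h1, inv_one]
    · rw [Finset.prod_inv_distrib, Equiv.prod_comp σ θ, inv_pow, h2, inv_one]
    · have h := h3 (w.symm v) (σ i)
      rw [LinearIsometryEquiv.apply_symm_apply, Equiv.symm_apply_apply] at h
      show w.symm v i = (θ (σ i))⁻¹ * v (σ i)
      rw [h, inv_mul_cancel_left₀ (h3.ne_zero _)]


theorem imprimitiveGroup_le (r p n : ℕ) :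
    imprimitiveGroup r p n ≤ imprimitiveGroup r 1 n := by
  rintro w ⟨θ, σ, h1, _, h3⟩
  refine ⟨θ, σ, h1, ?_, h3⟩
  rw [Nat.div_one, ← Finset.prod_pow]
  exact Finset.prod_eq_one fun i _ => h1 i

instance finite_imprimitiveGroup (r p n : ℕ) [NeZero r] : Finite (imprimitiveGroup r p n) := by
  have hfin : Finite {z : ℂ // z ^ r = 1} := by
    refine ((Polynomial.nthRoots r (1 : ℂ)).toFinset.finite_toSet.subset fun z hz => ?_).to_subtype
    have hz' : z ^ r = 1 := hz
    simpa [Polynomial.mem_nthRoots (NeZero.pos r)] using hz'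
  choose θ σ h1 _ h3 using fun w : imprimitiveGroup r p n => w.2
  refine Finite.of_injective
    (fun w => ((fun i => ⟨θ w i, h1 w i⟩ : Fin n → {z : ℂ // z ^ r = 1}), σ w)) ?_
  intro w w' hww
  obtain ⟨e1, e2⟩ := Prod.ext_iff.1 hww
  refine Subtype.ext (LinearIsometryEquiv.ext fun v => ?_)
  ext i
  rw [h3 w, h3 w']
  have e3 := congrArg Subtype.val (congrFun e1 i)
  simp only at e2 e3
  rw [e2, e3]

theorem exists_isMonomial {r p n : ℕ} (w : imprimitiveGroup r p n) :
    ∃ x : (Fin n → ℂ) × Equiv.Perm (Fin n), IsMonomial w.1 x.1 x.2 := by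
  obtain ⟨θ, σ, _, _, h⟩ := w.2
  exact ⟨(θ, σ), h⟩

section VRep

variable {p d n : ℕ} [NeZero p]

/-- The representation of `G(r, 1, n)`, `r = p d`, on `V(λ)`: the monomial matrix with entries `θ`
and permutation `σ` acts as the diagonal matrix with entries `θ` times the permutation matrix
of `σ`. -/
noncomputable def VRep (lam : MultiPartition p d n) :
    Representation ℂ (imprimitiveGroup (p * d) 1 n) (VMod lam) where
  toFun w := torusOp lam (exists_isMonomial w).choose.1 *
    permRep lam (exists_isMonomial w).choose.2
  map_one' := by
    have h1 : IsMonomial (n := n) 1 (fun _ => 1) 1 := fun v i => (one_mul _).symm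
    obtain ⟨e1, e2⟩ := (exists_isMonomial (1 : imprimitiveGroup (p * d) 1 n)).choose_spec.unique h1
    rw [e1, e2, torusOp_one, map_one, one_mul]
  map_mul' w w' := by
    have h := (exists_isMonomial (w * w')).choose_spec
    obtain ⟨e1, e2⟩ :=
      h.unique ((exists_isMonomial w).choose_spec.mul (exists_isMonomial w').choose_spec)
    rw [e1, e2, torusOp_mul, map_mul, mul_assoc, mul_assoc,
      ← mul_assoc (permRep lam _) (torusOp lam _), permRep_torusOp, mul_assoc]

theorem VRep_apply (lam : MultiPartition p d n) (w : imprimitiveGroup (p * d) 1 n)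
    {θ : Fin n → ℂ} {σ : Equiv.Perm (Fin n)} (h : IsMonomial w.1 θ σ) :
    VRep lam w = torusOp lam θ * permRep lam σ := by
  obtain ⟨e1, e2⟩ := (exists_isMonomial w).choose_spec.unique h
  show torusOp lam (exists_isMonomial w).choose.1 *
    permRep lam (exists_isMonomial w).choose.2 = _
  rw [e1, e2]

/-- The restriction of `V(λ)` to `G(r, p, n)`, `r = p d`. -/
noncomputable def VRes (lam : MultiPartition p d n) :
    Representation ℂ (imprimitiveGroup (p * d) p n) (VMod lam) :=
  (VRep lam).comp (Subgroup.inclusion (imprimitiveGroup_le (p * d) p n))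

/-- The module `V(λ̄, l)` of `G(r, p, n)`: the eigenspace for the eigenvalue `exp(2 π i l / e_λ)` of
`v(T) ↦ v(shift^{p / e_λ} T)` on `V(λ)`. -/
noncomputable def VBar (lam : MultiPartition p d n) (l : ℕ) : Subrepresentation (VRes lam) where
  toSubmodule := Module.End.eigenspace (shiftOp lam (p / eNumber lam))
    (Complex.exp (2 * Real.pi * Complex.I * l / eNumber lam))
  apply_mem_toSubmodule := by
    intro w v hv
    obtain ⟨θ, σ, h1, h2, h3⟩ := w.2
    rw [Nat.mul_div_cancel_left _ (NeZero.pos p)] at h2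
    have hw : VRes lam w = torusOp lam θ * permRep lam σ := VRep_apply lam _ h3
    have hcomm : shiftOp lam (p / eNumber lam) * VRes lam w =
        VRes lam w * shiftOp lam (p / eNumber lam) := by
      rw [hw, ← mul_assoc, shiftOp_torusOp lam _ h1 h2, mul_assoc, shiftOp_permRep, mul_assoc]
    rw [Module.End.mem_eigenspace_iff] at hv ⊢
    rw [← Module.End.mul_apply, hcomm, Module.End.mul_apply, hv, map_smul]

/-- The vector space underlying `V(λ̄, l)`. -/
def VBarMod (lam : MultiPartition p d n) (l : ℕ) : Type := (VBar lam l).toSubmodule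

noncomputable instance (lam : MultiPartition p d n) (l : ℕ) : AddCommGroup (VBarMod lam l) :=
  inferInstanceAs (AddCommGroup (VBar lam l).toSubmodule)

noncomputable instance (lam : MultiPartition p d n) (l : ℕ) : Module ℂ (VBarMod lam l) :=
  inferInstanceAs (Module ℂ (VBar lam l).toSubmodule)

/-- The representation of `G(r, p, n)` on `V(λ̄, l)`. -/
noncomputable def VBarRep (lam : MultiPartition p d n) (l : ℕ) :
    Representation ℂ (imprimitiveGroup (p * d) p n) (VBarMod lam l) :=
  (VBar lam l).toRepresentation

end VRep

/-! ### Rational Cherednik algebras and standard modules -/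

section Cherednik

variable {V : Type*} [NormedAddCommGroup V] [InnerProductSpace ℂ V] [FiniteDimensional ℂ V]

/-- The space of vectors fixed by `g`. -/
def fixedSpace (g : V ≃ₗᵢ[ℂ] V) : Submodule ℂ V where
  carrier := {v | g v = v}
  add_mem' {u v} hu hv := by
    show g (u + v) = u + v
    rw [map_add, show g u = u from hu, show g v = v from hv]
  zero_mem' := map_zero g
  smul_mem' a v hv := by
    show g (a • v) = a • v
    rw [map_smul, show g v = v from hv]

/-- A reflection is a unitary transformation whose fixed space is a hyperplane. -/
def IsReflection (g : V ≃ₗᵢ[ℂ] V) : Prop :=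
  Module.finrank ℂ (fixedSpace g) + 1 = Module.finrank ℂ V

/-- For a reflection `g` with hyperplane `H`, normal vector `v_H` and `α_H = ⟪v_H, ·⟫`, the value
`⟨α_H, y⟩ ⟨x, v_H⟩ / ⟨α_H, v_H⟩`, which is `x` evaluated at the orthogonal projection of `y` to the
line `Hᗮ` spanned by `v_H`. -/
noncomputable def reflCoeff (g : V ≃ₗᵢ[ℂ] V) (x : Module.Dual ℂ V) (y : V) : ℂ :=
  x ((fixedSpace g)ᗮ.starProjection y)

/-- The generators of the Cherednik algebra: `x ∈ V*`, `y ∈ V` and `w ∈ W`. -/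
inductive CherednikGen (W : Subgroup (V ≃ₗᵢ[ℂ] V))
  | x (ξ : Module.Dual ℂ V)
  | y (v : V)
  | w (g : W)

/-- The dual action of `g` on `V*`. -/
def dualAct (g : V ≃ₗᵢ[ℂ] V) (ξ : Module.Dual ℂ V) : Module.Dual ℂ V :=
  ξ ∘ₗ (g⁻¹ : V ≃ₗᵢ[ℂ] V).toLinearEquiv.toLinearMap

open CherednikGen in
open scoped Classical in
/-- The defining relations of the Cherednik algebra: `V*`, `V` are linear subspaces, `W` is a
subgroup of the units, the commutation relations `[x, x'] = 0`, `[y, y'] = 0`, `w x w⁻¹ = w(x)`,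
`w y w⁻¹ = w(y)`, and
`[y, x] = ⟨y, x⟩ + ∑_H (⟨α_H, y⟩ ⟨x, v_H⟩ / ⟨α_H, v_H⟩) γ_H` with `γ_H = ∑_{g ∈ W_H ∖ 1} c_g g`.
The pairs `(H, g)` with `H` a reflection hyperplane and `g ∈ W_H ∖ 1` are the reflections `g ∈ W`,
so the double sum is written as one sum over the reflections of (the finite group) `W`. -/
inductive CherednikRel (W : Subgroup (V ≃ₗᵢ[ℂ] V)) (c : (V ≃ₗᵢ[ℂ] V) → ℂ) :
    FreeAlgebra ℂ (CherednikGen W) → FreeAlgebra ℂ (CherednikGen W) → Prop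
  | x_add (ξ η) : CherednikRel W c (.ι ℂ (x (ξ + η))) (.ι ℂ (x ξ) + .ι ℂ (x η))
  | x_smul (a : ℂ) (ξ) : CherednikRel W c (.ι ℂ (x (a • ξ))) (a • .ι ℂ (x ξ))
  | y_add (u v) : CherednikRel W c (.ι ℂ (y (u + v))) (.ι ℂ (y u) + .ι ℂ (y v))
  | y_smul (a : ℂ) (v) : CherednikRel W c (.ι ℂ (y (a • v))) (a • .ι ℂ (y v))
  | w_one : CherednikRel W c (.ι ℂ (w 1)) 1
  | w_mul (g h : W) : CherednikRel W c (.ι ℂ (w (g * h))) (.ι ℂ (w g) * .ι ℂ (w h))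
  | x_comm (ξ η) : CherednikRel W c (.ι ℂ (x ξ) * .ι ℂ (x η)) (.ι ℂ (x η) * .ι ℂ (x ξ))
  | y_comm (u v) : CherednikRel W c (.ι ℂ (y u) * .ι ℂ (y v)) (.ι ℂ (y v) * .ι ℂ (y u))
  | w_x (g : W) (ξ) : CherednikRel W c (.ι ℂ (w g) * .ι ℂ (x ξ) * .ι ℂ (w g⁻¹))
      (.ι ℂ (x (dualAct g.1 ξ)))
  | w_y (g : W) (v) : CherednikRel W c (.ι ℂ (w g) * .ι ℂ (y v) * .ι ℂ (w g⁻¹))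
      (.ι ℂ (y (g.1 v)))
  | y_x (v) (ξ) : CherednikRel W c (.ι ℂ (y v) * .ι ℂ (x ξ) - .ι ℂ (x ξ) * .ι ℂ (y v))
      (algebraMap ℂ _ (ξ v) +
        ∑ᶠ g : W, (if IsReflection g.1 then c g.1 * reflCoeff g.1 ξ v else 0) • .ι ℂ (w g))

/-- The rational Cherednik algebra `H_c(W)` of a finite group `W` of unitary transformations of `V`;
only the values of `c` at reflections of `W` matter. -/
def CherednikAlgebra (W : Subgroup (V ≃ₗᵢ[ℂ] V)) (c : (V ≃ₗᵢ[ℂ] V) → ℂ) : Type _ :=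
  RingQuot (CherednikRel W c)

namespace CherednikAlgebra

variable (W : Subgroup (V ≃ₗᵢ[ℂ] V)) (c : (V ≃ₗᵢ[ℂ] V) → ℂ)

noncomputable instance : Ring (CherednikAlgebra W c) :=
  inferInstanceAs (Ring (RingQuot (CherednikRel W c)))

noncomputable instance : Algebra ℂ (CherednikAlgebra W c) :=
  inferInstanceAs (Algebra ℂ (RingQuot (CherednikRel W c)))

/-- The quotient map from the free algebra on the generators. -/
noncomputable def mk : FreeAlgebra ℂ (CherednikGen W) →ₐ[ℂ] CherednikAlgebra W c :=
  RingQuot.mkAlgHom ℂ (CherednikRel W c)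

/-- The generators, as elements of `H_c(W)`. -/
noncomputable def gen (a : CherednikGen W) : CherednikAlgebra W c :=
  mk W c (FreeAlgebra.ι ℂ a)

theorem rel {a b : FreeAlgebra ℂ (CherednikGen W)} (h : CherednikRel W c a b) :
    mk W c a = mk W c b :=
  RingQuot.mkAlgHom_rel ℂ h

variable {W}

/-- The generator of a subgroup, as a generator of the whole group. -/
def inclGen {W' : Subgroup (V ≃ₗᵢ[ℂ] V)} (hle : W' ≤ W) : CherednikGen W' → CherednikGen W
  | .x ξ => .x ξ
  | .y v => .y v
  | .w g => .w (Subgroup.inclusion hle g)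

/-- The algebra homomorphism `H_c(W') → H_c(W)` that is the identity on `V*`, `V` and `W'`, for
`W' ≤ W` such that `c` vanishes at the reflections of `W` that are not in `W'`. -/
noncomputable def incl {W' : Subgroup (V ≃ₗᵢ[ℂ] V)} [Finite W] (hle : W' ≤ W)
    (hc : ∀ g ∈ W, IsReflection g → g ∉ W' → c g = 0) :
    CherednikAlgebra W' c →ₐ[ℂ] CherednikAlgebra W c :=
  RingQuot.liftAlgHom ℂ ⟨FreeAlgebra.lift ℂ fun a => gen W c (inclGen hle a), by
    classical
    intro a b hab
    induction hab with
    | x_add ξ η => simpa [gen, inclGen] using rel W c (.x_add ξ η)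
    | x_smul a ξ => simpa [gen, inclGen] using rel W c (.x_smul a ξ)
    | y_add u v => simpa [gen, inclGen] using rel W c (.y_add u v)
    | y_smul a v => simpa [gen, inclGen] using rel W c (.y_smul a v)
    | w_one => simpa [gen, inclGen] using rel W c .w_one
    | w_mul g h => simpa [gen, inclGen] using rel W c (.w_mul (Subgroup.inclusion hle g)
        (Subgroup.inclusion hle h))
    | x_comm ξ η => simpa [gen, inclGen] using rel W c (.x_comm ξ η)
    | y_comm u v => simpa [gen, inclGen] using rel W c (.y_comm u v)
    | w_x g ξ => simpa [gen, inclGen] using rel W c (.w_x (Subgroup.inclusion hle g) ξ)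
    | w_y g v => simpa [gen, inclGen] using rel W c (.w_y (Subgroup.inclusion hle g) v)
    | y_x v ξ =>
      have h := rel W c (.y_x v ξ)
      have : Finite W' := Finite.of_injective _ (Subgroup.inclusion_injective hle)
      have key : ∀ F : W → CherednikAlgebra W c, (∀ g : W, g.1 ∉ W' → F g = 0) →
          ∑ᶠ g : W', F (Subgroup.inclusion hle g) = ∑ᶠ g : W, F g := by
        intro F hF
        rw [← finsum_mem_range (Subgroup.inclusion_injective hle), finsum_mem_def]
        refine finsum_congr fun g => Set.indicator_apply_eq_self.2 fun hg => hF g fun hg' => ?_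
        exact hg ⟨⟨g.1, hg'⟩, rfl⟩
      have h' := key (fun g => (if IsReflection g.1 then c g.1 * reflCoeff g.1 ξ v else 0) •
        gen W c (.w g)) (fun g hg => by
          split_ifs with hr
          · rw [hc g.1 g.2 hr hg, zero_mul, zero_smul]
          · rw [zero_smul])
      simp only [map_sub, map_mul, map_add, AlgHom.commutes, FreeAlgebra.lift_ι_apply] at h ⊢
      rw [map_finsum _ (Set.toFinite _)] at h ⊢
      simp only [map_smul, FreeAlgebra.lift_ι_apply] at h ⊢
      exact h.trans (congrArg _ h'.symm)⟩

theorem incl_gen {W' : Subgroup (V ≃ₗᵢ[ℂ] V)} [Finite W] (hle : W' ≤ W)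
    (hc : ∀ g ∈ W, IsReflection g → g ∉ W' → c g = 0) (a : CherednikGen W') :
    incl c hle hc (gen W' c a) = gen W c (inclGen hle a) := by
  show RingQuot.liftAlgHom ℂ _ (RingQuot.mkAlgHom ℂ _ _) = _
  rw [RingQuot.liftAlgHom_mkAlgHom_apply, FreeAlgebra.lift_ι_apply]

end CherednikAlgebra

variable {S : Type*} [AddCommGroup S] [Module ℂ S]

/-- The submodule of `H_c(W) ⊗ S` generated by the relations of the balanced tensor product
over `ℂ[V*] ⋊ W`, where `W` acts on `S` by `σ` and `V` acts by zero. -/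
noncomputable def standardRel (W : Subgroup (V ≃ₗᵢ[ℂ] V)) (c : (V ≃ₗᵢ[ℂ] V) → ℂ) (σ : Representation ℂ W S) :
    Submodule (CherednikAlgebra W c) (CherednikAlgebra W c ⊗[ℂ] S) :=
  Submodule.span _
    ({t | ∃ h g s, t = (h * CherednikAlgebra.gen W c (.w g)) ⊗ₜ[ℂ] s - h ⊗ₜ[ℂ] (σ g s)} ∪
      {t | ∃ h v s, t = (h * CherednikAlgebra.gen W c (.y v)) ⊗ₜ[ℂ] s})

/-- The standard module `Δ(σ) = H_c(W) ⊗_{ℂ[V*] ⋊ W} σ` (isomorphic to `ℂ[V] ⊗ σ` as a vector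
space), where `V` acts on `σ` by zero. -/
def StandardModule (W : Subgroup (V ≃ₗᵢ[ℂ] V)) (c : (V ≃ₗᵢ[ℂ] V) → ℂ)
    (σ : Representation ℂ W S) : Type _ :=
  (CherednikAlgebra W c ⊗[ℂ] S) ⧸ standardRel W c σ

noncomputable instance (W : Subgroup (V ≃ₗᵢ[ℂ] V)) (c : (V ≃ₗᵢ[ℂ] V) → ℂ)
    (σ : Representation ℂ W S) : AddCommGroup (StandardModule W c σ) :=
  inferInstanceAs (AddCommGroup ((CherednikAlgebra W c ⊗[ℂ] S) ⧸ standardRel W c σ))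

noncomputable instance (W : Subgroup (V ≃ₗᵢ[ℂ] V)) (c : (V ≃ₗᵢ[ℂ] V) → ℂ)
    (σ : Representation ℂ W S) : Module (CherednikAlgebra W c) (StandardModule W c σ) :=
  inferInstanceAs
    (Module (CherednikAlgebra W c) ((CherednikAlgebra W c ⊗[ℂ] S) ⧸ standardRel W c σ))

/-- The restriction of the `B`-module `M` along `φ : A → B` is isomorphic to the `A`-module `N`. -/
def RestrictsTo {A B : Type*} [Ring A] [Algebra ℂ A] [Ring B] [Algebra ℂ B] (φ : A →ₐ[ℂ] B)
    (M : Type*) [AddCommGroup M] [Module B M] (N : Type*) [AddCommGroup N] [Module A N] : Prop :=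
  ∃ f : M ≃+ N, ∀ (a : A) (m : M), f (φ a • m) = a • f m

end Cherednik

end ImprimitiveCherednik

namespace ImprimitiveCherednik

/-! ### Unitary equivariance of reflections, and conjugation on Cherednik algebras. -/

section CherednikRestriction

variable {V : Type*} [NormedAddCommGroup V] [InnerProductSpace ℂ V] [FiniteDimensional ℂ V]

/-! Write `W = G(r,1,n)` and `W' = G(r,p,n)`, a normal subgroup of `W`. The proof separates a
statement about Cherednik algebras from one about representations of the finite groups.

Cherednik algebras: `Δ(σ)` restricts to `Δ(σ|W')` for every representation `σ` of `W`
(`restrictsTo_standardModule`). As `c` vanishes at the reflections of `W` outside `W'`, the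
commutator `[y, x]` involves only elements of `W'`. Conjugation by `g ∈ W` is an endomorphism of
`H_c(W')` (`CherednikAlgebra.conj`), so `g` acts on `Δ(σ|W')` by `[h ⊗ s] ↦ [g h g⁻¹ ⊗ g s]`. These
operators extend the action of `H_c(W')` to one of `H_c(W)`, and the universal properties of the two
standard modules give mutually inverse maps. No PBW basis is needed. A decomposition of `σ|W'` then
induces one of `Δ(σ|W')` (`exists_standardModule_equiv_directSum`).

Finite groups: let `A` be the shift of tableaux by the length of the orbit of `μ`. It commutes with
`W'` and satisfies `A ^ e = 1`, so `V(μ)` is the direct sum of the eigenspaces of `A` for the `e`-th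
roots of unity, with averages of powers of `A` as projections. A shift also identifies `V(λ)` and
`V(μ)` over `W'`, which makes the choice of representative immaterial (`CyclicEquiv.exists_equiv`).

Irreducibility: the operators of `W'` generate many operators that are diagonal in the basis `v(T)`.
They detect ratios of torus weights, torus weights modulo `d`, and, by Jucys-Murphy elements,
contents (`content_mem_diagonals`). A tableau is determined by the diagrams and contents of its
entries, so tableaux that are not separated are shifts of one another
(`exists_shift_of_not_separated`). Hence a nonzero invariant subspace of an eigenspace contains the
projection of some `v(T)`. Adjacent transpositions connect all standard tableaux
(`IsStd.swap_induction`), so it contains the projection of every `v(T)` (`eq_VBar_of_invariant`). -/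

theorem dualAct_apply (g : V ≃ₗᵢ[ℂ] V) (ξ : Module.Dual ℂ V) (v : V) :
    dualAct g ξ v = ξ (g⁻¹ v) := rfl

theorem dualAct_add (g : V ≃ₗᵢ[ℂ] V) (ξ η : Module.Dual ℂ V) :
    dualAct g (ξ + η) = dualAct g ξ + dualAct g η := rfl

theorem dualAct_smul (g : V ≃ₗᵢ[ℂ] V) (a : ℂ) (ξ : Module.Dual ℂ V) :
    dualAct g (a • ξ) = a • dualAct g ξ := rfl

theorem dualAct_mul (g h : V ≃ₗᵢ[ℂ] V) (ξ : Module.Dual ℂ V) :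
    dualAct (g * h) ξ = dualAct g (dualAct h ξ) := by
  ext v
  simp only [dualAct_apply, mul_inv_rev, LinearIsometryEquiv.coe_mul, Function.comp_apply]

theorem mem_fixedSpace {g : V ≃ₗᵢ[ℂ] V} {v : V} : v ∈ fixedSpace g ↔ g v = v := Iff.rfl

theorem fixedSpace_conj (w g : V ≃ₗᵢ[ℂ] V) :
    fixedSpace (w * g * w⁻¹) = (fixedSpace g).map (w.toLinearEquiv : V →ₗ[ℂ] V) := by
  ext v
  rw [Submodule.mem_map_equiv, mem_fixedSpace, mem_fixedSpace]
  simp only [LinearIsometryEquiv.coe_mul, Function.comp_apply]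
  constructor
  · intro h
    have := congrArg (fun u => w⁻¹ u) h
    simpa using this
  · intro h
    have := congrArg w h
    simpa using this

theorem isReflection_conj (w g : V ≃ₗᵢ[ℂ] V) : IsReflection (w * g * w⁻¹) ↔ IsReflection g := by
  unfold IsReflection
  rw [fixedSpace_conj, LinearEquiv.finrank_map_eq]

/-- The isometry `w` carries the hyperplane of `g` to that of `w g w⁻¹`, hence also the orthogonal
projections to the normal lines. This is the invariance of the coefficients in the relation for `[y,
x]`. -/
theorem reflCoeff_conj (w g : V ≃ₗᵢ[ℂ] V) (ξ : Module.Dual ℂ V) (v : V) :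
    reflCoeff (w * g * w⁻¹) (dualAct w ξ) (w v) = reflCoeff g ξ v := by
  -- The subspace is a variable, so that `fixedSpace_conj` can be used without rewriting inside the
  -- dependent projection.
  have key : ∀ K : Submodule ℂ V, K = (fixedSpace g).map (w.toLinearEquiv : V →ₗ[ℂ] V) →
      Kᗮ.starProjection (w v) = w ((fixedSpace g)ᗮ.starProjection v) := by
    rintro K rfl
    rw [Submodule.starProjection_orthogonal_val, Submodule.starProjection_orthogonal_val,
      Submodule.starProjection_map_apply, map_sub]
    simp
  unfold reflCoeff
  rw [key _ (fixedSpace_conj w g), dualAct_apply]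
  simp

/-! ### Generators, relations and the universal property of `H_c(W)`. -/

namespace CherednikAlgebra

variable {W : Subgroup (V ≃ₗᵢ[ℂ] V)} {c : (V ≃ₗᵢ[ℂ] V) → ℂ}

theorem induction {P : CherednikAlgebra W c → Prop} (halg : ∀ a : ℂ, P (algebraMap ℂ _ a))
    (hgen : ∀ a, P (gen W c a)) (hadd : ∀ a b, P a → P b → P (a + b))
    (hmul : ∀ a b, P a → P b → P (a * b)) (a : CherednikAlgebra W c) : P a := by
  obtain ⟨b, rfl⟩ : ∃ b, mk W c b = a := RingQuot.mkAlgHom_surjective ℂ (CherednikRel W c) a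
  induction b using FreeAlgebra.induction with
  | grade0 r => rw [AlgHom.commutes]; exact halg r
  | grade1 x => exact hgen x
  | mul a b ha hb => rw [map_mul]; exact hmul _ _ ha hb
  | add a b ha hb => rw [map_add]; exact hadd _ _ ha hb

theorem algHom_ext {B : Type*} [Ring B] [Algebra ℂ B] {f g : CherednikAlgebra W c →ₐ[ℂ] B}
    (h : ∀ a, f (gen W c a) = g (gen W c a)) : f = g := by
  refine AlgHom.ext fun a => ?_
  refine induction (P := fun a => f a = g a) (fun a => ?_) h (fun a b ha hb => ?_)
    (fun a b ha hb => ?_) a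
  · rw [AlgHom.commutes, AlgHom.commutes]
  · rw [map_add, map_add, ha, hb]
  · rw [map_mul, map_mul, ha, hb]

/-- The algebra homomorphism from `H_c(W)` with prescribed values at the generators. -/
noncomputable def lift {B : Type*} [Ring B] [Algebra ℂ B] (f : CherednikGen W → B)
    (hf : ∀ a b, CherednikRel W c a b → FreeAlgebra.lift ℂ f a = FreeAlgebra.lift ℂ f b) :
    CherednikAlgebra W c →ₐ[ℂ] B :=
  RingQuot.liftAlgHom ℂ ⟨FreeAlgebra.lift ℂ f, fun {a b} h => hf a b h⟩

theorem lift_gen {B : Type*} [Ring B] [Algebra ℂ B] (f : CherednikGen W → B)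
    (hf : ∀ a b, CherednikRel W c a b → FreeAlgebra.lift ℂ f a = FreeAlgebra.lift ℂ f b)
    (a : CherednikGen W) : lift (c := c) f hf (gen W c a) = f a := by
  show RingQuot.liftAlgHom ℂ _ (RingQuot.mkAlgHom ℂ _ _) = _
  rw [RingQuot.liftAlgHom_mkAlgHom_apply, FreeAlgebra.lift_ι_apply]

theorem gen_x_add (ξ η : Module.Dual ℂ V) :
    gen W c (.x (ξ + η)) = gen W c (.x ξ) + gen W c (.x η) := by
  simpa [gen] using rel W c (.x_add ξ η)

theorem gen_x_smul (a : ℂ) (ξ : Module.Dual ℂ V) :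
    gen W c (.x (a • ξ)) = a • gen W c (.x ξ) := by
  simpa [gen] using rel W c (.x_smul a ξ)

theorem gen_y_add (u v : V) : gen W c (.y (u + v)) = gen W c (.y u) + gen W c (.y v) := by
  simpa [gen] using rel W c (.y_add u v)

theorem gen_y_smul (a : ℂ) (v : V) : gen W c (.y (a • v)) = a • gen W c (.y v) := by
  simpa [gen] using rel W c (.y_smul a v)

theorem gen_w_one : gen W c (.w 1) = 1 := by
  simpa [gen] using rel W c .w_one

theorem gen_w_mul (g h : W) : gen W c (.w (g * h)) = gen W c (.w g) * gen W c (.w h) := by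
  simpa [gen] using rel W c (.w_mul g h)

theorem gen_x_comm (ξ η : Module.Dual ℂ V) :
    gen W c (.x ξ) * gen W c (.x η) = gen W c (.x η) * gen W c (.x ξ) := by
  simpa [gen] using rel W c (.x_comm ξ η)

theorem gen_y_comm (u v : V) :
    gen W c (.y u) * gen W c (.y v) = gen W c (.y v) * gen W c (.y u) := by
  simpa [gen] using rel W c (.y_comm u v)

/-- The form of the relation `w x w⁻¹ = w(x)` that moves group elements to the right. -/
theorem gen_w_x (g : W) (ξ : Module.Dual ℂ V) :
    gen W c (.w g) * gen W c (.x ξ) = gen W c (.x (dualAct g.1 ξ)) * gen W c (.w g) := by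
  have h : gen W c (.w g) * gen W c (.x ξ) * gen W c (.w g⁻¹) = gen W c (.x (dualAct g.1 ξ)) := by
    simpa [gen] using rel W c (.w_x g ξ)
  rw [← h, mul_assoc, ← gen_w_mul, inv_mul_cancel, gen_w_one, mul_one]

theorem gen_w_y (g : W) (v : V) :
    gen W c (.w g) * gen W c (.y v) = gen W c (.y (g.1 v)) * gen W c (.w g) := by
  have h : gen W c (.w g) * gen W c (.y v) * gen W c (.w g⁻¹) = gen W c (.y (g.1 v)) := by
    simpa [gen] using rel W c (.w_y g v)
  rw [← h, mul_assoc, ← gen_w_mul, inv_mul_cancel, gen_w_one, mul_one]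

open scoped Classical in
theorem gen_y_x [Finite W] (v : V) (ξ : Module.Dual ℂ V) :
    gen W c (.y v) * gen W c (.x ξ) - gen W c (.x ξ) * gen W c (.y v) =
      algebraMap ℂ _ (ξ v) + ∑ᶠ g : W,
        (if IsReflection g.1 then c g.1 * reflCoeff g.1 ξ v else 0) • gen W c (.w g) := by
  have h := rel W c (.y_x v ξ)
  simp only [map_sub, map_mul, map_add, AlgHom.commutes] at h
  rw [map_finsum _ (Set.toFinite _)] at h
  simp only [map_smul] at h
  exact h

/-! ### Conjugation by an element of the normalizer. -/

section Conj

variable {W' : Subgroup (V ≃ₗᵢ[ℂ] V)}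

/-- Conjugation by `g`, which normalizes `W'`, on the generators of `H_c(W')`. -/
def conjGen (g : V ≃ₗᵢ[ℂ] V) (hn : ∀ h ∈ W', g * h * g⁻¹ ∈ W') : CherednikGen W' → CherednikGen W'
  | .x ξ => .x (dualAct g ξ)
  | .y v => .y (g v)
  | .w h => .w ⟨g * h.1 * g⁻¹, hn h.1 h.2⟩

/-- A function on a finite group may be summed after conjugation. -/
theorem finsum_conj {M : Type*} [AddCommMonoid M] (g : V ≃ₗᵢ[ℂ] V)
    (hn : ∀ h ∈ W', g * h * g⁻¹ ∈ W') [Finite W'] (F : W' → M) :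
    ∑ᶠ h : W', F ⟨g * h.1 * g⁻¹, hn h.1 h.2⟩ = ∑ᶠ h : W', F h := by
  have hinj : Function.Injective fun h : W' => (⟨g * h.1 * g⁻¹, hn h.1 h.2⟩ : W') := by
    intro a b hab
    have := congrArg Subtype.val hab
    simp only [mul_left_inj, mul_right_inj] at this
    exact Subtype.ext this
  exact finsum_comp_equiv (Equiv.ofBijective _ (Finite.injective_iff_bijective.1 hinj))

/-- Conjugation by an element `g` that normalizes `W'` and leaves `c` invariant, as an algebra
endomorphism of `H_c(W')`. -/
noncomputable def conj [Finite W'] (g : V ≃ₗᵢ[ℂ] V) (hn : ∀ h ∈ W', g * h * g⁻¹ ∈ W')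
    (hinv : ∀ h ∈ W', IsReflection h → c (g * h * g⁻¹) = c h) :
    CherednikAlgebra W' c →ₐ[ℂ] CherednikAlgebra W' c :=
  lift (fun a => gen W' c (conjGen g hn a)) <| by
    classical
    intro a b hab
    induction hab with
    | x_add ξ η => simp [conjGen, dualAct_add, gen_x_add]
    | x_smul a ξ => simp [conjGen, dualAct_smul, gen_x_smul]
    | y_add u v => simp [conjGen, gen_y_add]
    | y_smul a v => simp [conjGen, gen_y_smul]
    | w_one =>
      simp only [FreeAlgebra.lift_ι_apply, conjGen, map_one]
      rw [← gen_w_one]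
      congr 2
      exact Subtype.ext (by simp)
    | w_mul h k =>
      simp only [FreeAlgebra.lift_ι_apply, conjGen, map_mul]
      rw [← gen_w_mul]
      congr 2
      exact Subtype.ext (by simp [mul_assoc])
    | x_comm ξ η => simpa [conjGen] using gen_x_comm _ _
    | y_comm u v => simpa [conjGen] using gen_y_comm _ _
    | w_x h ξ =>
      simp only [FreeAlgebra.lift_ι_apply, conjGen, map_mul]
      rw [gen_w_x, mul_assoc, ← gen_w_mul]
      have e : (⟨g * h.1 * g⁻¹, hn h.1 h.2⟩ : W') * ⟨g * (h⁻¹).1 * g⁻¹, hn _ (h⁻¹).2⟩ = 1 :=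
        Subtype.ext (by simp [mul_assoc])
      rw [e, gen_w_one, mul_one, ← dualAct_mul, ← dualAct_mul]
      simp [mul_assoc]
    | w_y h v =>
      simp only [FreeAlgebra.lift_ι_apply, conjGen, map_mul]
      rw [gen_w_y, mul_assoc, ← gen_w_mul]
      have e : (⟨g * h.1 * g⁻¹, hn h.1 h.2⟩ : W') * ⟨g * (h⁻¹).1 * g⁻¹, hn _ (h⁻¹).2⟩ = 1 :=
        Subtype.ext (by simp [mul_assoc])
      rw [e, gen_w_one, mul_one]
      simp
    | y_x v ξ =>
      simp only [map_sub, map_mul, map_add, AlgHom.commutes, FreeAlgebra.lift_ι_apply]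
      rw [map_finsum _ (Set.toFinite _)]
      simp only [map_smul, FreeAlgebra.lift_ι_apply, conjGen]
      rw [gen_y_x, dualAct_apply]
      congr 1
      · simp
      -- The sum for the conjugated pair is reindexed by `h ↦ g h g⁻¹`; then the terms agree one by
      -- one, by the invariance of `c` and `reflCoeff_conj`.
      · rw [← finsum_conj g hn]
        refine finsum_congr fun h => ?_
        simp only [isReflection_conj, reflCoeff_conj]
        by_cases hr : IsReflection h.1
        · rw [if_pos hr, if_pos hr, hinv h.1 h.2 hr]
        · rw [if_neg hr, if_neg hr]

theorem conj_gen [Finite W'] (g : V ≃ₗᵢ[ℂ] V) (hn : ∀ h ∈ W', g * h * g⁻¹ ∈ W')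
    (hinv : ∀ h ∈ W', IsReflection h → c (g * h * g⁻¹) = c h) (a : CherednikGen W') :
    conj g hn hinv (gen W' c a) = gen W' c (conjGen g hn a) :=
  lift_gen _ _ a

/-- For `g ∈ W'` the conjugation is inner. This makes the action of `W` on the standard module agree
on `W'` with the one already present. -/
theorem conj_of_mem [Finite W'] (g : W') (hn : ∀ h ∈ W', g.1 * h * g.1⁻¹ ∈ W')
    (hinv : ∀ h ∈ W', IsReflection h → c (g.1 * h * g.1⁻¹) = c h) (a : CherednikAlgebra W' c) :
    conj g.1 hn hinv a * gen W' c (.w g) = gen W' c (.w g) * a := by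
  refine induction (P := fun a => conj g.1 hn hinv a * gen W' c (.w g) = gen W' c (.w g) * a)
    (fun a => ?_) (fun a => ?_) (fun a b ha hb => ?_) (fun a b ha hb => ?_) a
  · rw [AlgHom.commutes, Algebra.commutes]
  · rw [conj_gen]
    cases a with
    | x ξ => exact (gen_w_x g ξ).symm
    | y v => exact (gen_w_y g v).symm
    | w h =>
      simp only [conjGen]
      rw [← gen_w_mul, ← gen_w_mul]
      congr 2
      exact Subtype.ext (by simp)
  · rw [map_add, add_mul, mul_add, ha, hb]
  · rw [map_mul, mul_assoc, hb, ← mul_assoc, ha, mul_assoc]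

/-- Conjugation by `g ∈ W`, in general outer on `H_c(W')`, becomes inner in `H_c(W)`. Both sides are
twisted-multiplicative in `a`, so generators suffice. -/
theorem incl_conj [Finite W] [Finite W'] (hle : W' ≤ W)
    (hc : ∀ g ∈ W, IsReflection g → g ∉ W' → c g = 0) (g : W)
    (hn : ∀ h ∈ W', g.1 * h * g.1⁻¹ ∈ W')
    (hinv : ∀ h ∈ W', IsReflection h → c (g.1 * h * g.1⁻¹) = c h) (a : CherednikAlgebra W' c) :
    incl c hle hc (conj g.1 hn hinv a) * gen W c (.w g) =
      gen W c (.w g) * incl c hle hc a := by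
  refine induction (P := fun a => incl c hle hc (conj g.1 hn hinv a) * gen W c (.w g) =
    gen W c (.w g) * incl c hle hc a)
    (fun a => ?_) (fun a => ?_) (fun a b ha hb => ?_) (fun a b ha hb => ?_) a
  · rw [AlgHom.commutes, AlgHom.commutes, Algebra.commutes]
  · rw [conj_gen, incl_gen, incl_gen]
    cases a with
    | x ξ => exact (gen_w_x g ξ).symm
    | y v => exact (gen_w_y g v).symm
    | w h =>
      simp only [conjGen, inclGen]
      rw [← gen_w_mul, ← gen_w_mul]
      congr 2
      exact Subtype.ext (by simp)
  · simp only [map_add, add_mul, mul_add, ha, hb]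
  · simp only [map_mul]
    rw [mul_assoc, hb, ← mul_assoc, ha, mul_assoc]

end Conj

end CherednikAlgebra

end CherednikRestriction

/-! ### Standard modules: universal property, additivity, restriction to a normal subgroup. -/

section StandardModules

variable {V : Type*} [NormedAddCommGroup V] [InnerProductSpace ℂ V] [FiniteDimensional ℂ V]
variable {S : Type*} [AddCommGroup S] [Module ℂ S]

open CherednikAlgebra

namespace StandardModule

variable {W : Subgroup (V ≃ₗᵢ[ℂ] V)} {c : (V ≃ₗᵢ[ℂ] V) → ℂ} {σ : Representation ℂ W S}

noncomputable instance : Module ℂ (StandardModule W c σ) :=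
  Module.compHom _ (algebraMap ℂ (CherednikAlgebra W c))

instance : IsScalarTower ℂ (CherednikAlgebra W c) (StandardModule W c σ) where
  smul_assoc a h m := by
    rw [Algebra.smul_def, mul_smul]
    rfl

theorem algebraMap_smul' (a : ℂ) (m : StandardModule W c σ) :
    algebraMap ℂ (CherednikAlgebra W c) a • m = a • m := rfl

/-- The quotient map from `H_c(W) ⊗ S`. -/
noncomputable def mkQ : CherednikAlgebra W c ⊗[ℂ] S →ₗ[CherednikAlgebra W c] StandardModule W c σ :=
  (standardRel W c σ).mkQ

/-- The canonical map `S → Δ(σ)`. -/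
noncomputable def of (c : (V ≃ₗᵢ[ℂ] V) → ℂ) (σ : Representation ℂ W S) :
    S →ₗ[ℂ] StandardModule W c σ where
  toFun s := mkQ (1 ⊗ₜ s)
  map_add' s t := by rw [TensorProduct.tmul_add, map_add]
  map_smul' a s := by
    rw [RingHom.id_apply, ← algebraMap_smul', ← map_smul, TensorProduct.smul_tmul', smul_eq_mul,
      mul_one, ← TensorProduct.smul_tmul, Algebra.algebraMap_eq_smul_one]

theorem mkQ_tmul (h : CherednikAlgebra W c) (s : S) :
    mkQ (σ := σ) (h ⊗ₜ s) = h • of c σ s := by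
  show _ = h • mkQ (1 ⊗ₜ s)
  rw [← map_smul, TensorProduct.smul_tmul', smul_eq_mul, mul_one]

theorem gen_w_smul_of (g : W) (s : S) : gen W c (.w g) • of c σ s = of c σ (σ g s) := by
  rw [← mkQ_tmul]
  refine (Submodule.Quotient.eq _).2 (Submodule.subset_span (Or.inl ⟨1, g, s, ?_⟩))
  rw [one_mul]

theorem gen_y_smul_of (v : V) (s : S) : gen W c (.y v) • of c σ s = 0 := by
  rw [← mkQ_tmul]
  refine (Submodule.Quotient.mk_eq_zero _).2 (Submodule.subset_span (Or.inr ⟨1, v, s, ?_⟩))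
  rw [one_mul]

/-- `Δ(σ)` is generated by the image of `S`, so additive or semilinear maps may be compared on the
elements `h • of c σ s`. -/
theorem induction {P : StandardModule W c σ → Prop}
    (hsmul : ∀ (h : CherednikAlgebra W c) (s : S), P (h • of c σ s))
    (hadd : ∀ a b, P a → P b → P (a + b)) (m : StandardModule W c σ) : P m := by
  obtain ⟨t, rfl⟩ : ∃ t, mkQ t = m := (standardRel W c σ).mkQ_surjective m
  induction t using TensorProduct.induction_on with
  | zero => rw [map_zero, ← zero_smul (CherednikAlgebra W c) (of c σ 0)]; exact hsmul _ _
  | tmul h s => rw [mkQ_tmul]; exact hsmul h s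
  | add a b ha hb => rw [map_add]; exact hadd _ _ ha hb

section Lift

variable {B : Type*} [Ring B] [Algebra ℂ B] {M : Type*} [AddCommGroup M] [Module ℂ M] [Module B M]
  [IsScalarTower ℂ B M] [SMulCommClass B ℂ M]

/-- The semilinear map on `H_c(W) ⊗ S` induced by a linear map on `S`. -/
noncomputable def liftTensor (φ : CherednikAlgebra W c →ₐ[ℂ] B) (f : S →ₗ[ℂ] M) :
    CherednikAlgebra W c ⊗[ℂ] S →ₛₗ[(φ : CherednikAlgebra W c →+* B)] M where
  toFun := TensorProduct.lift (LinearMap.mk₂ ℂ (fun h s => φ h • f s)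
    (fun a b s => by rw [map_add, add_smul]) (fun a h s => by rw [map_smul, smul_assoc])
    (fun h s t => by rw [map_add, smul_add]) (fun a h s => by rw [map_smul, smul_comm]))
  map_add' := map_add _
  map_smul' h t := by
    induction t using TensorProduct.induction_on with
    | zero => simp
    | tmul k s => simp [TensorProduct.smul_tmul', mul_smul]
    | add a b ha hb => rw [smul_add, map_add, map_add, ha, hb, smul_add]

theorem liftTensor_tmul (φ : CherednikAlgebra W c →ₐ[ℂ] B) (f : S →ₗ[ℂ] M)
    (h : CherednikAlgebra W c) (s : S) : liftTensor φ f (h ⊗ₜ s) = φ h • f s := rfl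

/-- The universal property of `Δ(σ)`, for maps that are semilinear along `φ`. -/
noncomputable def lift (φ : CherednikAlgebra W c →ₐ[ℂ] B) (f : S →ₗ[ℂ] M)
    (hw : ∀ g s, φ (gen W c (.w g)) • f s = f (σ g s))
    (hy : ∀ v s, φ (gen W c (.y v)) • f s = 0) :
    StandardModule W c σ →ₛₗ[(φ : CherednikAlgebra W c →+* B)] M :=
  (standardRel W c σ).liftQ (liftTensor φ f) <| by
    refine Submodule.span_le.2 ?_
    rintro t (⟨h, g, s, rfl⟩ | ⟨h, v, s, rfl⟩)
    · show liftTensor φ f _ = 0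
      rw [map_sub, liftTensor_tmul, liftTensor_tmul, map_mul, mul_smul, hw, sub_self]
    · show liftTensor φ f _ = 0
      rw [liftTensor_tmul, map_mul, mul_smul, hy, smul_zero]

variable (φ : CherednikAlgebra W c →ₐ[ℂ] B) (f : S →ₗ[ℂ] M)
    (hw : ∀ g s, φ (gen W c (.w g)) • f s = f (σ g s))
    (hy : ∀ v s, φ (gen W c (.y v)) • f s = 0)

theorem lift_smul (h : CherednikAlgebra W c) (m : StandardModule W c σ) :
    lift φ f hw hy (h • m) = φ h • lift φ f hw hy m :=
  (lift φ f hw hy).map_smulₛₗ h m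

theorem lift_of (s : S) : lift φ f hw hy (of c σ s) = f s := by
  show liftTensor φ f (1 ⊗ₜ s) = f s
  rw [liftTensor_tmul, map_one, one_smul]

end Lift

section Map

variable {S' : Type*} [AddCommGroup S'] [Module ℂ S'] {σ' : Representation ℂ W S'}

/-- The map `Δ(σ) → Δ(σ')` induced by an intertwining map. -/
noncomputable def map (c : (V ≃ₗᵢ[ℂ] V) → ℂ) (σ : Representation ℂ W S) (σ' : Representation ℂ W S')
    (f : S →ₗ[ℂ] S') (hf : ∀ g s, f (σ g s) = σ' g (f s)) :
    StandardModule W c σ →ₛₗ[((AlgHom.id ℂ _ : CherednikAlgebra W c →ₐ[ℂ] CherednikAlgebra W c) :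
      CherednikAlgebra W c →+* CherednikAlgebra W c)] StandardModule W c σ' :=
  lift (AlgHom.id ℂ _) (of c σ' ∘ₗ f)
    (fun g s => by
      rw [AlgHom.id_apply, LinearMap.comp_apply, gen_w_smul_of, LinearMap.comp_apply, hf])
    (fun v s => by rw [AlgHom.id_apply, LinearMap.comp_apply, gen_y_smul_of])

variable (f : S →ₗ[ℂ] S') (hf : ∀ g s, f (σ g s) = σ' g (f s))

theorem map_smul' (h : CherednikAlgebra W c) (m : StandardModule W c σ) :
    map c σ σ' f hf (h • m) = h • map c σ σ' f hf m :=
  lift_smul _ _ _ _ h m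

theorem map_of (s : S) : map c σ σ' f hf (of c σ s) = of c σ' (f s) := lift_of _ _ _ _ s

end Map

end StandardModule

open StandardModule

section DirectSums

variable {W : Subgroup (V ≃ₗᵢ[ℂ] V)}

/-- Intertwining projections that decompose `σ` decompose `Δ(σ)`. -/
theorem exists_standardModule_equiv_directSum (c : (V ≃ₗᵢ[ℂ] V) → ℂ) (σ : Representation ℂ W S)
    {ι : Type*} [Fintype ι] [DecidableEq ι] (T : ι → Type*) [∀ i, AddCommGroup (T i)]
    [∀ i, Module ℂ (T i)] (τ : ∀ i, Representation ℂ W (T i))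
    (inc : ∀ i, T i →ₗ[ℂ] S) (pr : ∀ i, S →ₗ[ℂ] T i)
    (hinc : ∀ i g t, inc i (τ i g t) = σ g (inc i t))
    (hpr : ∀ i g s, pr i (σ g s) = τ i g (pr i s))
    (hsame : ∀ i t, pr i (inc i t) = t) (hne : ∀ i j, i ≠ j → ∀ t, pr i (inc j t) = 0)
    (hsum : ∀ s, ∑ i, inc i (pr i s) = s) :
    ∃ f : StandardModule W c σ ≃+ ⨁ i, StandardModule W c (τ i),
      ∀ (a : CherednikAlgebra W c) m, f (a • m) = a • f m := by
  let F : StandardModule W c σ →+ ⨁ i, StandardModule W c (τ i) :=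
    ∑ i, (DirectSum.of (fun i => StandardModule W c (τ i)) i).comp
      (map c σ (τ i) (pr i) (hpr i)).toAddMonoidHom
  let G : (⨁ i, StandardModule W c (τ i)) →+ StandardModule W c σ :=
    DirectSum.toAddMonoid fun i => (map c (τ i) σ (inc i) (hinc i)).toAddMonoidHom
  have hF : ∀ m, F m = ∑ i, DirectSum.of (fun i => StandardModule W c (τ i)) i
      (map c σ (τ i) (pr i) (hpr i) m) := fun m => by
    rw [AddMonoidHom.finsetSum_apply]; rfl
  have hG : ∀ i m, G (DirectSum.of (fun i => StandardModule W c (τ i)) i m) =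
      map c (τ i) σ (inc i) (hinc i) m := fun i m => DirectSum.toAddMonoid_of _ _ _
  -- Functoriality of `Δ`: the composite of the induced maps is induced by `pr i ∘ inc j`, which is
  -- the identity for `i = j` and zero otherwise.
  have hpi : ∀ i j m, map c σ (τ i) (pr i) (hpr i) (map c (τ j) σ (inc j) (hinc j) m) =
      map c (τ j) (τ i) (pr i ∘ₗ inc j) (fun g t => by
        rw [LinearMap.comp_apply, hinc, hpr, LinearMap.comp_apply]) m := by
    intro i j m
    induction m using StandardModule.induction with
    | hsmul h s =>
      simp only [map_smul', map_of, LinearMap.comp_apply]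
    | hadd a b ha hb =>
      simp only [map_add, ha, hb]
  refine ⟨{ F with
    invFun := G
    left_inv := fun m => ?_
    right_inv := fun m => ?_ }, fun a m => ?_⟩
  · show G (F m) = m
    induction m using StandardModule.induction with
    | hsmul h s =>
      simp only [hF, map_sum, hG, map_smul', map_of]
      rw [← Finset.smul_sum, ← map_sum, hsum]
    | hadd a b ha hb =>
      rw [map_add, map_add, ha, hb]
  · show F (G m) = m
    induction m using DirectSum.induction_on with
    | zero => rw [map_zero, map_zero]
    | of j x =>
      rw [hG, hF, Finset.sum_eq_single j]
      · rw [hpi]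
        congr 1
        induction x using StandardModule.induction with
        | hsmul h s =>
          rw [map_smul', map_of, LinearMap.comp_apply, hsame]
        | hadd a b ha hb =>
          rw [map_add, ha, hb]
      · intro i _ hij
        rw [hpi]
        have : map c (τ j) (τ i) (pr i ∘ₗ inc j) (fun g t => by
            rw [LinearMap.comp_apply, hinc, hpr, LinearMap.comp_apply]) x = 0 := by
          induction x using StandardModule.induction with
          | hsmul h s =>
            rw [map_smul', map_of, LinearMap.comp_apply, hne i j hij, map_zero, smul_zero]
          | hadd a b ha hb =>
            rw [map_add, ha, hb, add_zero]
        rw [this, map_zero]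
      · intro h; exact absurd (Finset.mem_univ j) h
    | add a b ha hb => rw [map_add, map_add, ha, hb]
  · show F (a • m) = a • F m
    rw [hF, hF, Finset.smul_sum]
    refine Finset.sum_congr rfl fun i _ => ?_
    rw [map_smul']
    exact (DirectSum.lof (CherednikAlgebra W c) ι (fun i => StandardModule W c (τ i)) i).map_smul a _

/-- An isomorphism of representations induces one of standard modules. -/
theorem exists_standardModule_equiv (c : (V ≃ₗᵢ[ℂ] V) → ℂ) (σ : Representation ℂ W S)
    {S' : Type*} [AddCommGroup S'] [Module ℂ S'] (σ' : Representation ℂ W S') (e : S ≃ₗ[ℂ] S')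
    (he : ∀ g s, e (σ g s) = σ' g (e s)) :
    ∃ f : StandardModule W c σ ≃+ StandardModule W c σ',
      ∀ (a : CherednikAlgebra W c) m, f (a • m) = a • f m := by
  have he' : ∀ g s, e.symm (σ' g s) = σ g (e.symm s) := fun g s => by
    rw [LinearEquiv.symm_apply_eq, he, LinearEquiv.apply_symm_apply]
  refine ⟨{ (map c σ σ' e he).toAddMonoidHom with
    invFun := map c σ' σ e.symm he'
    left_inv := fun m => ?_
    right_inv := fun m => ?_ }, fun a m => map_smul' (σ := σ) (σ' := σ') (e : S →ₗ[ℂ] S') he a m⟩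
  · show map c σ' σ e.symm he' (map c σ σ' e he m) = m
    induction m using StandardModule.induction with
    | hsmul h s =>
      rw [map_smul', map_of, map_smul', map_of]
      simp
    | hadd a b ha hb =>
      rw [map_add, map_add, ha, hb]
  · show map c σ σ' e he (map c σ' σ e.symm he' m) = m
    induction m using StandardModule.induction with
    | hsmul h s =>
      rw [map_smul', map_of, map_smul', map_of]
      simp
    | hadd a b ha hb =>
      rw [map_add, map_add, ha, hb]

end DirectSums

section Restriction

variable {W W' : Subgroup (V ≃ₗᵢ[ℂ] V)} [Finite W] [Finite W']

/-- Let `W'` be normal in `W`, and let the `W`-invariant function `c` vanish at the reflections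
of `W` outside `W'`. Then `Δ(σ)` restricts to `Δ(σ|_{W'})`: the group `W` acts on the latter by
`g [h ⊗ s] = [g h g⁻¹ ⊗ g s]`, which extends the action of `H_c(W')` to one of `H_c(W)`. -/
theorem restrictsTo_standardModule (c : (V ≃ₗᵢ[ℂ] V) → ℂ) (hle : W' ≤ W)
    (hc : ∀ g ∈ W, IsReflection g → g ∉ W' → c g = 0)
    (hn : ∀ g ∈ W, ∀ h ∈ W', g * h * g⁻¹ ∈ W')
    (hinv : ∀ w ∈ W, ∀ g ∈ W, IsReflection g → c (w * g * w⁻¹) = c g)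
    (σ : Representation ℂ W S) :
    RestrictsTo (incl c hle hc) (StandardModule W c σ)
      (StandardModule W' c (σ.comp (Subgroup.inclusion hle))) := by
  classical
  set σ' : Representation ℂ W' S := σ.comp (Subgroup.inclusion hle) with hσ'
  have hinv' : ∀ w ∈ W, ∀ g ∈ W', IsReflection g → c (w * g * w⁻¹) = c g :=
    fun w hw g hg => hinv w hw g (hle hg)
  -- In the following, `T g` is the operator `[h ⊗ s] ↦ [g h g⁻¹ ⊗ g s]`. It is semilinear along `cj
  -- g`, and the universal property applies because `σ g` intertwines `σ'` with its conjugate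
  -- (`hσ`).
  let cj : W → CherednikAlgebra W' c →ₐ[ℂ] CherednikAlgebra W' c := fun g =>
    conj g.1 (hn g.1 g.2) (hinv' g.1 g.2)
  have hσ : ∀ (g : W) (h : W'), σ g * σ' h = σ' ⟨g.1 * h.1 * g.1⁻¹, hn g.1 g.2 h.1 h.2⟩ * σ g := by
    intro g h
    show σ g * σ (Subgroup.inclusion hle h) = σ (Subgroup.inclusion hle _) * σ g
    rw [← map_mul, ← map_mul]
    congr 1
    exact Subtype.ext (by simp)
  let T : ∀ g : W, StandardModule W' c σ' →ₛₗ[(cj g : CherednikAlgebra W' c →+*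
      CherednikAlgebra W' c)] StandardModule W' c σ' := fun g =>
    StandardModule.lift (cj g) (of c σ' ∘ₗ σ g)
      (fun h s => by
        rw [LinearMap.comp_apply, LinearMap.comp_apply, conj_gen]
        simp only [conjGen]
        rw [gen_w_smul_of, ← Module.End.mul_apply, ← hσ, Module.End.mul_apply])
      (fun v s => by
        rw [LinearMap.comp_apply, conj_gen]
        simp only [conjGen]
        rw [gen_y_smul_of])
  have hT : ∀ g h m, T g (h • m) = cj g h • T g m := fun g h m => StandardModule.lift_smul _ _ _ _ h m
  have hTof : ∀ g s, T g (of c σ' s) = of c σ' (σ g s) := fun g s =>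
    StandardModule.lift_of _ _ _ _ s
  have hTw : ∀ (g : W') m, T (Subgroup.inclusion hle g) m = gen W' c (.w g) • m := by
    intro g m
    induction m using StandardModule.induction with
    | hsmul h s =>
      rw [hT, hTof, ← mul_smul, ← conj_of_mem g (hn g.1 (hle g.2)) (hinv' g.1 (hle g.2)), mul_smul,
        gen_w_smul_of]
      rfl
    | hadd a b ha hb =>
      rw [map_add, smul_add, ha, hb]
  have hcj : ∀ g h a, cj (g * h) a = cj g (cj h a) := by
    intro g h a
    refine DFunLike.congr_fun (algHom_ext (f := cj (g * h)) (g := (cj g).comp (cj h))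
      fun x => ?_) a
    rw [AlgHom.comp_apply, conj_gen, conj_gen, conj_gen]
    cases x with
    | x ξ => simp only [conjGen, Subgroup.coe_mul, dualAct_mul]
    | y v => rfl
    | w k =>
      simp only [conjGen]
      congr 2
  have hTmul : ∀ g h m, T (g * h) m = T g (T h m) := by
    intro g h m
    induction m using StandardModule.induction with
    | hsmul a s =>
      rw [hT, hT, hT, hTof, hTof, hTof, hcj, map_mul, Module.End.mul_apply]
    | hadd a b ha hb =>
      rw [map_add, map_add, map_add, ha, hb]
  have hTone : ∀ m, T 1 m = m := by
    intro m
    have := hTw 1 m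
    rwa [map_one, gen_w_one, one_smul] at this
  let E := Module.End ℂ (StandardModule W' c σ')
  let L : CherednikAlgebra W' c →ₐ[ℂ] E := Algebra.lsmul ℂ ℂ (StandardModule W' c σ')
  have hL : ∀ a m, L a m = a • m := fun a m => rfl
  let TE : W → E := fun g =>
    { toFun := T g
      map_add' := map_add (T g)
      map_smul' := fun a m => by
        rw [← algebraMap_smul', hT, AlgHom.commutes]; rfl }
  let φ : CherednikGen W → E := fun x => match x with
    | .x ξ => L (gen W' c (.x ξ))
    | .y v => L (gen W' c (.y v))
    | .w g => TE g
  have hTEmul : ∀ g h, TE (g * h) = TE g * TE h := fun g h => LinearMap.ext fun m => hTmul g h m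
  have hTEone : TE 1 = 1 := LinearMap.ext hTone
  have hTEL : ∀ g a, TE g * L a = L (cj g a) * TE g := fun g a => LinearMap.ext fun m => hT g a m
  have hTEw : ∀ g : W', TE (Subgroup.inclusion hle g) = L (gen W' c (.w g)) :=
    fun g => LinearMap.ext fun m => hTw g m
  have hcjL : ∀ g a, TE g * L a * TE g⁻¹ = L (cj g a) := fun g a => by
    rw [hTEL, mul_assoc, ← hTEmul, mul_inv_cancel, hTEone, mul_one]
  -- The action of `H_c(W)` on `Δ(σ')`: `x` and `y` act as they do in `H_c(W')`, and `g ∈ W` acts by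
  -- `T g`.
  let Φ : CherednikAlgebra W c →ₐ[ℂ] E := CherednikAlgebra.lift φ <| by
    intro a b hab
    induction hab with
    | x_add ξ η => simp [φ, gen_x_add]
    | x_smul a ξ => simp [φ, gen_x_smul]
    | y_add u v => simp [φ, gen_y_add]
    | y_smul a v => simp [φ, gen_y_smul]
    | w_one => simpa [φ] using hTEone
    | w_mul g h => simpa [φ] using hTEmul g h
    | x_comm ξ η =>
      simp only [map_mul, FreeAlgebra.lift_ι_apply, φ]
      rw [← map_mul, gen_x_comm, map_mul]
    | y_comm u v =>
      simp only [map_mul, FreeAlgebra.lift_ι_apply, φ]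
      rw [← map_mul, gen_y_comm, map_mul]
    | w_x g ξ =>
      simp only [map_mul, FreeAlgebra.lift_ι_apply, φ]
      rw [hcjL, conj_gen]
      rfl
    | w_y g v =>
      simp only [map_mul, FreeAlgebra.lift_ι_apply, φ]
      rw [hcjL, conj_gen]
      rfl
    | y_x v ξ =>
      -- Only this relation uses the vanishing of `c`: the sum over `W` reduces to one over `W'`,
      -- where `TE` is the given action, and the relation becomes the one in `H_c(W')`.
      have key : ∀ F : W → E, (∀ g : W, g.1 ∉ W' → F g = 0) →
          ∑ᶠ g : W', F (Subgroup.inclusion hle g) = ∑ᶠ g : W, F g := by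
        intro F hF
        rw [← finsum_mem_range (Subgroup.inclusion_injective hle), finsum_mem_def]
        refine finsum_congr fun g => Set.indicator_apply_eq_self.2 fun hg => hF g fun hg' => ?_
        exact hg ⟨⟨g.1, hg'⟩, rfl⟩
      have h' := key (fun g => (if IsReflection g.1 then c g.1 * reflCoeff g.1 ξ v else 0) •
        TE g) (fun g hg => by
          split_ifs with hr
          · rw [hc g.1 g.2 hr hg, zero_mul, zero_smul]
          · rw [zero_smul])
      simp only [map_sub, map_mul, map_add, AlgHom.commutes, FreeAlgebra.lift_ι_apply, φ]
      rw [map_finsum _ (Set.toFinite _)]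
      simp only [map_smul, FreeAlgebra.lift_ι_apply]
      rw [← h', ← map_mul, ← map_mul, ← map_sub, gen_y_x, map_add, AlgHom.commutes,
        map_finsum _ (Set.toFinite _)]
      congr 1
      refine finsum_congr fun g => ?_
      rw [map_smul, hTEw]
      rfl
  have hΦ : ∀ x, Φ (gen W c x) = φ x := fun x => CherednikAlgebra.lift_gen _ _ x
  have hΦincl : ∀ a, Φ (incl c hle hc a) = L a := by
    intro a
    refine DFunLike.congr_fun (algHom_ext (f := Φ.comp (incl c hle hc)) (g := L) fun x => ?_) a
    rw [AlgHom.comp_apply, incl_gen, hΦ]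
    cases x with
    | x ξ => rfl
    | y v => rfl
    | w g => exact hTEw g
  -- `Δ(σ')` is a module over its own endomorphism algebra, so `G` is obtained from the universal
  -- property along `Φ`; the map `F` in the other direction comes from the one along `incl`. Both
  -- are the identity on `S`.
  let G : StandardModule W c σ →ₛₗ[(Φ : CherednikAlgebra W c →+* E)] StandardModule W' c σ' :=
    StandardModule.lift Φ (of c σ')
      (fun g s => by rw [hΦ]; exact hTof g s)
      (fun v s => by rw [hΦ]; exact gen_y_smul_of v s)
  let F : StandardModule W' c σ' →ₛₗ[(incl c hle hc : CherednikAlgebra W' c →+*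
      CherednikAlgebra W c)] StandardModule W c σ :=
    StandardModule.lift (incl c hle hc) (of c σ)
      (fun g s => by rw [incl_gen]; exact gen_w_smul_of _ s)
      (fun v s => by rw [incl_gen]; exact gen_y_smul_of v s)
  have hG : ∀ h m, G (h • m) = Φ h (G m) := fun h m => StandardModule.lift_smul _ _ _ _ h m
  have hGof : ∀ s, G (of c σ s) = of c σ' s := fun s => StandardModule.lift_of _ _ _ _ s
  have hF : ∀ h m, F (h • m) = incl c hle hc h • F m := fun h m =>
    StandardModule.lift_smul _ _ _ _ h m
  have hFof : ∀ s, F (of c σ' s) = of c σ s := fun s => StandardModule.lift_of _ _ _ _ s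
  have hFT : ∀ g m, F (T g m) = gen W c (.w g) • F m := by
    intro g m
    induction m using StandardModule.induction with
    | hsmul h s =>
      rw [hT, hTof, hF, hF, hFof, hFof, ← gen_w_smul_of, ← mul_smul, ← mul_smul, incl_conj]
    | hadd a b ha hb =>
      rw [map_add, map_add, map_add, smul_add, ha, hb]
  -- A priori `F` is linear only over `H_c(W')`. Linearity over all of `H_c(W)` is checked on
  -- generators, the group elements being covered by `hFT`.
  have hFΦ : ∀ h m, F (Φ h m) = h • F m := by
    intro h
    refine CherednikAlgebra.induction (P := fun h => ∀ m, F (Φ h m) = h • F m)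
      (fun a m => ?_) (fun x m => ?_) (fun a b ha hb m => ?_) (fun a b ha hb m => ?_) h
    · rw [AlgHom.commutes, Module.algebraMap_end_apply, ← algebraMap_smul', hF, AlgHom.commutes]
    · rw [hΦ]
      cases x with
      | x ξ => exact (hF _ m).trans (by rw [incl_gen]; rfl)
      | y v => exact (hF _ m).trans (by rw [incl_gen]; rfl)
      | w g => exact hFT g m
    · rw [map_add, LinearMap.add_apply, map_add, ha, hb, add_smul]
    · rw [map_mul, Module.End.mul_apply, ha, hb, mul_smul]
  refine ⟨{ G.toAddMonoidHom with
    invFun := F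
    left_inv := fun m => ?_
    right_inv := fun m => ?_ }, fun a m => ?_⟩
  · show F (G m) = m
    induction m using StandardModule.induction with
    | hsmul h s =>
      rw [hG, hGof, hFΦ, hFof]
    | hadd a b ha hb =>
      rw [map_add, map_add, ha, hb]
  · show G (F m) = m
    induction m using StandardModule.induction with
    | hsmul h s =>
      rw [hF, hFof, hG, hGof, hΦincl, hL]
    | hadd a b ha hb =>
      rw [map_add, map_add, ha, hb]
  · show G (incl c hle hc a • m) = a • G m
    rw [hG, hΦincl, hL]

end Restriction

end StandardModules

/-! ### Connectedness, existence and rigidity of standard tableaux. -/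

section TableauCombinatorics

variable {p d n : ℕ} [NeZero p] {lam mu : MultiPartition p d n}

/-- A set of standard tableaux that is stable under the admissible adjacent transpositions is
empty or contains every standard tableau. -/
theorem IsStd.swap_induction {P : (Fin n → Box p d) → Prop} {f g : Fin n → Box p d}
    (hf : IsStd lam f) (hP : P f)
    (hstep : ∀ (f : Fin n → Box p d) (a b : Fin n), (a : ℕ) + 1 = b → IsStd lam f →
      IsStd lam (f ∘ Equiv.swap a b) → P f → P (f ∘ Equiv.swap a b))
    (hg : IsStd lam g) : P g := by
  have hσ : ∃ σ : Equiv.Perm (Fin n), f = g ∘ σ := by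
    have h1 : ∀ k, ∃ l, g l = f k := fun k => (hg.range_iff _).2 ((hf.range_iff _).1 ⟨k, rfl⟩)
    choose s hs using h1
    have hinj : Function.Injective s := fun a b hab => hf.inj (by rw [← hs, ← hs, hab])
    exact ⟨Equiv.ofBijective s (Finite.injective_iff_bijective.1 hinj),
      funext fun k => (hs k).symm⟩
  obtain ⟨σ, hσ⟩ := hσ
  -- Induction on the permutation from `g` to the current tableau, in lexicographic order: undoing
  -- an adjacent descent makes it smaller, and a permutation without descents is the identity.
  have key : ∀ x : Lex (Fin n → Fin n), ∀ σ : Equiv.Perm (Fin n), toLex (σ : Fin n → Fin n) = x →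
      IsStd lam (g ∘ σ) → P (g ∘ σ) → P g := by
    intro x
    induction x using WellFoundedLT.induction with
    | ind x ih =>
      rintro σ rfl hst hPσ
      by_cases hdesc : ∃ (i : ℕ) (h : i + 1 < n), σ ⟨i + 1, h⟩ < σ ⟨i, Nat.lt_of_succ_lt h⟩
      · obtain ⟨i, h, hlt⟩ := hdesc
        -- The exchange could fail to be standard only if the cell of `i` were weakly north-west of
        -- that of `i + 1` in the same diagram. Then `g` would number these cells in increasing
        -- order too, against the descent.
        have hst' : IsStd lam ((g ∘ σ) ∘ Equiv.swap ⟨i, Nat.lt_of_succ_lt h⟩ ⟨i + 1, h⟩) := by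
          have hc := hst.range_comp (Equiv.swap ⟨i, Nat.lt_of_succ_lt h⟩ ⟨i + 1, h⟩)
          refine ⟨hc.1, hc.2, fun k l h1 h2 => ?_⟩
          have h3 := hst.mono _ _ h1 h2
          have h4 := hg.mono _ _ h1 h2
          by_contra hkl
          have hk : l = ⟨i, Nat.lt_of_succ_lt h⟩ ∧ k = ⟨i + 1, h⟩ := by
            simp only [Fin.le_def, swap_val, Fin.ext_iff] at *
            split_ifs at h3 <;> omega
          obtain ⟨rfl, rfl⟩ := hk
          rw [Equiv.swap_apply_left, Equiv.swap_apply_right] at h4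
          exact absurd hlt (not_lt.2 h4)
        exact ih _ (Pi.lex_desc (Fin.le_def.2 (Nat.le_succ i)) hlt)
          (σ * Equiv.swap ⟨i, Nat.lt_of_succ_lt h⟩ ⟨i + 1, h⟩) rfl
          (by rw [Equiv.Perm.coe_mul, ← Function.comp_assoc]; exact hst')
          (by rw [Equiv.Perm.coe_mul, ← Function.comp_assoc]; exact hstep _ _ _ rfl hst hst' hPσ)
      · push Not at hdesc
        have hone : (σ : Fin n → Fin n) = id := by
          cases n with
          | zero => exact Subsingleton.elim _ _
          | succ n =>
            have hm : Monotone (σ : Fin (n + 1) → Fin (n + 1)) :=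
              Fin.monotone_iff_le_succ.2 fun i => hdesc i (by omega)
            refine ((hm.strictMono_of_injective σ.injective).range_inj strictMono_id).1 ?_
            rw [σ.surjective.range_eq, Set.range_id]
        rw [hone, Function.comp_id] at hPσ
        exact hPσ
  exact key _ σ rfl (hσ ▸ hf) (hσ ▸ hP)

/-- Numbering the cells by increasing row plus column, with ties broken arbitrarily, gives a
standard tableau: among comparable distinct cells this sum is strictly increasing. -/
theorem exists_isStd (lam : MultiPartition p d n) : ∃ f, IsStd lam f := by
  let C := Σ ij : ZMod p × Fin d, (lam.shape ij.1 ij.2).cells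
  have hcard : Fintype.card C = n := by
    simp only [C, Fintype.card_sigma, Fintype.card_coe, Fintype.sum_prod_type]
    exact lam.card_eq
  let e : Fin n ≃ C := (Fintype.equivFinOfCardEq hcard).symm
  let w : Fin n → ℕ := fun k => (e k).2.1.1 + (e k).2.1.2
  let s := Tuple.sort w
  have hs : Monotone (w ∘ s) := Tuple.monotone_sort w
  let f : Fin n → Box p d := fun k => ((e (s k)).1, (e (s k)).2.1)
  have hinj : Function.Injective f := by
    intro a b hab
    refine s.injective (e.injective ?_)
    have h1 : (e (s a)).1 = (e (s b)).1 := congrArg Prod.fst hab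
    have h2 : (e (s a)).2.1 = (e (s b)).2.1 := congrArg Prod.snd hab
    generalize e (s a) = x at *
    generalize e (s b) = y at *
    obtain ⟨x1, x2⟩ := x
    obtain ⟨y1, y2⟩ := y
    obtain rfl : x1 = y1 := h1
    obtain rfl : x2 = y2 := Subtype.ext h2
    rfl
  refine ⟨f, hinj, fun b => ⟨?_, fun hb => ?_⟩, fun k l h1 h2 => ?_⟩
  · rintro ⟨k, rfl⟩
    exact (YoungDiagram.mem_cells _).1 (e (s k)).2.2
  · refine ⟨s.symm (e.symm ⟨b.1, ⟨b.2, (YoungDiagram.mem_cells _).2 hb⟩⟩), ?_⟩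
    simp only [f]
    rw [Equiv.apply_symm_apply, Equiv.apply_symm_apply]
  · by_contra hlt
    rw [not_le] at hlt
    have h3 : (f l).2.1 + (f l).2.2 ≤ (f k).2.1 + (f k).2.2 := hs hlt.le
    rw [Prod.le_def] at h2
    exact hlt.ne (hinj (Prod.ext h1.symm (Prod.ext (by omega) (by omega))))

instance (lam : MultiPartition p d n) : Finite (StdTableau lam) := by
  obtain ⟨g, hg⟩ := exists_isStd lam
  have h1 : ∀ (f : StdTableau lam) k, ∃ l, g l = f.1 k := fun f k =>
    (hg.range_iff _).2 ((f.2.range_iff _).1 ⟨k, rfl⟩)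
  choose s hs using h1
  refine Finite.of_injective s fun f f' hff => Subtype.ext (funext fun k => ?_)
  rw [← hs, ← hs, hff]

/-- A standard tableau is determined by the diagrams and the contents of its entries. -/
theorem IsStd.eq_of_content {f g : Fin n → Box p d} (hf : IsStd lam f) (hg : IsStd mu g)
    (h1 : ∀ k, (f k).1 = (g k).1) (h2 : ∀ k, content f k = content g k) : f = g := by
  -- Cells of equal content are comparable. If the cell of `k` in `f` lies weakly north-west of that
  -- in `g`, then `g` puts some `m ≤ k` into it, and `m < k` contradicts injectivity of `f`, as `f`
  -- and `g` agree below `k`. All data are quantified again because the lemma is used with `f` and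
  -- `g` exchanged.
  have key : ∀ {lam mu : MultiPartition p d n} {f g : Fin n → Box p d}, IsStd lam f → IsStd mu g →
      (∀ k, (f k).1 = (g k).1) → ∀ k : Fin n, (∀ l < k, f l = g l) → (f k).2 ≤ (g k).2 →
      f k = g k := by
    intro lam mu f g hf hg h1 k hk hle
    obtain ⟨m, hm, hmk⟩ := hg.exists_le k _ hle
    rcases hmk.lt_or_eq with h | rfl
    · rw [← hk m h] at hm
      have := hf.inj (hm.trans (Prod.ext (h1 k).symm rfl))
      exact absurd this h.ne
    · rw [hm, ← h1]
  funext k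
  induction k using WellFoundedLT.induction with
  | ind k ih =>
    have hc := h2 k
    unfold content at hc
    rcases le_total (f k).2.1 (g k).2.1 with h | h
    · exact key hf hg h1 k ih (Prod.le_def.2 ⟨h, by omega⟩)
    · exact (key hg hf (fun k => (h1 k).symm) k (fun l hl => (ih l hl).symm)
        (Prod.le_def.2 ⟨h, by omega⟩)).symm

theorem IsStd.shape_unique {f : Fin n → Box p d} (hf : IsStd lam f) (hg : IsStd mu f) :
    lam = mu := by
  refine MultiPartition.ext (funext fun i => funext fun j => YoungDiagram.ext ?_)
  ext x
  rw [YoungDiagram.mem_cells, YoungDiagram.mem_cells]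
  exact (hf.range_iff ((i, j), x)).symm.trans (hg.range_iff ((i, j), x))

/-! ### Shifts of multipartitions and of fillings, and orbit lengths. -/

theorem shift_iterate_shape (lam : MultiPartition p d n) (m : ℕ) (i : ZMod p) (j : Fin d) :
    (MultiPartition.shift^[m] lam).shape i j = lam.shape (i + m) j := by
  induction m generalizing i with
  | zero => simp
  | succ m ih =>
    rw [Function.iterate_succ_apply']
    show (MultiPartition.shift^[m] lam).shape (i + 1) j = _
    rw [ih]
    push_cast
    rw [add_right_comm, add_assoc]

theorem shift_iterate_self (lam : MultiPartition p d n) : MultiPartition.shift^[p] lam = lam := by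
  refine MultiPartition.ext (funext fun i => funext fun j => ?_)
  rw [shift_iterate_shape, CharP.cast_eq_zero, add_zero]

theorem shiftFilling_shiftFilling (m m' : ℕ) (f : Fin n → Box p d) :
    shiftFilling m (shiftFilling m' f) = shiftFilling (m + m') f := by
  funext k
  simp only [shiftFilling, Nat.cast_add, sub_sub, add_comm]

theorem shiftFilling_mul_self (m : ℕ) (f : Fin n → Box p d) : shiftFilling (m * p) f = f := by
  funext k
  simp [shiftFilling]

theorem shiftFilling_self (f : Fin n → Box p d) : shiftFilling p f = f := by
  funext k
  simp [shiftFilling]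

theorem shiftFilling_zero (f : Fin n → Box p d) : shiftFilling 0 f = f := by
  funext k
  simp [shiftFilling]

theorem IsStd.shiftFilling {f : Fin n → Box p d} (hf : IsStd lam f) (m : ℕ) :
    IsStd (MultiPartition.shift^[m] lam) (shiftFilling m f) where
  inj a b hab := hf.inj (Prod.ext ((shiftFilling_fst_eq m f a b).1 (congrArg Prod.fst hab))
    (congrArg Prod.snd hab :))
  range_iff b := by
    rw [shift_iterate_shape, ← hf.range_iff ((b.1.1 + m, b.1.2), b.2)]
    refine exists_congr fun k => ⟨fun h => ?_, fun h => ?_⟩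
    · rw [← h]; simp [ImprimitiveCherednik.shiftFilling]
    · simp [ImprimitiveCherednik.shiftFilling, h]
  mono k l h1 h2 := hf.mono k l ((shiftFilling_fst_eq m f k l).1 h1) h2

/-- The diagram index of the entry `0` detects the shift; for `n = 0` the empty filling is fixed by
every shift. -/
theorem shiftFilling_eq_self_iff [NeZero n] (m : ℕ) (f : Fin n → Box p d) :
    shiftFilling m f = f ↔ p ∣ m := by
  rw [← ZMod.natCast_eq_zero_iff]
  constructor
  · intro h
    have := congrArg (fun x : Box p d => x.1.1) (congrFun h 0)
    simpa [shiftFilling] using this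
  · intro h
    funext k
    simp [shiftFilling, h]

/-- The length of the cyclic equivalence class of `λ`. -/
noncomputable def orbitLength (lam : MultiPartition p d n) : ℕ :=
  Function.minimalPeriod MultiPartition.shift lam

theorem orbitLength_dvd (lam : MultiPartition p d n) : orbitLength lam ∣ p :=
  Function.IsPeriodicPt.minimalPeriod_dvd (shift_iterate_self lam)

theorem orbitLength_pos (lam : MultiPartition p d n) : 0 < orbitLength lam :=
  Nat.pos_of_dvd_of_pos (orbitLength_dvd lam) (NeZero.pos p)

theorem ncard_cyclicEquiv (lam : MultiPartition p d n) :
    {mu | CyclicEquiv lam mu}.ncard = orbitLength lam := by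
  have h : {mu | CyclicEquiv lam mu} =
      (fun k => MultiPartition.shift^[k] lam) '' (Finset.range (orbitLength lam) : Set ℕ) := by
    ext mu
    simp only [Set.mem_ofPred_eq, Finset.coe_range, Set.mem_image, Set.mem_Iio]
    constructor
    · rintro ⟨k, rfl⟩
      exact ⟨k % orbitLength lam, Nat.mod_lt _ (orbitLength_pos lam),
        Function.iterate_mod_minimalPeriod_eq⟩
    · rintro ⟨k, _, rfl⟩
      exact ⟨k, rfl⟩
  rw [h, Set.InjOn.ncard_image, Set.ncard_coe_finset, Finset.card_range]
  intro a ha b hb hab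
  exact Function.iterate_injOn_Iio_minimalPeriod (by simpa [orbitLength] using ha)
    (by simpa [orbitLength] using hb) hab

theorem eNumber_eq (lam : MultiPartition p d n) : eNumber lam = p / orbitLength lam := by
  rw [eNumber, ncard_cyclicEquiv]

theorem eNumber_mul (lam : MultiPartition p d n) : eNumber lam * orbitLength lam = p := by
  rw [eNumber_eq, Nat.div_mul_cancel (orbitLength_dvd lam)]

instance (lam : MultiPartition p d n) : NeZero (eNumber lam) :=
  ⟨fun h => NeZero.ne p (by rw [← eNumber_mul lam, h, zero_mul])⟩

theorem div_eNumber (lam : MultiPartition p d n) : p / eNumber lam = orbitLength lam :=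
  Nat.div_eq_of_eq_mul_right (NeZero.pos _) (eNumber_mul lam).symm

theorem shift_iterate_eq_self_iff (lam : MultiPartition p d n) (m : ℕ) :
    MultiPartition.shift^[m] lam = lam ↔ orbitLength lam ∣ m :=
  Function.isPeriodicPt_iff_minimalPeriod_dvd

theorem CyclicEquiv.eNumber_eq (h : CyclicEquiv lam mu) : eNumber mu = eNumber lam := by
  obtain ⟨k, rfl⟩ := h
  have hp : lam ∈ Function.periodicPts (MultiPartition.shift (p := p) (d := d) (n := n)) :=
    ⟨p, NeZero.pos p, shift_iterate_self lam⟩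
  rw [ImprimitiveCherednik.eNumber_eq, ImprimitiveCherednik.eNumber_eq, orbitLength,
    Function.minimalPeriod_apply_iterate hp]
  rfl

/-- If both tableaux are standard, the two cells lie in different diagrams, or are incomparable and
so differ in content by at least two. Hence `1 + α` is nonzero and a transposition really reaches
the exchanged tableau. -/
theorem IsStd.axial_sq_ne_one {f : Fin n → Box p d} (hf : IsStd lam f) {a b : Fin n}
    (hab : (a : ℕ) + 1 = b) (hs : IsStd lam (f ∘ Equiv.swap a b)) : axial f a b ^ 2 ≠ 1 := by
  intro h
  by_cases hc : (f a).1 = (f b).1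
  · rw [axial, if_pos hc] at h
    have hd : content f b - content f a = 1 ∨ content f b - content f a = -1 := by
      rw [inv_pow, inv_eq_one] at h
      exact sq_eq_one_iff.1 (by exact_mod_cast h)
    have n1 : ¬ (f a).2 ≤ (f b).2 := fun hle => by
      have := hs.mono b a (by simpa using hc) (by simpa using hle)
      rw [Fin.le_def] at this; omega
    have n2 : ¬ (f b).2 ≤ (f a).2 := fun hle => by
      have := hf.mono b a hc.symm hle
      rw [Fin.le_def] at this; omega
    rw [Prod.le_def] at n1 n2
    unfold content at hd
    omega
  · rw [axial, if_neg hc] at h; norm_num at h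

end TableauCombinatorics

/-! ### Projections to the eigenspaces of an operator of finite order. -/

section EigenProjection

variable {M : Type*} [AddCommGroup M] [Module ℂ M]

/-- For an operator `A` with `A ^ e = 1`, the projection to the eigenspace for the eigenvalue `ω`,
an `e`-th root of unity. -/
noncomputable def eigenProj (A : Module.End ℂ M) (e : ℕ) (ω : ℂ) : Module.End ℂ M :=
  (e : ℂ)⁻¹ • ∑ j ∈ Finset.range e, (ω⁻¹ • A) ^ j

variable {A : Module.End ℂ M} {e : ℕ} {ω : ℂ}

theorem mul_eigenProj (hA : A ^ e = 1) (hω : ω ^ e = 1) (he : e ≠ 0) :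
    A * eigenProj A e ω = ω • eigenProj A e ω := by
  have hω0 : ω ≠ 0 := by rintro rfl; simp [he] at hω
  have h1 : (ω⁻¹ • A) ^ e = 1 := by rw [smul_pow, inv_pow, hω, hA, inv_one, one_smul]
  have h2 := mul_geom_sum (ω⁻¹ • A) e
  rw [h1, sub_self, sub_mul, one_mul, sub_eq_zero] at h2
  unfold eigenProj
  rw [mul_smul_comm, smul_comm]
  congr 1
  rw [← h2, ← smul_mul_assoc, smul_smul, mul_inv_cancel₀ hω0, one_smul, ← h2]
  simp only [h2]

theorem commute_eigenProj {B : Module.End ℂ M} (h : Commute B A) :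
    Commute B (eigenProj A e ω) := by
  unfold eigenProj
  exact (Commute.sum_right _ _ _ fun j _ => (h.smul_right _).pow_right _).smul_right _

/-- On an eigenvector the average is a geometric sum in the `e`-th root of unity `ω⁻¹ ω'`, which
vanishes unless this root is one. -/
theorem eigenProj_apply_of_eigen {ω' : ℂ} {v : M} (hv : A v = ω' • v) (hω : ω ^ e = 1)
    (hω' : ω' ^ e = 1) (he : e ≠ 0) : eigenProj A e ω v = if ω = ω' then v else 0 := by
  have hω0 : ω ≠ 0 := by rintro rfl; simp [he] at hω
  have h1 : ∀ j : ℕ, ((ω⁻¹ • A) ^ j) v = (ω⁻¹ * ω') ^ j • v := by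
    intro j
    induction j with
    | zero => simp
    | succ j ih =>
      rw [pow_succ', Module.End.mul_apply, ih, map_smul, LinearMap.smul_apply, hv, smul_smul,
        smul_smul]
      congr 1; ring
  rw [eigenProj, LinearMap.smul_apply, LinearMap.sum_apply]
  simp only [h1]
  rw [← Finset.sum_smul, smul_smul]
  split_ifs with h
  · subst h
    rw [inv_mul_cancel₀ hω0]
    simp [he]
  · have h2 := mul_geom_sum (ω⁻¹ * ω') e
    rw [mul_pow, inv_pow, hω, hω', inv_one, mul_one, sub_self] at h2
    rcases mul_eq_zero.1 h2 with h3 | h3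
    · refine absurd ?_ h
      rw [sub_eq_zero, inv_mul_eq_one₀ hω0] at h3
      exact h3
    · rw [h3, mul_zero, zero_smul]

/-- By orthogonality of roots of unity only the power `A ^ 0` survives the summation over `l`. The
offset `t` allows any `e` consecutive exponents: both `1, …, e` and `0, …, e - 1` are needed. -/
theorem sum_eigenProj {ζ : ℂ} (hζ : IsPrimitiveRoot ζ e) (he : e ≠ 0) (t : ℕ) :
    ∑ l ∈ Finset.range e, eigenProj A e (ζ ^ (l + t)) = 1 := by
  have hζ0 : ζ ≠ 0 := hζ.ne_zero he
  unfold eigenProj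
  rw [← Finset.smul_sum, Finset.sum_comm, Finset.sum_eq_single 0]
  · simp only [pow_zero, Finset.sum_const, Finset.card_range]
    rw [← Nat.cast_smul_eq_nsmul ℂ, smul_smul, inv_mul_cancel₀ (by exact_mod_cast he), one_smul]
  · intro j hj hj0
    have h1 : ∀ l : ℕ, ((ζ ^ (l + t))⁻¹ • A) ^ j = ((ζ⁻¹ ^ j) ^ l * (ζ⁻¹ ^ (t * j))) • A ^ j := by
      intro l
      rw [smul_pow]
      congr 1
      rw [← inv_pow, ← pow_mul, ← pow_mul, ← pow_add]
      congr 1; ring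
    simp only [h1]
    rw [← Finset.sum_smul, ← Finset.sum_mul]
    have h2 := mul_geom_sum (ζ⁻¹ ^ j) e
    have h3 : (ζ⁻¹ ^ j) ^ e = 1 := by
      rw [← pow_mul, mul_comm, pow_mul, inv_pow, hζ.pow_eq_one, inv_one, one_pow]
    rw [h3, sub_self] at h2
    rcases mul_eq_zero.1 h2 with h4 | h4
    · rw [sub_eq_zero, inv_pow, inv_eq_one] at h4
      exact absurd h4 (hζ.pow_ne_one_of_pos_of_lt hj0 (Finset.mem_range.1 hj))
    · rw [h4, zero_mul, zero_smul]
  · intro h; exact absurd (Finset.mem_range.2 (Nat.pos_of_ne_zero he)) h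

end EigenProjection

/-! ### Separation of points by finite-dimensional function algebras. -/

section FunctionAlgebra

/-- A subalgebra of the algebra of functions on a finite set contains every function that is
constant on the sets of points that it does not separate. -/
theorem mem_subalgebra_of_separated {X : Type*} [Finite X] (D : Subalgebra ℂ (X → ℂ)) (g : X → ℂ)
    (hg : ∀ x y, (∀ φ ∈ D, φ x = φ y) → g x = g y) : g ∈ D := by
  classical
  have := Fintype.ofFinite X
  let R : X → X → Prop := fun x y => ∀ φ ∈ D, φ x = φ y
  have hind : ∀ x, (fun y => if R x y then (1 : ℂ) else 0) ∈ D := by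
    intro x
    have h1 : ∀ z, ∃ φ ∈ D, (∀ y, R x y → φ y = 1) ∧ (¬ R x z → φ z = 0) := by
      intro z
      by_cases hz : R x z
      · exact ⟨1, D.one_mem, fun _ _ => rfl, fun h => absurd hz h⟩
      · have hz' := hz
        simp only [R] at hz'
        push Not at hz'
        obtain ⟨φ, hφ, hne⟩ := hz'
        refine ⟨(φ x - φ z)⁻¹ • (φ - algebraMap ℂ _ (φ z)),
          D.smul_mem (D.sub_mem hφ (D.algebraMap_mem _)) _, fun y hy => ?_, fun _ => ?_⟩
        · simp only [Pi.smul_apply, Pi.sub_apply, Pi.algebraMap_apply, ← hy φ hφ]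
          exact inv_mul_cancel₀ (sub_ne_zero.2 hne)
        · simp
    choose φ hφ h1φ h0φ using h1
    -- The indicator of the class of `x` is a product over all points `z` of functions equal to one
    -- on the class, and vanishing at `z` if `z` is outside it.
    have : (fun y => if R x y then (1 : ℂ) else 0) = ∏ z, φ z := by
      funext y
      rw [Finset.prod_apply]
      split_ifs with h
      · exact (Finset.prod_eq_one fun z _ => h1φ z y h).symm
      · exact (Finset.prod_eq_zero (f := fun z => φ z y) (Finset.mem_univ y) (h0φ y h)).symm
    rw [this]
    exact D.prod_mem fun z _ => hφ z
  have hR : ∀ x y, R x y → R y x := fun x y h φ hφ => (h φ hφ).symm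
  -- Each class occurs in the sum once for every one of its elements, hence the division by its
  -- cardinality.
  have hsum : g = ∑ x, (g x * ((Finset.univ.filter fun y => R x y).card : ℂ)⁻¹) •
      (fun y => if R x y then (1 : ℂ) else 0) := by
    funext y
    rw [Finset.sum_apply]
    have h2 : ∀ x, ((g x * ((Finset.univ.filter fun y => R x y).card : ℂ)⁻¹) •
        (fun y => if R x y then (1 : ℂ) else 0)) y =
        if R y x then g y * ((Finset.univ.filter fun z => R y z).card : ℂ)⁻¹ else 0 := by
      intro x
      by_cases h : R x y
      · have hcls : (Finset.univ.filter fun z => R x z) = Finset.univ.filter fun z => R y z := by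
          ext z
          simp only [Finset.mem_filter, Finset.mem_univ, true_and]
          exact ⟨fun h' φ hφ => (h φ hφ).symm.trans (h' φ hφ),
            fun h' φ hφ => (h φ hφ).trans (h' φ hφ)⟩
        simp only [Pi.smul_apply, if_pos h, if_pos (hR _ _ h), hg x y h, hcls, smul_eq_mul, mul_one]
      · simp only [Pi.smul_apply, if_neg h, if_neg (fun h' => h (hR _ _ h')), smul_zero]
    rw [Finset.sum_congr rfl fun x _ => h2 x, ← Finset.sum_filter, Finset.sum_const, nsmul_eq_mul,
      mul_left_comm, mul_inv_cancel₀, mul_one]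
    have : y ∈ Finset.univ.filter fun z => R y z :=
      Finset.mem_filter.2 ⟨Finset.mem_univ y, fun _ _ => rfl⟩
    exact_mod_cast Finset.card_ne_zero_of_mem this
  rw [hsum]
  exact D.sum_mem fun x _ => D.smul_mem (hind x) _

end FunctionAlgebra

/-! ### Realization of monomial matrices by unitary transformations. -/

section MonomialTransformations

/-- Every monomial matrix with entries of modulus one is a unitary transformation. -/
theorem exists_isometry_isMonomial {n : ℕ} (θ : Fin n → ℂ) (σ : Equiv.Perm (Fin n))
    (hθ : ∀ i, ‖θ i‖ = 1) :
    ∃ w : EuclideanSpace ℂ (Fin n) ≃ₗᵢ[ℂ] EuclideanSpace ℂ (Fin n), IsMonomial w θ σ := by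
  have h0 : ∀ i, θ i ≠ 0 := fun i h => by have := hθ i; rw [h, norm_zero] at this; norm_num at this
  let s : ∀ _ : Fin n, ℂ ≃ₗᵢ[ℂ] ℂ := fun i =>
    { LinearEquiv.smulOfNeZero ℂ ℂ (θ i) (h0 i) with
      norm_map' := fun z => by
        show ‖θ i • z‖ = ‖z‖
        rw [norm_smul, hθ, one_mul] }
  refine ⟨(LinearIsometryEquiv.piLpCongrLeft 2 ℂ ℂ σ).trans
    (LinearIsometryEquiv.piLpCongrRight 2 s), fun v i => ?_⟩
  rfl

end MonomialTransformations

/-! ### Diagonal operators generated by `G(r, p, n)`. -/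

section GroupOperators

variable {p d n : ℕ} [NeZero p] {lam : MultiPartition p d n}

theorem norm_eq_one_of_pow {r : ℕ} [NeZero r] {z : ℂ} (hz : z ^ r = 1) : ‖z‖ = 1 :=
  Complex.norm_eq_one_of_pow_eq_one hz (NeZero.ne r)

/-- The algebra of operators on `V(λ)` generated by `G(r, p, n)`. -/
noncomputable def groupOperators (lam : MultiPartition p d n) :
    Subalgebra ℂ (Module.End ℂ (VMod lam)) :=
  Algebra.adjoin ℂ (Set.range (VRes lam))

theorem VRes_apply (w : imprimitiveGroup (p * d) p n) {θ : Fin n → ℂ} {σ : Equiv.Perm (Fin n)}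
    (h : IsMonomial w.1 θ σ) : VRes lam w = torusOp lam θ * permRep lam σ :=
  VRep_apply lam _ h

theorem mem_of_groupOperators {U : Submodule ℂ (VMod lam)}
    (hU : ∀ w, ∀ v ∈ U, VRes lam w v ∈ U) {B : Module.End ℂ (VMod lam)}
    (hB : B ∈ groupOperators lam) : ∀ v ∈ U, B v ∈ U := by
  refine Algebra.adjoin_induction (p := fun B _ => ∀ v ∈ U, B v ∈ U) ?_ ?_ ?_ ?_ hB
  · rintro _ ⟨w, rfl⟩
    exact hU w
  · intro a v hv
    rw [Module.algebraMap_end_apply]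
    exact U.smul_mem a hv
  · intro B C _ _ hB hC v hv
    exact U.add_mem (hB v hv) (hC v hv)
  · intro B C _ _ hB hC v hv
    exact hB _ (hC v hv)

theorem torusOp_mem [NeZero d] {θ : Fin n → ℂ} (h1 : ∀ i, θ i ^ (p * d) = 1)
    (h2 : (∏ i, θ i) ^ d = 1) : torusOp lam θ ∈ groupOperators lam := by
  obtain ⟨w, hw⟩ := exists_isometry_isMonomial θ 1 fun i => norm_eq_one_of_pow (h1 i)
  have hmem : w ∈ imprimitiveGroup (p * d) p n :=
    ⟨θ, 1, h1, by rwa [Nat.mul_div_cancel_left _ (NeZero.pos p)], hw⟩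
  have h := VRes_apply (lam := lam) ⟨w, hmem⟩ hw
  rw [map_one, mul_one] at h
  rw [← h]
  exact Algebra.subset_adjoin ⟨_, rfl⟩

theorem swapOp_mem {a b : Fin n} (hab : (a : ℕ) + 1 = b) : swapOp lam a b ∈ groupOperators lam := by
  obtain ⟨w, hw⟩ := exists_isometry_isMonomial (fun _ => 1) (Equiv.swap a b) fun _ => norm_one
  have hmem : w ∈ imprimitiveGroup (p * d) p n :=
    ⟨fun _ => 1, Equiv.swap a b, by simp, by simp, hw⟩
  have h := VRes_apply (lam := lam) ⟨w, hmem⟩ hw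
  obtain ⟨a, ha⟩ := a
  obtain ⟨b, hb⟩ := b
  obtain rfl : a + 1 = b := hab
  rw [torusOp_one, one_mul, permRep_swap lam a hb] at h
  rw [← h]
  exact Algebra.subset_adjoin ⟨_, rfl⟩

/-- The operator `v(T) ↦ φ(T) v(T)`. -/
noncomputable def diagOp (lam : MultiPartition p d n) :
    (StdTableau lam → ℂ) →ₐ[ℂ] Module.End ℂ (VMod lam) where
  toFun φ := Finsupp.linearCombination ℂ fun T => φ T • Finsupp.single T 1
  map_one' := by
    ext T : 2
    simp
  map_mul' φ ψ := by
    ext T : 2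
    simp [mul_comm]
  map_zero' := by
    ext T : 2
    simp
  map_add' φ ψ := by
    ext T : 2
    simp
  commutes' a := by
    ext T : 2
    simp

theorem diagOp_vec (φ : StdTableau lam → ℂ) (T : StdTableau lam) :
    diagOp lam φ (vec lam T.1) = φ T • vec lam T.1 := by
  show Finsupp.linearCombination ℂ (fun T => φ T • Finsupp.single T 1) _ = _
  rw [vec_std, Finsupp.linearCombination_single, one_smul]

theorem diagOp_apply (φ : StdTableau lam → ℂ) (v : VMod lam) (T : StdTableau lam) :
    diagOp lam φ v T = φ T * v T := by
  induction v using Finsupp.induction_linear with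
  | zero => simp
  | add v w hv hw => rw [map_add, Finsupp.add_apply, hv, hw, Finsupp.add_apply, mul_add]
  | single S a =>
    classical
    show Finsupp.linearCombination ℂ (fun T => φ T • Finsupp.single T 1) _ _ = _
    rw [Finsupp.linearCombination_single]
    simp only [Finsupp.smul_apply, Finsupp.single_apply, smul_eq_mul]
    split_ifs with h
    · rw [h]; ring
    · ring

/-- The functions `φ` on the standard tableaux for which the operator `v(T) ↦ φ(T) v(T)` is in the
algebra generated by `G(r, p, n)`. -/
noncomputable def diagonals (lam : MultiPartition p d n) : Subalgebra ℂ (StdTableau lam → ℂ) :=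
  (groupOperators lam).comap (diagOp lam)

theorem mem_diagonals_of_vec {φ : StdTableau lam → ℂ} {B : Module.End ℂ (VMod lam)}
    (hB : B ∈ groupOperators lam) (h : ∀ T : StdTableau lam, B (vec lam T.1) = φ T • vec lam T.1) :
    φ ∈ diagonals lam := by
  have : diagOp lam φ = B := end_ext fun f hf => by
    rw [h ⟨f, hf⟩]; exact diagOp_vec φ ⟨f, hf⟩
  show diagOp lam φ ∈ groupOperators lam
  rwa [this]

/-- The exponent with which the `k`-th entry of a diagonal matrix acts on `v(f)`. -/
def weight (f : Fin n → Box p d) (k : Fin n) : ℕ := d * (f k).1.1.val + ((f k).1.2 : ℕ)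

theorem weight_lt (f : Fin n → Box p d) (k : Fin n) : weight f k < p * d := by
  unfold weight
  have h1 := ZMod.val_lt (f k).1.1
  have h2 := (f k).1.2.isLt
  calc _ < d * (f k).1.1.val + d := by omega
    _ = d * ((f k).1.1.val + 1) := by ring
    _ ≤ d * p := Nat.mul_le_mul_left d h1
    _ = p * d := mul_comm _ _

/-- The weight `d i + j` with `j < d` determines `i` and `j` as its quotient and remainder by `d`.
-/
theorem weight_eq_iff (f : Fin n → Box p d) (a b : Fin n) :
    weight f a = weight f b ↔ (f a).1 = (f b).1 := by
  refine ⟨fun h => ?_, fun h => by rw [weight, weight, h]⟩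
  unfold weight at h
  have h1 := (f a).1.2.isLt
  have h2 := (f b).1.2.isLt
  have hd : 0 < d := by omega
  have e1 := congrArg (· % d) h
  have e2 := congrArg (· / d) h
  simp only [Nat.mul_add_mod, Nat.mod_eq_of_lt h1, Nat.mod_eq_of_lt h2] at e1
  simp only [Nat.mul_add_div hd, Nat.div_eq_of_lt h1, Nat.div_eq_of_lt h2, add_zero] at e2
  exact Prod.ext (ZMod.val_injective p e2) (Fin.ext e1)

theorem mulSingle_pow {z : ℂ} (a : Fin n) (N : Fin n → ℕ) (k : Fin n) :
    (Pi.mulSingle a z : Fin n → ℂ) k ^ N k = (Pi.mulSingle a (z ^ N a) : Fin n → ℂ) k := by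
  by_cases h : k = a
  · subst h; simp
  · simp [Pi.mulSingle_eq_of_ne h]

theorem prod_mulSingle (a : Fin n) (z : ℂ) : ∏ k, (Pi.mulSingle a z : Fin n → ℂ) k = z := by
  rw [Finset.prod_eq_single a (fun k _ hk => Pi.mulSingle_eq_of_ne hk _)
    (fun h => absurd (Finset.mem_univ a) h), Pi.mulSingle_eq_same]

theorem mulSingle_root {r : ℕ} {z : ℂ} (hz : z ^ r = 1) (a k : Fin n) :
    (Pi.mulSingle a z : Fin n → ℂ) k ^ r = 1 := by
  rw [mulSingle_pow a (fun _ => r), hz, Pi.mulSingle_one, Pi.one_apply]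

/-- A diagonal matrix with `ζ` at `a` and `ζ⁻¹` at `b` has product of entries one, so it lies in
`G(r, p, n)`. Writing it as a product of two `Pi.mulSingle` also covers `a = b`. -/
theorem weight_sub_mem_diagonals [NeZero d] {ζ : ℂ} (hζ : ζ ^ (p * d) = 1) (a b : Fin n) :
    (fun T : StdTableau lam => ζ ^ weight T.1 a * ζ⁻¹ ^ weight T.1 b) ∈ diagonals lam := by
  have hζ0 : ζ ≠ 0 := by
    rintro rfl
    rw [zero_pow (NeZero.ne (p * d))] at hζ; exact zero_ne_one hζ
  have hζ' : ζ⁻¹ ^ (p * d) = 1 := by rw [inv_pow, hζ, inv_one]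
  refine mem_diagonals_of_vec (torusOp_mem
    (θ := fun k => (Pi.mulSingle a ζ : Fin n → ℂ) k * (Pi.mulSingle b ζ⁻¹ : Fin n → ℂ) k)
    (fun i => ?_) ?_) fun T => ?_
  · rw [mul_pow, mulSingle_root hζ, mulSingle_root hζ', mul_one]
  · rw [Finset.prod_mul_distrib, prod_mulSingle, prod_mulSingle, mul_inv_cancel₀ hζ0, one_pow]
  · rw [torusOp_vec]
    congr 1
    have : ∀ k, ((Pi.mulSingle a ζ : Fin n → ℂ) k * (Pi.mulSingle b ζ⁻¹ : Fin n → ℂ) k) ^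
        (d * (T.1 k).1.1.val + ((T.1 k).1.2 : ℕ)) =
        (Pi.mulSingle a (ζ ^ weight T.1 a) : Fin n → ℂ) k *
          (Pi.mulSingle b (ζ⁻¹ ^ weight T.1 b) : Fin n → ℂ) k := fun k => by
      rw [mul_pow]
      exact congrArg₂ _ (mulSingle_pow a (weight T.1) k) (mulSingle_pow b (weight T.1) k)
    simp only [this]
    rw [Finset.prod_mul_distrib, prod_mulSingle, prod_mulSingle]

/-- A single nontrivial entry is allowed in `G(r, p, n)` when it is a `d`-th root of unity, such as
`ζ ^ p`; it sees the weight modulo `d`, that is, the index `j`. -/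
theorem weight_mem_diagonals [NeZero d] {ζ : ℂ} (hζ : ζ ^ (p * d) = 1) (a : Fin n) :
    (fun T : StdTableau lam => (ζ ^ p) ^ weight T.1 a) ∈ diagonals lam := by
  have h1 : (ζ ^ p) ^ (p * d) = 1 := by rw [← pow_mul, mul_comm, pow_mul, hζ, one_pow]
  refine mem_diagonals_of_vec (torusOp_mem (θ := Pi.mulSingle a (ζ ^ p))
    (fun i => mulSingle_root h1 a i) ?_) fun T => ?_
  · rw [prod_mulSingle, ← pow_mul, hζ]
  · rw [torusOp_vec]
    congr 1
    exact (Finset.prod_congr rfl fun k _ => mulSingle_pow a (weight T.1) k).trans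
      (prod_mulSingle _ _)

open scoped Classical in
-- For a primitive `ζ` the ratio of the weights of `a` and `b` is one exactly when the diagrams
-- coincide, so the indicator is constant on the sets not separated by `diagonals`.
theorem indicator_mem_diagonals [NeZero d] (a b : Fin n) :
    (fun T : StdTableau lam => if (T.1 a).1 = (T.1 b).1 then (1 : ℂ) else 0) ∈ diagonals lam := by
  have hζ := Complex.isPrimitiveRoot_exp (p * d) (NeZero.ne _)
  set ζ := Complex.exp (2 * Real.pi * Complex.I / (p * d : ℕ)) with hζdef
  have hζ0 : ζ ≠ 0 := hζ.ne_zero (NeZero.ne _)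
  have key : ∀ T : StdTableau lam, ζ ^ weight T.1 a * ζ⁻¹ ^ weight T.1 b = 1 ↔
      (T.1 a).1 = (T.1 b).1 := fun T => by
    rw [inv_pow, mul_inv_eq_one₀ (pow_ne_zero _ hζ0), ← weight_eq_iff]
    exact ⟨fun h => hζ.pow_inj (weight_lt _ _) (weight_lt _ _) h, fun h => by rw [h]⟩
  refine mem_subalgebra_of_separated _ _ fun T T' h => ?_
  have := h _ (weight_sub_mem_diagonals hζ.pow_eq_one a b)
  simp only [← key]
  rw [this]

theorem content_swap (f : Fin n → Box p d) (s : Fin n → Fin n) (a : Fin n) :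
    content (f ∘ s) a = content f (s a) := rfl

/-- The contents are the eigenvalues of the Jucys-Murphy elements, which satisfy
`J_{k+1} = s_k J_k s_k + s_k Π_k`, where `Π_k` is the projection to the span of the tableaux with
`k` and `k + 1` in the same diagram. -/
theorem content_mem_diagonals [NeZero d] (k : Fin n) :
    (fun T : StdTableau lam => (content T.1 k : ℂ)) ∈ diagonals lam := by
  classical
  obtain ⟨k, hk⟩ := k
  induction k with
  | zero =>
    have : (fun T : StdTableau lam => (content T.1 ⟨0, hk⟩ : ℂ)) = 0 := by
      funext T
      -- The smallest number must occupy the corner of its diagram, where the content is zero.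
      obtain ⟨m, hm, hm0⟩ := T.2.exists_le ⟨0, hk⟩ (0, 0) (Prod.le_def.2 ⟨Nat.zero_le _, Nat.zero_le _⟩)
      have : m = ⟨0, hk⟩ := le_antisymm hm0 (Fin.le_def.2 (Nat.zero_le _))
      subst this
      have h0 : (T.1 ⟨0, hk⟩).2 = (0, 0) := congrArg Prod.snd hm
      simp [content, h0]
    rw [this]
    exact (diagonals lam).zero_mem
  | succ k ih =>
    have ih := ih (Nat.lt_of_succ_lt hk)
    set a : Fin n := ⟨k, Nat.lt_of_succ_lt hk⟩ with ha
    set b : Fin n := ⟨k + 1, hk⟩ with hb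
    have hab : (a : ℕ) + 1 = b := rfl
    set J : Module.End ℂ (VMod lam) := diagOp lam fun T : StdTableau lam => (content T.1 a : ℂ)
    set Q : Module.End ℂ (VMod lam) := diagOp lam fun T : StdTableau lam =>
      if (T.1 a).1 = (T.1 b).1 then (1 : ℂ) else 0
    have hs := swapOp_mem (lam := lam) hab
    refine mem_diagonals_of_vec (B := swapOp lam a b * J * swapOp lam a b + swapOp lam a b * Q)
      (Subalgebra.add_mem _ (Subalgebra.mul_mem _ (Subalgebra.mul_mem _ hs ih) hs)
        (Subalgebra.mul_mem _ hs (indicator_mem_diagonals a b))) fun T => ?_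
    have hJ : ∀ f : Fin n → Box p d, J (vec lam f) = (content f a : ℂ) • vec lam f := fun f => by
      by_cases hf : IsStd lam f
      · exact diagOp_vec _ ⟨f, hf⟩
      · rw [vec_not hf, map_zero, smul_zero]
    have hQ : Q (vec lam T.1) =
        (if (T.1 a).1 = (T.1 b).1 then (1 : ℂ) else 0) • vec lam T.1 := diagOp_vec _ T
    have hc : axial T.1 a b * ((content T.1 b : ℂ) - content T.1 a) =
        if (T.1 a).1 = (T.1 b).1 then (1 : ℂ) else 0 := by
      unfold axial
      split_ifs with h
      · have hne : ((content T.1 b - content T.1 a : ℤ) : ℂ) ≠ 0 := by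
          rw [Int.cast_ne_zero, sub_ne_zero]
          intro h'
          have := T.2.content_lt (Fin.lt_def.2 (by omega)) h h'.symm
          omega
        rw [← Int.cast_sub, inv_mul_cancel₀ hne]
      · rw [zero_mul]
    -- The exchanged tableau has content `ct(b)` at `a`. On `v(T)` itself `J` gives `α ct(a)`, and
    -- `Q` supplies the missing `α (ct(b) - ct(a))` by `hc`. Applying the transposition, an
    -- involution, isolates the eigenvalue `ct(b)`.
    have h1 : J (swapOp lam a b (vec lam T.1)) + Q (vec lam T.1) =
        (content T.1 b : ℂ) • swapOp lam a b (vec lam T.1) := by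
      rw [hQ, ← hc, swapOp_vec lam hab, map_add, map_smul, map_smul, hJ, hJ, content_swap,
        Equiv.swap_apply_left]
      match_scalars <;> ring
    rw [LinearMap.add_apply, Module.End.mul_apply, Module.End.mul_apply, Module.End.mul_apply,
      ← map_add, h1, map_smul, ← Module.End.mul_apply, swapOp_sq lam hab, Module.End.one_apply]

theorem modEq_of_pow_eq {k : ℕ} {ζ : ℂ} (hζ : IsPrimitiveRoot ζ k) (hk : k ≠ 0) {a b : ℕ}
    (h : ζ ^ a = ζ ^ b) : a ≡ b [MOD k] := by
  rw [← pow_mod_orderOf, ← pow_mod_orderOf ζ b, ← hζ.eq_orderOf] at h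
  exact hζ.pow_inj (Nat.mod_lt _ (Nat.pos_of_ne_zero hk)) (Nat.mod_lt _ (Nat.pos_of_ne_zero hk)) h

/-- Tableaux that are not separated by the diagonal operators in the algebra generated by
`G(r, p, n)` are shifts of each other. -/
theorem exists_shift_of_not_separated [NeZero d] [NeZero n] {T T' : StdTableau lam}
    (h : ∀ φ ∈ diagonals lam, φ T = φ T') :
    ∃ j < eNumber lam, T'.1 = shiftFilling (j * orbitLength lam) T.1 := by
  have hζ := Complex.isPrimitiveRoot_exp (p * d) (NeZero.ne _)
  set ζ := Complex.exp (2 * Real.pi * Complex.I / (p * d : ℕ)) with hζdef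
  have hζ0 : ζ ≠ 0 := hζ.ne_zero (NeZero.ne _)
  have hd : 0 < d := NeZero.pos d
  -- The weights modulo `d` give the indices `j`. The ratios of weights then give, in `hi`, that the
  -- displacement of the index `i` modulo `p` is the same for all entries.
  have hj : ∀ a, (T'.1 a).1.2 = (T.1 a).1.2 := by
    intro a
    have h1 := h _ (weight_mem_diagonals hζ.pow_eq_one a)
    have hprim : IsPrimitiveRoot (ζ ^ p) d := hζ.pow (NeZero.pos _) rfl
    replace h1 := modEq_of_pow_eq hprim (NeZero.ne d) h1
    have h2 : weight T.1 a % d = weight T'.1 a % d := h1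
    unfold weight at h2
    rw [Nat.mul_add_mod, Nat.mul_add_mod, Nat.mod_eq_of_lt (Fin.isLt _),
      Nat.mod_eq_of_lt (Fin.isLt _)] at h2
    exact Fin.ext h2.symm
  have hi : ∀ a b, (T'.1 a).1.1 + (T.1 b).1.1 = (T.1 a).1.1 + (T'.1 b).1.1 := by
    intro a b
    have h1 := h _ (weight_sub_mem_diagonals hζ.pow_eq_one a b)
    have h2 : ζ ^ (weight T'.1 a + weight T.1 b) = ζ ^ (weight T.1 a + weight T'.1 b) := by
      rw [inv_pow, inv_pow, ← div_eq_mul_inv, ← div_eq_mul_inv,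
        div_eq_div_iff (pow_ne_zero _ hζ0) (pow_ne_zero _ hζ0)] at h1
      rw [pow_add, pow_add, h1]
    replace h2 := modEq_of_pow_eq hζ (NeZero.ne _) h2
    have e1 : weight T'.1 a + weight T.1 b = d * ((T'.1 a).1.1.val + (T.1 b).1.1.val) +
        (((T.1 a).1.2 : ℕ) + ((T.1 b).1.2 : ℕ)) := by
      unfold weight; rw [hj]; ring
    have e2 : weight T.1 a + weight T'.1 b = d * ((T.1 a).1.1.val + (T'.1 b).1.1.val) +
        (((T.1 a).1.2 : ℕ) + ((T.1 b).1.2 : ℕ)) := by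
      unfold weight; rw [hj]; ring
    rw [e1, e2, mul_comm p d] at h2
    have h3 := Nat.ModEq.mul_left_cancel' hd.ne' (Nat.ModEq.add_right_cancel' _ h2)
    have h4 := (ZMod.natCast_eq_natCast_iff _ _ _).2 h3
    push_cast at h4
    simpa only [ZMod.natCast_zmod_val] using h4
  have hct : ∀ a, content T'.1 a = content T.1 a := by
    intro a
    have h1 := h _ (content_mem_diagonals a)
    exact_mod_cast h1.symm
  -- The common displacement, read off at the entry `0`. As a residue it is less than `p`, which
  -- later bounds `j` by `eNumber lam`.
  set m : ℕ := ((T.1 0).1.1 - (T'.1 0).1.1).val with hm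
  have hT' : T'.1 = shiftFilling m T.1 := by
    refine T'.2.eq_of_content (T.2.shiftFilling m) (fun a => ?_) hct
    refine Prod.ext ?_ (hj a)
    show (T'.1 a).1.1 = (T.1 a).1.1 - (m : ZMod p)
    rw [hm, ZMod.natCast_zmod_val]
    linear_combination hi a 0
  -- `T'` is standard for both `λ` and its shift by `m`; a filling determines its shape, so `m` is a
  -- period of `λ`.
  have hshape := (shift_iterate_eq_self_iff lam m).1
    ((hT' ▸ T.2.shiftFilling m : IsStd (MultiPartition.shift^[m] lam) T'.1).shape_unique T'.2)
  obtain ⟨j, hj'⟩ := hshape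
  refine ⟨j, ?_, by rw [hT', hj', mul_comm]⟩
  have h1 : m < p := ZMod.val_lt _
  rw [hj', mul_comm] at h1
  exact Nat.lt_of_mul_lt_mul_right (h1.trans_eq (eNumber_mul lam).symm)

end GroupOperators

/-! ### The eigenspaces `V(λ̄, l)` and their irreducibility. -/

section Irreducibility

variable {p d n : ℕ} [NeZero p] {lam : MultiPartition p d n}

/-- The eigenvalue `exp(2 π i l / e_λ)`. -/
noncomputable def shiftEigenvalue (lam : MultiPartition p d n) (l : ℕ) : ℂ :=
  Complex.exp (2 * Real.pi * Complex.I * l / eNumber lam)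

theorem shiftEigenvalue_eq_pow (lam : MultiPartition p d n) (l : ℕ) :
    shiftEigenvalue lam l = Complex.exp (2 * Real.pi * Complex.I / eNumber lam) ^ l := by
  rw [← Complex.exp_nat_mul, shiftEigenvalue]
  congr 1
  ring

theorem shiftEigenvalue_pow (lam : MultiPartition p d n) (l : ℕ) :
    shiftEigenvalue lam l ^ eNumber lam = 1 := by
  rw [shiftEigenvalue_eq_pow, ← pow_mul, mul_comm l, pow_mul,
    (Complex.isPrimitiveRoot_exp (eNumber lam) (NeZero.ne _)).pow_eq_one, one_pow]

theorem mem_VBar {l : ℕ} {v : VMod lam} : v ∈ (VBar lam l).toSubmodule ↔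
    shiftOp lam (orbitLength lam) v = shiftEigenvalue lam l • v := by
  rw [← div_eNumber]
  exact Module.End.mem_eigenspace_iff

theorem IsStd.shiftFilling_orbitLength {f : Fin n → Box p d} (hf : IsStd lam f) (j : ℕ) :
    IsStd lam (ImprimitiveCherednik.shiftFilling (j * orbitLength lam) f) := by
  have := hf.shiftFilling (j * orbitLength lam)
  rwa [(shift_iterate_eq_self_iff lam _).2 (dvd_mul_left _ _)] at this

theorem shiftOp_pow_vec {f : Fin n → Box p d} (hf : IsStd lam f) (j : ℕ) :
    (shiftOp lam (orbitLength lam) ^ j) (vec lam f) =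
      vec lam (shiftFilling (j * orbitLength lam) f) := by
  induction j with
  | zero => rw [pow_zero, zero_mul, shiftFilling_zero, Module.End.one_apply]
  | succ j ih =>
    rw [pow_succ', Module.End.mul_apply, ih, shiftOp_vec _ (hf.shiftFilling_orbitLength j),
      shiftFilling_shiftFilling, add_mul, one_mul, add_comm]

/-- The total displacement is `eNumber lam * orbitLength lam = p`, which is zero on indices in
`ℤ/p`. -/
theorem shiftOp_pow_eNumber (lam : MultiPartition p d n) :
    shiftOp lam (orbitLength lam) ^ eNumber lam = 1 := by
  refine end_ext fun f hf => ?_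
  rw [shiftOp_pow_vec hf, eNumber_mul, Module.End.one_apply, shiftFilling_self]

theorem commute_VRes_shiftOp (m : ℕ) (w : imprimitiveGroup (p * d) p n) :
    Commute (VRes lam w) (shiftOp lam m) := by
  obtain ⟨θ, σ, h1, h2, h3⟩ := w.2
  rw [Nat.mul_div_cancel_left _ (NeZero.pos p)] at h2
  show VRes lam w * shiftOp lam m = shiftOp lam m * VRes lam w
  rw [VRes_apply w h3, ← mul_assoc (shiftOp lam m), shiftOp_torusOp lam _ h1 h2, mul_assoc,
    mul_assoc, shiftOp_permRep]

/-- The projection of `V(λ)` to `V(λ̄, l)`. -/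
noncomputable def VBarProj (lam : MultiPartition p d n) (l : ℕ) : Module.End ℂ (VMod lam) :=
  eigenProj (shiftOp lam (orbitLength lam)) (eNumber lam) (shiftEigenvalue lam l)

theorem shiftOp_VBarProj (l : ℕ) : shiftOp lam (orbitLength lam) * VBarProj lam l =
    shiftEigenvalue lam l • VBarProj lam l :=
  mul_eigenProj (shiftOp_pow_eNumber lam) (shiftEigenvalue_pow lam l) (NeZero.ne _)

theorem VBarProj_mem (l : ℕ) (v : VMod lam) : VBarProj lam l v ∈ (VBar lam l).toSubmodule := by
  rw [mem_VBar, ← Module.End.mul_apply, shiftOp_VBarProj]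
  rfl

theorem VBarProj_of_mem {l : ℕ} {v : VMod lam} (hv : v ∈ (VBar lam l).toSubmodule) :
    VBarProj lam l v = v := by
  rw [VBarProj, eigenProj_apply_of_eigen (mem_VBar.1 hv) (shiftEigenvalue_pow lam l)
    (shiftEigenvalue_pow lam l) (NeZero.ne _), if_pos rfl]

theorem VBarProj_of_mem_ne {l l' : ℕ} (h : shiftEigenvalue lam l ≠ shiftEigenvalue lam l')
    {v : VMod lam} (hv : v ∈ (VBar lam l').toSubmodule) : VBarProj lam l v = 0 := by
  rw [VBarProj, eigenProj_apply_of_eigen (mem_VBar.1 hv) (shiftEigenvalue_pow lam l)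
    (shiftEigenvalue_pow lam l') (NeZero.ne _), if_neg h]

theorem commute_VRes_VBarProj (l : ℕ) (w : imprimitiveGroup (p * d) p n) :
    Commute (VRes lam w) (VBarProj lam l) :=
  commute_eigenProj (commute_VRes_shiftOp _ w)

theorem sum_VBarProj (lam : MultiPartition p d n) (t : ℕ) :
    ∑ l ∈ Finset.range (eNumber lam), VBarProj lam (l + t) = 1 := by
  simp only [VBarProj, shiftEigenvalue_eq_pow]
  exact sum_eigenProj (Complex.isPrimitiveRoot_exp _ (NeZero.ne _)) (NeZero.ne _) t

/-- All shifts of `T` that preserve `λ` have proportional projections. Hence a vector of the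
eigenspace supported on one class of tableaux is determined up to a scalar. -/
theorem VBarProj_shift (l j : ℕ) {f : Fin n → Box p d} (hf : IsStd lam f) :
    VBarProj lam l (vec lam (shiftFilling (j * orbitLength lam) f)) =
      shiftEigenvalue lam l ^ j • VBarProj lam l (vec lam f) := by
  have hcomm : Commute (shiftOp lam (orbitLength lam)) (VBarProj lam l) :=
    commute_eigenProj (Commute.refl _)
  rw [← shiftOp_pow_vec hf, ← Module.End.mul_apply, ← (hcomm.pow_left j).eq]
  induction j with
  | zero => simp
  | succ j ih =>
    rw [pow_succ', mul_assoc, Module.End.mul_apply, ih, map_smul, ← Module.End.mul_apply,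
      shiftOp_VBarProj, LinearMap.smul_apply, smul_smul, pow_succ]

/-- For `0 < j < e` the shifted tableau differs from `T`, so only the term `j = 0` contributes to
the coefficient at `T`, which is `1 / e`. -/
theorem VBarProj_vec_ne_zero [NeZero n] (l : ℕ) {f : Fin n → Box p d} (hf : IsStd lam f) :
    VBarProj lam l (vec lam f) ≠ 0 := by
  intro h
  have h1 := DFunLike.congr_fun h (⟨f, hf⟩ : StdTableau lam)
  rw [VBarProj, eigenProj, LinearMap.smul_apply, LinearMap.sum_apply, Finsupp.smul_apply,
    Finsupp.finsetSum_apply, Finset.sum_eq_single 0] at h1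
  · rw [pow_zero, Module.End.one_apply, vec, dif_pos hf, Finsupp.single_eq_same] at h1
    simp at h1
    exact NeZero.ne _ h1
  · intro j hj hj0
    rw [smul_pow, LinearMap.smul_apply, shiftOp_pow_vec hf, vec,
      dif_pos (hf.shiftFilling_orbitLength j), Finsupp.smul_apply, Finsupp.single_eq_of_ne, smul_zero]
    intro h2
    have h3 := congrArg Subtype.val h2
    have h4 := (shiftFilling_eq_self_iff _ _).1 h3.symm
    have h5 : eNumber lam ∣ j := by
      refine Nat.dvd_of_mul_dvd_mul_right (orbitLength_pos lam) ?_
      rwa [eNumber_mul]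
    exact absurd (Nat.le_of_dvd (Nat.pos_of_ne_zero hj0) h5) (not_le.2 (Finset.mem_range.1 hj))
  · intro h2
    exact absurd (Finset.mem_range.2 (NeZero.pos _)) h2

theorem commute_swapOp_VBarProj (l : ℕ) {a b : Fin n} (hab : (a : ℕ) + 1 = b) :
    Commute (swapOp lam a b) (VBarProj lam l) :=
  commute_eigenProj (shiftOp_swapOp lam _ hab).symm

/-- A nonzero `G(r, p, n)`-invariant subspace of `V(λ̄, l)` is all of it. -/
theorem eq_VBar_of_invariant [NeZero d] [NeZero n] {l : ℕ} {U : Submodule ℂ (VMod lam)}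
    (hU : ∀ w, ∀ v ∈ U, VRes lam w v ∈ U) (hle : U ≤ (VBar lam l).toSubmodule) (hne : U ≠ ⊥) :
    U = (VBar lam l).toSubmodule := by
  classical
  obtain ⟨u, huU, hu0⟩ := U.ne_bot_iff.1 hne
  obtain ⟨T, hT⟩ := Finsupp.ne_iff.1 hu0
  rw [Finsupp.zero_apply] at hT
  let R : StdTableau lam → Prop := fun T' => ∀ φ ∈ diagonals lam, φ T = φ T'
  have hind : (fun T' => if R T' then (1 : ℂ) else 0) ∈ diagonals lam := by
    refine mem_subalgebra_of_separated _ _ fun x y h => ?_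
    have : R x ↔ R y := ⟨fun hx φ hφ => (hx φ hφ).trans (h φ hφ),
      fun hy φ hφ => (hy φ hφ).trans (h φ hφ).symm⟩
    simp only [this]
  -- The vector `u` is cut down to the class of a tableau `T` in its support. The result `x` lies in
  -- `U`, hence in the eigenspace, so it equals its own projection, a multiple of the projection of
  -- `v(T)` by `hspan`.
  set x := diagOp lam (fun T' => if R T' then (1 : ℂ) else 0) u with hx
  have hxU : x ∈ U := mem_of_groupOperators hU hind u huU
  have hxT : x T ≠ 0 := by
    rw [hx, diagOp_apply, if_pos (fun φ _ => rfl), one_mul]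
    exact hT
  have hspan : ∀ y : VMod lam, (∀ T' ∈ y.support, R T') →
      VBarProj lam l y ∈ Submodule.span ℂ {VBarProj lam l (vec lam T.1)} := by
    intro y hy
    rw [← Finsupp.sum_single y, Finsupp.sum, map_sum]
    refine Submodule.sum_mem _ fun T' hT' => ?_
    obtain ⟨j, _, hj⟩ := exists_shift_of_not_separated (hy T' hT')
    rw [← mul_one (y T'), ← smul_eq_mul, ← Finsupp.smul_single, map_smul, ← vec_std, hj,
      VBarProj_shift l j T.2]
    exact Submodule.smul_mem _ _ (Submodule.smul_mem _ _ (Submodule.mem_span_singleton_self _))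
  have h1 := hspan x fun T' hT' => by
    by_contra hR
    rw [Finsupp.mem_support_iff, hx, diagOp_apply, if_neg hR, zero_mul] at hT'
    exact hT' rfl
  rw [VBarProj_of_mem (hle hxU), Submodule.mem_span_singleton] at h1
  obtain ⟨s, hs⟩ := h1
  have hs0 : s ≠ 0 := by
    rintro rfl
    rw [zero_smul] at hs
    rw [← hs] at hxT
    exact hxT rfl
  have h2 : VBarProj lam l (vec lam T.1) ∈ U := by
    rw [← inv_smul_smul₀ hs0 (VBarProj lam l (vec lam T.1)), hs]
    exact U.smul_mem _ hxU
  -- The transposition commutes with the projection. After subtracting the part already in `U`, the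
  -- projection of the exchanged tableau remains with coefficient `1 + α`, which is nonzero.
  have h3 : ∀ T' : StdTableau lam, VBarProj lam l (vec lam T'.1) ∈ U := by
    intro T'
    refine IsStd.swap_induction (P := fun f => VBarProj lam l (vec lam f) ∈ U) T.2 h2 ?_ T'.2
    intro f a b hab hf hf' hP
    have h4 : swapOp lam a b (VBarProj lam l (vec lam f)) ∈ U :=
      mem_of_groupOperators hU (swapOp_mem hab) _ hP
    rw [← Module.End.mul_apply, (commute_swapOp_VBarProj l hab).eq, Module.End.mul_apply,
      swapOp_vec lam hab, map_add, map_smul, map_smul] at h4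
    have h5 := (U.add_mem_iff_right (U.smul_mem _ hP)).1 h4
    have h6 := hf.axial_sq_ne_one hab hf'
    have h7 : coeffAux (axial f a b) ≠ 0 := by
      rw [coeffAux, if_neg h6]
      intro h8
      exact h6 (by rw [show axial f a b = -1 by linear_combination h8]; norm_num)
    exact (U.smul_mem_iff h7).1 h5
  refine le_antisymm hle fun v hv => ?_
  rw [← VBarProj_of_mem hv, ← Finsupp.sum_single v, Finsupp.sum, map_sum]
  refine Submodule.sum_mem _ fun T' _ => ?_
  rw [← mul_one (v T'), ← smul_eq_mul, ← Finsupp.smul_single, map_smul, ← vec_std]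
  exact U.smul_mem _ (h3 T')

/-- The inclusion of `V(λ̄, l)` in `V(λ)`. -/
noncomputable def VBarIncl (lam : MultiPartition p d n) (l : ℕ) : VBarMod lam l →ₗ[ℂ] VMod lam where
  toFun x := Subtype.val (p := fun v => v ∈ (VBar lam l).toSubmodule) x
  map_add' _ _ := rfl
  map_smul' _ _ := rfl

theorem VBarIncl_mem {l : ℕ} (x : VBarMod lam l) : VBarIncl lam l x ∈ (VBar lam l).toSubmodule :=
  Subtype.property (p := fun v => v ∈ (VBar lam l).toSubmodule) x

theorem VBarIncl_injective (l : ℕ) : Function.Injective (VBarIncl lam l) :=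
  Subtype.val_injective (p := fun v => v ∈ (VBar lam l).toSubmodule)

theorem exists_VBarIncl_eq {l : ℕ} {v : VMod lam} (hv : v ∈ (VBar lam l).toSubmodule) :
    ∃ x, VBarIncl lam l x = v :=
  ⟨(⟨v, hv⟩ : {v // v ∈ (VBar lam l).toSubmodule}), rfl⟩

theorem VBarIncl_VBarRep (l : ℕ) (w : imprimitiveGroup (p * d) p n) (x : VBarMod lam l) :
    VBarIncl lam l (VBarRep lam l w x) = VRes lam w (VBarIncl lam l x) := rfl

theorem VBar_ne_bot [NeZero n] (lam : MultiPartition p d n) (l : ℕ) :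
    (VBar lam l).toSubmodule ≠ ⊥ := by
  obtain ⟨f, hf⟩ := exists_isStd lam
  intro h
  have := VBarProj_mem l (vec lam f)
  rw [h, Submodule.mem_bot] at this
  exact VBarProj_vec_ne_zero l hf this

theorem isIrreducible_VBarRep [NeZero d] [NeZero n] (lam : MultiPartition p d n) (l : ℕ) :
    (VBarRep lam l).IsIrreducible where
  exists_pair_ne := by
    refine ⟨⊥, ⊤, fun h => VBar_ne_bot lam l ?_⟩
    have h1 : (⊥ : Submodule ℂ (VBarMod lam l)) = ⊤ := congrArg Subrepresentation.toSubmodule h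
    rw [Submodule.eq_bot_iff]
    intro v hv
    obtain ⟨x, rfl⟩ := exists_VBarIncl_eq hv
    have h2 : x ∈ (⊥ : Submodule ℂ (VBarMod lam l)) := h1 ▸ Submodule.mem_top
    rw [(Submodule.mem_bot ℂ).1 h2, map_zero]
  eq_bot_or_eq_top X := by
    let U : Submodule ℂ (VMod lam) := Submodule.map (VBarIncl lam l) X.toSubmodule
    have hU : ∀ w, ∀ v ∈ U, VRes lam w v ∈ U := by
      rintro w _ ⟨x, hx, rfl⟩
      exact ⟨VBarRep lam l w x, X.apply_mem_toSubmodule w hx, rfl⟩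
    have hle : U ≤ (VBar lam l).toSubmodule := by
      rintro _ ⟨x, _, rfl⟩
      exact VBarIncl_mem x
    by_cases hne : U = ⊥
    · left
      refine Subrepresentation.toSubmodule_injective ?_
      exact Submodule.map_injective_of_injective (VBarIncl_injective l)
        (hne.trans (Submodule.map_bot _).symm)
    · right
      have h1 := eq_VBar_of_invariant hU hle hne
      refine Subrepresentation.toSubmodule_injective ?_
      refine Submodule.eq_top_iff'.2 fun x => ?_
      have h2 : VBarIncl lam l x ∈ U := by rw [h1]; exact VBarIncl_mem x
      obtain ⟨y, hy, hyx⟩ := h2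
      rwa [VBarIncl_injective l hyx] at hy

/-- For `e = 1` the shift by the orbit length is the shift by `p`, hence the identity, and the
eigenvalue for `l = 0` is one. -/
theorem VBar_eq_top (h : eNumber lam = 1) : (VBar lam 0).toSubmodule = ⊤ := by
  refine Submodule.eq_top_iff'.2 fun v => ?_
  rw [mem_VBar]
  have h1 := shiftOp_pow_eNumber lam
  rw [h, pow_one] at h1
  rw [h1, shiftEigenvalue_eq_pow, pow_zero, one_smul, Module.End.one_apply]

theorem isIrreducible_VRes [NeZero d] [NeZero n] (h : eNumber lam = 1) :
    (VRes lam).IsIrreducible where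
  exists_pair_ne := by
    refine ⟨⊥, ⊤, fun h' => VBar_ne_bot lam 0 ?_⟩
    rw [VBar_eq_top h]
    exact (congrArg Subrepresentation.toSubmodule h').symm
  eq_bot_or_eq_top X := by
    by_cases hne : X.toSubmodule = ⊥
    · exact Or.inl (Subrepresentation.toSubmodule_injective hne)
    · refine Or.inr (Subrepresentation.toSubmodule_injective ?_)
      refine (eq_VBar_of_invariant (l := 0) (fun w v hv => X.apply_mem_toSubmodule w hv) ?_
        hne).trans (VBar_eq_top h)
      rw [VBar_eq_top h]
      exact le_top

end Irreducibility

/-! ### Change of representative, and assembly of the decomposition. -/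

section Restriction

variable {p d n : ℕ} [NeZero p] {lam mu : MultiPartition p d n}

/-- The product of the nonzero entries is multiplicative on monomial matrices, hence unchanged by
conjugation. -/
theorem imprimitiveGroup_normal (r p n : ℕ) : ∀ g ∈ imprimitiveGroup r 1 n,
    ∀ h ∈ imprimitiveGroup r p n, g * h * g⁻¹ ∈ imprimitiveGroup r p n := by
  rintro g hg h ⟨θ', σ', h1', h2', h3'⟩
  obtain ⟨θ, σ, h1, _, h3⟩ := hg
  have h4 : IsMonomial g⁻¹ (fun i => (θ (σ i))⁻¹) σ⁻¹ := fun v i => by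
    have h := h3 (g.symm v) (σ i)
    rw [LinearIsometryEquiv.apply_symm_apply, Equiv.symm_apply_apply] at h
    show g.symm v i = (θ (σ i))⁻¹ * v (σ i)
    rw [h, inv_mul_cancel_left₀ (h3.ne_zero _)]
  refine ⟨_, _, fun i => ?_, ?_, (h3.mul h3').mul h4⟩
  · rw [mul_pow, mul_pow, h1, h1', inv_pow, h1, inv_one, mul_one, mul_one]
  · rw [Finset.prod_mul_distrib, Finset.prod_mul_distrib, Equiv.prod_comp σ.symm θ',
      Equiv.prod_comp (σ * σ').symm fun i => (θ (σ i))⁻¹, Equiv.prod_comp σ fun i => (θ i)⁻¹,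
      Finset.prod_inv_distrib, mul_comm (∏ i, θ i), mul_inv_cancel_right₀, h2']
    exact Finset.prod_ne_zero_iff.2 fun i _ => h3.ne_zero i

/-- The shift by `k` is undone by the shift by `k * p - k`, a natural number congruent to `-k`
modulo `p`. -/
theorem isStd_shiftFilling_iff (k : ℕ) {f : Fin n → Box p d} :
    IsStd (MultiPartition.shift^[k] lam) (shiftFilling k f) ↔ IsStd lam f := by
  refine ⟨fun h => ?_, fun h => h.shiftFilling k⟩
  have h1 := h.shiftFilling (k * p - k)
  have h2 : k * p - k + k = k * p := Nat.sub_add_cancel (Nat.le_mul_of_pos_right k (NeZero.pos p))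
  rw [← Function.iterate_add_apply, shiftFilling_shiftFilling, h2, shiftFilling_mul_self,
    mul_comm, Function.iterate_mul, Function.iterate_fixed (shift_iterate_self lam)] at h1
  exact h1

/-- The shift of standard tableaux by `k`, as a bijection. -/
noncomputable def stdShift (lam : MultiPartition p d n) (k : ℕ) :
    StdTableau lam ≃ StdTableau (MultiPartition.shift^[k] lam) :=
  Equiv.ofBijective (fun T => ⟨shiftFilling k T.1, T.2.shiftFilling k⟩) <| by
    have h2 : k * p - k + k = k * p :=
      Nat.sub_add_cancel (Nat.le_mul_of_pos_right k (NeZero.pos p))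
    refine ⟨fun T T' h => Subtype.ext ?_, fun T => ?_⟩
    · have h1 := congrArg (shiftFilling (k * p - k)) (congrArg Subtype.val h)
      simpa only [shiftFilling_shiftFilling, h2, shiftFilling_mul_self] using h1
    · have h3 : shiftFilling k (shiftFilling (k * p - k) T.1) = T.1 := by
        rw [shiftFilling_shiftFilling, add_comm, h2, shiftFilling_mul_self]
      refine ⟨⟨shiftFilling (k * p - k) T.1, ?_⟩, Subtype.ext h3⟩
      rw [← isStd_shiftFilling_iff k, h3]
      exact T.2

/-- The linear isomorphism `v(T) ↦ v(shift^k T)`. -/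
noncomputable def shiftEquiv (lam : MultiPartition p d n) (k : ℕ) :
    VMod lam ≃ₗ[ℂ] VMod (MultiPartition.shift^[k] lam) :=
  Finsupp.domLCongr (stdShift lam k)

theorem shiftEquiv_vec (k : ℕ) (f : Fin n → Box p d) :
    shiftEquiv lam k (vec lam f) = vec (MultiPartition.shift^[k] lam) (shiftFilling k f) := by
  by_cases hf : IsStd lam f
  · rw [vec, dif_pos hf, vec, dif_pos (hf.shiftFilling k)]
    exact Finsupp.domLCongr_single _ _ _
  · rw [vec_not hf, map_zero, vec_not fun h => hf ((isStd_shiftFilling_iff k).1 h)]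

theorem shiftEquiv_swapOp (k : ℕ) {a b : Fin n} (hab : (a : ℕ) + 1 = b) (v : VMod lam) :
    shiftEquiv lam k (swapOp lam a b v) =
      swapOp (MultiPartition.shift^[k] lam) a b (shiftEquiv lam k v) := by
  refine LinearMap.congr_fun (f := (shiftEquiv lam k).toLinearMap ∘ₗ swapOp lam a b)
    (g := swapOp (MultiPartition.shift^[k] lam) a b ∘ₗ (shiftEquiv lam k).toLinearMap)
    (end_ext fun f _ => ?_) v
  simp only [LinearMap.comp_apply, LinearEquiv.coe_coe]
  rw [swapOp_vec lam hab, shiftEquiv_vec, swapOp_vec _ hab, map_add, map_smul, map_smul,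
    shiftEquiv_vec, shiftEquiv_vec, axial_shiftFilling]
  rfl

theorem shiftEquiv_permRep (k : ℕ) (σ : Equiv.Perm (Fin n)) : ∀ v : VMod lam,
    shiftEquiv lam k (permRep lam σ v) =
      permRep (MultiPartition.shift^[k] lam) σ (shiftEquiv lam k v) := by
  refine perm_induction (P := fun σ => ∀ v : VMod lam, shiftEquiv lam k (permRep lam σ v) =
    permRep (MultiPartition.shift^[k] lam) σ (shiftEquiv lam k v)) ?_ ?_ ?_ σ
  · intro v; rw [map_one, map_one]; rfl
  · intro i h v
    rw [permRep_swap, permRep_swap, shiftEquiv_swapOp k rfl]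
  · intro σ τ hσ hτ v
    rw [map_mul, map_mul, Module.End.mul_apply, Module.End.mul_apply, hσ, hτ]

/-- The shift changes every weight by `-d k` modulo `p d`, that is, the eigenvalue by a power of `(∏
θ_i) ^ d`. This is one for `G(r, p, n)`, but not in general for `G(r, 1, n)`. -/
theorem shiftEquiv_torusOp (k : ℕ) {θ : Fin n → ℂ} (h1 : ∀ i, θ i ^ (p * d) = 1)
    (h2 : (∏ i, θ i) ^ d = 1) (v : VMod lam) :
    shiftEquiv lam k (torusOp lam θ v) =
      torusOp (MultiPartition.shift^[k] lam) θ (shiftEquiv lam k v) := by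
  refine LinearMap.congr_fun (f := (shiftEquiv lam k).toLinearMap ∘ₗ torusOp lam θ)
    (g := torusOp (MultiPartition.shift^[k] lam) θ ∘ₗ (shiftEquiv lam k).toLinearMap)
    (end_ext fun f _ => ?_) v
  simp only [LinearMap.comp_apply, LinearEquiv.coe_coe]
  rw [torusOp_vec, map_smul, shiftEquiv_vec, torusOp_vec]
  congr 1
  have h3 : ∏ i, (θ i ^ d) ^ k = 1 := by
    rw [Finset.prod_pow, Finset.prod_pow, h2, one_pow]
  rw [← mul_one (∏ i, θ i ^ (d * (shiftFilling k f i).1.1.val + _)), ← h3,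
    ← Finset.prod_mul_distrib]
  refine Finset.prod_congr rfl fun i _ => ?_
  rw [pow_add, pow_add, pow_val_sub d k _ (h1 i)]
  simp only [shiftFilling]
  ring

/-- Cyclically equivalent multipartitions define isomorphic representations of `G(r, p, n)`. -/
theorem CyclicEquiv.exists_equiv (h : CyclicEquiv lam mu) :
    ∃ e : VMod lam ≃ₗ[ℂ] VMod mu, ∀ w v, e (VRes lam w v) = VRes mu w (e v) := by
  obtain ⟨k, rfl⟩ := h
  refine ⟨shiftEquiv lam k, fun w v => ?_⟩
  obtain ⟨θ, σ, h1, h2, h3⟩ := w.2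
  rw [Nat.mul_div_cancel_left _ (NeZero.pos p)] at h2
  rw [VRes_apply w h3, VRes_apply w h3, Module.End.mul_apply, Module.End.mul_apply,
    shiftEquiv_torusOp k h1 h2, shiftEquiv_permRep]

theorem shiftEigenvalue_injOn (t : ℕ) {l l' : ℕ} (hl : l < eNumber lam) (hl' : l' < eNumber lam)
    (h : shiftEigenvalue lam (l + t) = shiftEigenvalue lam (l' + t)) : l = l' := by
  rw [shiftEigenvalue_eq_pow, shiftEigenvalue_eq_pow, pow_add, pow_add] at h
  exact (Complex.isPrimitiveRoot_exp _ (NeZero.ne _)).pow_inj hl hl'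
    (mul_right_cancel₀ (pow_ne_zero _ (Complex.exp_ne_zero _)) h)

variable (c : (EuclideanSpace ℂ (Fin n) ≃ₗᵢ[ℂ] EuclideanSpace ℂ (Fin n)) → ℂ)

/-- The decomposition of `Δ(V(μ))` over `H_c(G(r, p, n))`. -/
theorem exists_standardModule_VRes_equiv (mu : MultiPartition p d n) (t e : ℕ)
    (he : eNumber mu = e) :
    ∃ f : StandardModule (imprimitiveGroup (p * d) p n) c (VRes mu) ≃+
        ⨁ l : Fin e, StandardModule (imprimitiveGroup (p * d) p n) c (VBarRep mu (l + t)),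
      ∀ (a : CherednikAlgebra (imprimitiveGroup (p * d) p n) c) m, f (a • m) = a • f m := by
  subst he
  -- The projection is regarded as a map onto `VBarMod mu l`; linearity and all later identities are
  -- checked after the injective map `VBarIncl`.
  have hpr : ∀ l : ℕ, ∃ q : VMod mu →ₗ[ℂ] VBarMod mu l,
      ∀ v, VBarIncl mu l (q v) = VBarProj mu l v := by
    intro l
    choose q hq using fun v => exists_VBarIncl_eq (VBarProj_mem (lam := mu) l v)
    refine ⟨⟨⟨q, fun u v => ?_⟩, fun a v => ?_⟩, hq⟩
    · exact VBarIncl_injective l (by rw [map_add, hq, hq, hq, map_add])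
    · exact VBarIncl_injective l (by rw [map_smul, hq, hq, map_smul, RingHom.id_apply])
  choose q hq using hpr
  refine exists_standardModule_equiv_directSum c (VRes mu) (fun l : Fin (eNumber mu) => VBarMod mu (l + t))
    (fun l => VBarRep mu (l + t)) (fun l => VBarIncl mu (l + t)) (fun l => q (l + t))
    (fun l g x => VBarIncl_VBarRep _ g x) (fun l g v => ?_) (fun l x => ?_) (fun l l' hne x => ?_)
    (fun v => ?_)
  · refine VBarIncl_injective _ ?_
    rw [hq, VBarIncl_VBarRep, hq, ← Module.End.mul_apply, ← (commute_VRes_VBarProj _ g).eq,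
      Module.End.mul_apply]
  · refine VBarIncl_injective _ ?_
    rw [hq, VBarProj_of_mem (VBarIncl_mem x)]
  · refine VBarIncl_injective _ ?_
    rw [hq, map_zero]
    exact VBarProj_of_mem_ne (fun h => hne (Fin.ext (shiftEigenvalue_injOn t l.2 l'.2 h)))
      (VBarIncl_mem x)
  · simp only [hq]
    rw [← LinearMap.sum_apply, Fin.sum_univ_eq_sum_range fun l => VBarProj mu (l + t), sum_VBarProj,
      Module.End.one_apply]

theorem RestrictsTo.trans_equiv {A B : Type*} [Ring A] [Algebra ℂ A] [Ring B] [Algebra ℂ B]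
    {φ : A →ₐ[ℂ] B} {M N N' : Type*} [AddCommGroup M] [Module B M] [AddCommGroup N] [Module A N]
    [AddCommGroup N'] [Module A N'] (h : RestrictsTo φ M N)
    (h' : ∃ f : N ≃+ N', ∀ (a : A) m, f (a • m) = a • f m) : RestrictsTo φ M N' := by
  obtain ⟨f, hf⟩ := h
  obtain ⟨f', hf'⟩ := h'
  exact ⟨f.trans f', fun a m => by
    rw [AddEquiv.trans_apply, hf, hf', AddEquiv.trans_apply]⟩

variable [NeZero d]

/-- The restriction of `Δ(V(λ))` to `H_c(G(r, p, n))` is `Δ(V(μ))`, for `μ` in the class of `λ`. -/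
theorem restrictsTo_VRes
    (hinv : ∀ w ∈ imprimitiveGroup (p * d) 1 n, ∀ g ∈ imprimitiveGroup (p * d) 1 n,
      IsReflection g → c (w * g * w⁻¹) = c g)
    (hc : ∀ g ∈ imprimitiveGroup (p * d) 1 n, IsReflection g →
      g ∉ imprimitiveGroup (p * d) p n → c g = 0) (h : CyclicEquiv lam mu) :
    RestrictsTo (CherednikAlgebra.incl c (imprimitiveGroup_le (p * d) p n) hc)
      (StandardModule (imprimitiveGroup (p * d) 1 n) c (VRep lam))
      (StandardModule (imprimitiveGroup (p * d) p n) c (VRes mu)) := by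
  obtain ⟨e, he⟩ := h.exists_equiv
  exact (restrictsTo_standardModule c (imprimitiveGroup_le (p * d) p n) hc
    (imprimitiveGroup_normal (p * d) p n) hinv (VRep lam)).trans_equiv
    (exists_standardModule_equiv c (VRes lam) (VRes mu) e he)

/-- The parameters `t` and `e` serve both parts of the theorem: `t = 1` with `e = eNumber lam`, and
`t = 0` with the numeral `2` for type `D`. -/
theorem restrictsTo_directSum
    (hinv : ∀ w ∈ imprimitiveGroup (p * d) 1 n, ∀ g ∈ imprimitiveGroup (p * d) 1 n,
      IsReflection g → c (w * g * w⁻¹) = c g)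
    (hc : ∀ g ∈ imprimitiveGroup (p * d) 1 n, IsReflection g →
      g ∉ imprimitiveGroup (p * d) p n → c g = 0) (h : CyclicEquiv lam mu) (t e : ℕ)
    (he : eNumber lam = e) :
    RestrictsTo (CherednikAlgebra.incl c (imprimitiveGroup_le (p * d) p n) hc)
      (StandardModule (imprimitiveGroup (p * d) 1 n) c (VRep lam))
      (⨁ l : Fin e, StandardModule (imprimitiveGroup (p * d) p n) c (VBarRep mu (l + t))) :=
  (restrictsTo_VRes c hinv hc h).trans_equiv
    (exists_standardModule_VRes_equiv c mu t e (h.eNumber_eq.trans he))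

end Restriction

/-! ### The case of `W(B_n)` and `W(D_n)`. -/

theorem shift_eq_self_iff_of_two {n : ℕ} (lam : MultiPartition 2 1 n) :
    MultiPartition.shift lam = lam ↔ lam.shape 0 0 = lam.shape 1 0 := by
  constructor
  · intro h
    exact (congrFun (congrFun (congrArg MultiPartition.shape h) 0) 0).symm
  · intro h
    refine MultiPartition.ext (funext fun i => funext fun j => ?_)
    rw [Subsingleton.elim j 0]
    fin_cases i
    · exact h.symm
    · exact h

/-- The orbit length divides the prime `2`, and it is one exactly when the shift, which exchanges
the two diagrams, fixes `λ`. -/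
theorem eNumber_of_two {n : ℕ} (lam : MultiPartition 2 1 n) :
    (lam.shape 0 0 = lam.shape 1 0 ∧ eNumber lam = 2) ∨
      (lam.shape 0 0 ≠ lam.shape 1 0 ∧ eNumber lam = 1) := by
  have h := shift_iterate_eq_self_iff lam 1
  rw [Function.iterate_one, shift_eq_self_iff_of_two, Nat.dvd_one] at h
  have h2 := eNumber_mul lam
  rcases (Nat.dvd_prime Nat.prime_two).1 (orbitLength_dvd lam) with h3 | h3
  · left
    rw [h3, mul_one] at h2
    exact ⟨h.2 h3, h2⟩
  · right
    rw [h3] at h2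
    exact ⟨fun h4 => by have := h.1 h4; omega, by omega⟩

end ImprimitiveCherednik

open ImprimitiveCherednik in
theorem mainTheorem9 :
    (∀ (p d n : ℕ) [NeZero p] [NeZero d] [NeZero n]
      (c : (EuclideanSpace ℂ (Fin n) ≃ₗᵢ[ℂ] EuclideanSpace ℂ (Fin n)) → ℂ)
      (_ : ∀ w ∈ imprimitiveGroup (p * d) 1 n, ∀ g ∈ imprimitiveGroup (p * d) 1 n,
        IsReflection g → c (w * g * w⁻¹) = c g)
      (hc : ∀ g ∈ imprimitiveGroup (p * d) 1 n, IsReflection g →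
        g ∉ imprimitiveGroup (p * d) p n → c g = 0)
      (lam mu : MultiPartition p d n) (_ : CyclicEquiv lam mu),
      (∀ l : Fin (eNumber lam), (VBarRep mu (l + 1)).IsIrreducible) ∧
      RestrictsTo (CherednikAlgebra.incl c (imprimitiveGroup_le (p * d) p n) hc)
        (StandardModule (imprimitiveGroup (p * d) 1 n) c (VRep lam))
        (⨁ l : Fin (eNumber lam), StandardModule (imprimitiveGroup (p * d) p n) c
          (VBarRep mu (l + 1)))) ∧
    (∀ (n : ℕ) [NeZero n]
      (c : (EuclideanSpace ℂ (Fin n) ≃ₗᵢ[ℂ] EuclideanSpace ℂ (Fin n)) → ℂ)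
      (_ : ∀ w ∈ imprimitiveGroup (2 * 1) 1 n, ∀ g ∈ imprimitiveGroup (2 * 1) 1 n,
        IsReflection g → c (w * g * w⁻¹) = c g)
      (hc : ∀ g ∈ imprimitiveGroup (2 * 1) 1 n, IsReflection g →
        g ∉ imprimitiveGroup (2 * 1) 2 n → c g = 0)
      (lam mu : MultiPartition 2 1 n) (_ : CyclicEquiv lam mu),
      (eNumber lam = 2 ↔ lam.shape 0 0 = lam.shape 1 0) ∧
      (lam.shape 0 0 ≠ lam.shape 1 0 →
        (VRes mu).IsIrreducible ∧
        RestrictsTo (CherednikAlgebra.incl c (imprimitiveGroup_le (2 * 1) 2 n) hc)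
          (StandardModule (imprimitiveGroup (2 * 1) 1 n) c (VRep lam))
          (StandardModule (imprimitiveGroup (2 * 1) 2 n) c (VRes mu))) ∧
      (lam.shape 0 0 = lam.shape 1 0 →
        (∀ l : Fin 2, (VBarRep mu l).IsIrreducible) ∧
        RestrictsTo (CherednikAlgebra.incl c (imprimitiveGroup_le (2 * 1) 2 n) hc)
          (StandardModule (imprimitiveGroup (2 * 1) 1 n) c (VRep lam))
          (⨁ l : Fin 2, StandardModule (imprimitiveGroup (2 * 1) 2 n) c (VBarRep mu l)))) := by
  refine ⟨fun p d n _ _ _ c hinv hc lam mu h => ⟨fun l => isIrreducible_VBarRep mu _,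
    restrictsTo_directSum c hinv hc h 1 _ rfl⟩, fun n _ c hinv hc lam mu h => ?_⟩
  rcases eNumber_of_two lam with ⟨h1, h2⟩ | ⟨h1, h2⟩
  · exact ⟨iff_of_true h2 h1, fun h3 => absurd h1 h3, fun _ =>
      ⟨fun l => isIrreducible_VBarRep mu l, restrictsTo_directSum c hinv hc h 0 2 h2⟩⟩
  · exact ⟨iff_of_false (by rw [h2]; decide) h1,
      fun _ => ⟨isIrreducible_VRes (h.eNumber_eq.trans h2), restrictsTo_VRes c hinv hc h⟩,
      fun h3 => absurd h3 h1⟩
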